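/- **Setting: the linear quantum $\lambda$-calculus.** Fix a finite set of symbols $\mathsf U$, each with an arity $n\ge 1$ and denoting a unitary operator on $n$ qubits. Types are $A,B::=\mathbb B\mid\mathbb Q\mid A\multimap B\mid A\otimes B$, and terms are $$t,u,v::=x\mid r\mid \lambda x^A.t\mid tu\mid\langle t,u\rangle\mid \mathsf{let}\,\langle x,y\rangle=t\,\mathsf{in}\,u\mid\mathsf{new}\mid\mathsf{tt}\mid\mathsf{ff}\mid\mathsf{meas}\mid\mathsf U\mid\mathsf{if}\,t\,\mathsf{then}\,u\,\mathsf{else}\,v$$ with $r$ ranging over quantum variables; terms are linearly typed by judgments $\Theta,V\vdash t:A$ ($\Theta$ types $\lambda$-variables, $V$ is a finite set of quantum variables, contexts of different premises are disjoint and used exactly), where the branches of an $\mathsf{if}$ are typed in the empty context, $\mathsf{new}:\mathbb Q$, $\mathsf{meas}:\mathbb Q\multimap\mathbb B$, $\mathsf U_n:\mathbb Q^{\otimes n}\multimap\mathbb Q^{\otimes n}$. Bound variables of abstractions carry their type, so a judgment determines its derivation. Values are $a,b::=r\mid\lambda x^A.t\mid\langle a,b\rangle\mid\mathsf{new}\mid\mathsf{tt}\mid\mathsf{ff}\mid\mathsf{meas}\mid\mathsf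 U$; evaluation contexts are $E::=[\cdot]\mid E\,t\mid a\,E\mid\langle E,t\rangle\mid\langle a,E\rangle\mid\mathsf{let}\,\langle x,y\rangle=E\,\mathsf{in}\,t\mid\mathsf{if}\,E\,\mathsf{then}\,t\,\mathsf{else}\,u$. A *quantum closure* of type $A$ is a pair $[Q,t]$ with $V\vdash t:A$ and $Q$ a normalized vector of the Hilbert space with basis $\{0,1\}^V$, modulo renaming of quantum variables. One-step reduction $\mapsto$ relates closures to finite distributions: $[Q,E[(\lambda x^A.t)u]]\mapsto\{[Q,E[t\{u/x\}]]^1\}$; $[Q,E[\mathsf{let}\,\langle x,y\rangle=\langle t,u\rangle\,\mathsf{in}\,v]]\mapsto\{[Q,E[v\{t,u/x,y\}]]^1\}$; $\mathsf{if}\,\mathsf{tt}$ and $\mathsf{if}\,\mathsf{ff}$ select the first and the second branch; $[Q,E[\mathsf{new}]]\mapsto\{[Q\otimes|r\leftarrow0\rangle,E[r]]^1\}$ with $r$ fresh; $[Q,E[\mathsf U_n\langle r_1,\dots,r_n\rangle]]\mapsto\{[\mathsf U_n^{r_1,\dots,r_n}(Q),E[\langle r_1,\dots,r_n\rangle]]^1\}$;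 and $[Q,E[\mathsf{meas}\,r]]\mapsto\{[Q_0,E[\mathsf{tt}]]^{p_0},[Q_1,E[\mathsf{ff}]]^{p_1}\}$, where $p_b$ is the probability of observing $b$ for $r$ in $Q$, $Q_b$ is the normalized resulting state on $V\setminus\{r\}$, and outcomes of probability $0$ are omitted. Multi-step reduction $\Rightarrow$ is generated by: $C\Rightarrow\{C^1\}$; and if $C\mapsto\{D_1^{p_1},\dots,D_n^{p_n}\}$ and $D_i\Rightarrow\mathscr D_i$ for all $i$, then $C\Rightarrow\sum_ip_i\mathscr D_i$. **Setting: quantum nets.** A QSMLL *structure* is a graph with edges labelled by formulas of multiplicative linear logic with units, built from $\mathsf{ax}$, $\mathsf{cut}$, $\otimes$, $\wp$ (par) and $\mathsf{one}$ links, *sync* links (with corresponding premises $e_i$ and conclusions $f_i$ of the same formula, positive, $P::=1\mid P\otimes P$, or negative, $N::=\bot\mid N\wp N$, labelled by a unitary operator whose arity is the number of atoms of the formulas), and boxes of conclusions $\bot,\Gamma$ that contain two structures of conclusions $\Gamma$. It is a *net* if its depth-$0$ graph (boxes being nodes without premises) has no cyclic switching path, i.e. no simple cycle using at most one premise of each $\wp$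 and at most one out-edge (positive conclusion or negative premise) of each sync link, and the contents of its boxes are nets. A *quantum net* is a net together with a normalized register $Q$ whose variables correspond to some of its $\mathsf{one}$ links of depth $0$; quantum nets are taken up to isomorphism. One-step reduction $\hookrightarrow$ acts at depth $0$ by the rules $\mathsf{ax}/\mathsf{cut}$ and $\otimes/\wp $; the commutations of sync links with $\otimes$, $\wp$, $\mathsf{ax}$ (from the positive to the negative conclusion) and $\mathsf{cut}$ (from the negative to the positive premise), all with probability $1$ and $Q$ unchanged; and the following rules: a $\mathsf{one}$ link not associated with the register becomes associated with a fresh variable $r$, and $Q$ becomes $Q\otimes|r\leftarrow0\rangle$; a sync link labelled $U$ whose premises are conclusions of $\mathsf{one}$ links associated with $r_1,\dots,r_n$ is erased, and $Q$ becomes $U^{r_1,\dots,r_n}(Q)$; if the lock of a box is cut against a $\mathsf{one}$ link associated with $r$, then $r$ is measured, and with probability $p_b$ the box is opened with its first content and $Q_0$ (for $b=0$) or its second content and $Q_1$ (for $b=1$). Multi-step reduction $\leadsto$ is generated from $\hookrightarrow$ as $\Rightarrow$ is from $\mapsto$. **Translation.** Put $\langle\mathbb B\rangle=\langle\mathbb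 Q\rangle=1$, $\langle A\multimap B\rangle=\langle A\rangle^\bot\wp \langle B\rangle$, $\langle A\otimes B\rangle=\langle A\rangle\otimes\langle B\rangle$. The derivation of $x_1:A_1,\dots,x_k:A_k,V\vdash t:B$ is translated to a net with conclusions $\langle A_1\rangle^\bot,\dots,\langle A_k\rangle^\bot,\langle B\rangle$: a variable is an axiom; $\lambda$ is a $\wp$ link, a pair a $\otimes$ link; an application $tu$ is a cut of $\langle t\rangle$ with the $\otimes$ of $\langle u\rangle$ and an axiom; a $\mathsf{let}$ is a cut of $\langle t\rangle$ with the $\wp$ of the conclusions of $\langle u\rangle$ for $x,y$; $r$ is a $\mathsf{one}$ link associated with $r$, $\mathsf{new}$ an unassociated $\mathsf{one}$ link; $\mathsf{tt}$ and $\mathsf{ff}$ are an unassociated $\mathsf{one}$ link followed by a sync link labelled by the identity, respectively by the negation gate $X$; $\mathsf U_n$ is the $\wp$ of the conclusions of an axiom on $1^{\otimes n}$ whose positive conclusion is followed by a sync link labelled $\mathsf U_n$; $\mathsf{meas}$ is the $\wp$ of the two conclusions of a box with contents $\langle\mathsf{tt}\rangle,\langle\mathsf{ff}\rangle$; $\mathsf{if}\,t\,\mathsf{then}\,u\,\mathsf{else}\,v$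 is the cut of $\langle t\rangle$ with the lock of a box with contents $\langle u\rangle,\langle v\rangle$. For a closure $C=[Q,t]$ of type $A$, $\langle C\rangle$ is the translation of $t$ with the register $Q$, and $\langle\mathscr D\rangle$ is the image of the distribution $\mathscr D$ under $\langle\cdot\rangle$. **Proposition (Simulation).** For every quantum closure $C$ of type $A$, $\langle C\rangle$ is a quantum net; and for every distribution $\mathscr D$ of quantum closures of type $A$, if $C\Rightarrow\mathscr D$, then $\langle C\rangle\leadsto\langle\mathscr D\rangle$. -/

import Mathlib

open scoped NNReal

noncomputable section

namespace QSMLL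

/-! ## Finite distributions and multi-step probabilistic reduction

A finite distribution written `{x₁^p₁, …, xₙ^pₙ}` is given as the list `[(p₁, x₁), …, (pₙ, xₙ)]`;
distributions as functions are finitely supported functions `X →₀ ℝ≥0`. -/

/-- Multi-step reduction generated by a one-step relation between points and distributions:
`x` reduces to `{x^1}`; and if `x` steps to `{y₁^p₁, …, yₙ^pₙ}` and every `yᵢ` reduces to `Eᵢ`,
then `x` reduces to `∑ᵢ pᵢ • Eᵢ`. -/
inductive Multi {X : Type*} (step : X → List (ℝ≥0 × X) → Prop) : X → (X →₀ ℝ≥0) → Prop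
  | refl (x : X) : Multi step x (Finsupp.single x 1)
  | step (x : X) (l : List (ℝ≥0 × X)) (E : Fin l.length → X →₀ ℝ≥0) :
      step x l → (∀ i, Multi step (l.get i).2 (E i)) →
      Multi step x (∑ i, (l.get i).1 • E i)

/-- Push a listed distribution forward along a map. -/
def mapList {X Y : Type*} (f : X → Y) (l : List (ℝ≥0 × X)) : List (ℝ≥0 × Y) :=
  l.map (fun q => (q.1, f q.2))

/-! ## Quantum registers

For a finite set `V` of quantum variables, a basis vector of `ℍ(SUB(V))`, that is, a function
`V → {0,1}`, is encoded by the set `s ⊆ V` of the variables to which it assigns `1`.  A vector is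
the function `Q` of its coordinates, zero on the sets that are not contained in `V`. -/

/-- Coordinates of a register. -/
abbrev Reg : Type := Finset ℕ → ℂ

namespace Reg

/-- `Q` is a normalized vector of `ℍ(SUB(V))`. -/
def IsState (V : Finset ℕ) (Q : Reg) : Prop :=
  (∀ s, ¬ s ⊆ V → Q s = 0) ∧ ∑ s ∈ V.powerset, ‖Q s‖ ^ 2 = 1

/-- `Q ⊗ |r ← 0⟩`, where `r` is a variable that is not in the register `Q`. -/
def addZero (Q : Reg) (r : ℕ) : Reg := fun s => if r ∈ s then 0 else Q s

/-- The probability of observing the bit `b` when measuring `r` in `Q`. -/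
def prob (V : Finset ℕ) (Q : Reg) (r : ℕ) (b : Bool) : ℝ≥0 :=
  ∑ s ∈ V.powerset.filter (fun s => decide (r ∈ s) = b), ‖Q s‖₊ ^ 2

/-- The state, on the variables `V \ {r}`, after the bit `b` has been observed for `r`: the
projection of `Q` into the subspace in which `r` is assigned to `b`, normalized. -/
def proj (V : Finset ℕ) (Q : Reg) (r : ℕ) (b : Bool) : Reg := fun s =>
  if r ∈ s then 0
  else Q (if b then insert r s else s) / (Real.sqrt (prob V Q r b) : ℂ)

/-- Overwrite the bits of the variables `rs 0, …, rs (n-1)` by `y 0, …, y (n-1)`. -/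
def setBits {n : ℕ} (rs : Fin n → ℕ) (y : Fin n → Bool) (s : Finset ℕ) : Finset ℕ :=
  (s \ Finset.univ.image rs) ∪ (Finset.univ.filter (fun i => y i = true)).image rs

/-- The operator `U` on `n` qubits applied to the (distinct) variables `rs 0, …, rs (n-1)`. -/
def apply {n : ℕ} (U : Matrix (Fin n → Bool) (Fin n → Bool) ℂ) (rs : Fin n → ℕ) (Q : Reg) : Reg :=
  fun s => ∑ y : Fin n → Bool, U (fun i => decide (rs i ∈ s)) y * Q (setBits rs y s)

/-- Change the names of the quantum variables along a bijection. -/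
def rename (τ : Equiv.Perm ℕ) (Q : Reg) : Reg := fun s => Q (s.map τ.symm.toEmbedding)

end Reg

/-- The unitary operators on `n` qubits. -/
abbrev QGate (n : ℕ) : Type := Matrix.unitaryGroup (Fin n → Bool) ℂ

/-- The distribution of the outcomes of a measurement; outcomes of probability `0` are left out. -/
def measList {X : Type*} (p : Bool → ℝ≥0) (x : Bool → X) : List (ℝ≥0 × X) :=
  open Classical in
  ([false, true].filter (fun b => decide (p b ≠ 0))).map (fun b => (p b, x b))

/-! ## The linear quantum λ-calculus -/

/-- A finite set of symbols, each denoting a unitary operator of positive arity. -/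
structure GateSet where
  Op : Type
  finite : Finite Op
  arity : Op → ℕ
  arity_pos : ∀ u, 0 < arity u
  den : ∀ u, QGate (arity u)

/-- Types `A, B ::= 𝔹 | ℚ | A ⊸ B | A ⊗ B`. -/
inductive Ty : Type
  | bool : Ty
  | qbit : Ty
  | arr : Ty → Ty → Ty
  | tens : Ty → Ty → Ty

/-- `A^{⊗ n} = A ⊗ (A ⊗ ⋯ )`, for `n ≥ 1`. -/
def Ty.pow (A : Ty) : ℕ → Ty
  | 0 => A
  | 1 => A
  | n + 2 => .tens A (Ty.pow A (n + 1))

/-- Terms.  λ-variables are de Bruijn indices; quantum variables are named by natural numbers.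
Abstractions `λx:A. t` carry the type of the bound variable, so that a typing judgment determines
its derivation and typable terms stand for type derivations.  In `letp t u`, i.e.
`let ⟨x, y⟩ = t in u`, the index `0` of `u` is `y` and the index `1` is `x`. -/
inductive Tm (G : GateSet) : Type
  | var : ℕ → Tm G
  | qvar : ℕ → Tm G
  | lam : Ty → Tm G → Tm G
  | app : Tm G → Tm G → Tm G
  | pair : Tm G → Tm G → Tm G
  | letp : Tm G → Tm G → Tm G
  | new : Tm G
  | tt : Tm G
  | ff : Tm G
  | meas : Tm G
  | gate : G.Op → Tm G
  | ite : Tm G → Tm G → Tm G → Tm G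

/-- Extend a map on de Bruijn indices with a value for the innermost variable. -/
def scons {α : Type*} (a : α) (f : ℕ → α) : ℕ → α
  | 0 => a
  | n + 1 => f n

/-- Environments: partial maps from λ-variables to types. -/
abbrev Ctx : Type := ℕ → Option Ty

/-- The empty environment. -/
def Ctx.nil : Ctx := fun _ => none

/-- `Γ` is the disjoint union of `Γ₁` and `Γ₂`. -/
def Ctx.Split (Γ Γ₁ Γ₂ : Ctx) : Prop :=
  ∀ i, (Γ₁ i = Γ i ∧ Γ₂ i = none) ∨ (Γ₁ i = none ∧ Γ₂ i = Γ i)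

/-- Typing judgments `Γ, V ⊢ t : A`, with `Γ` an environment and `V` a set of quantum variables. -/
inductive HasType {G : GateSet} : Ctx → Finset ℕ → Tm G → Ty → Prop
  | var (i : ℕ) (A : Ty) : HasType (Function.update Ctx.nil i (some A)) ∅ (.var i) A
  | qvar (r : ℕ) : HasType Ctx.nil {r} (.qvar r) .qbit
  | lam {Γ V A B t} : HasType (scons (some A) Γ) V t B → HasType Γ V (.lam A t) (.arr A B)
  | app {Γ Γ₁ Γ₂ V₁ V₂ A B t u} : Ctx.Split Γ Γ₁ Γ₂ → Disjoint V₁ V₂ →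
      HasType Γ₁ V₁ t (.arr A B) → HasType Γ₂ V₂ u A → HasType Γ (V₁ ∪ V₂) (.app t u) B
  | pair {Γ Γ₁ Γ₂ V₁ V₂ A B t u} : Ctx.Split Γ Γ₁ Γ₂ → Disjoint V₁ V₂ →
      HasType Γ₁ V₁ t A → HasType Γ₂ V₂ u B → HasType Γ (V₁ ∪ V₂) (.pair t u) (.tens A B)
  | letp {Γ Γ₁ Γ₂ V₁ V₂ A B C t u} : Ctx.Split Γ Γ₁ Γ₂ → Disjoint V₁ V₂ →
      HasType Γ₁ V₁ t (.tens A B) → HasType (scons (some B) (scons (some A) Γ₂)) V₂ u C →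
      HasType Γ (V₁ ∪ V₂) (.letp t u) C
  | new : HasType Ctx.nil ∅ .new .qbit
  | tt : HasType Ctx.nil ∅ .tt .bool
  | ff : HasType Ctx.nil ∅ .ff .bool
  | meas : HasType Ctx.nil ∅ .meas (.arr .qbit .bool)
  | gate (u : G.Op) : HasType Ctx.nil ∅ (.gate u)
      (.arr (Ty.pow .qbit (G.arity u)) (Ty.pow .qbit (G.arity u)))
  | ite {Γ V A t u v} : HasType Γ V t .bool → HasType Ctx.nil ∅ u A → HasType Ctx.nil ∅ v A →
      HasType Γ V (.ite t u v) A

namespace Tm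

variable {G : GateSet}

/-- Apply `g` to the quantum variables. -/
def mapQ (g : ℕ → ℕ) : Tm G → Tm G
  | var i => var i
  | qvar r => qvar (g r)
  | lam A t => lam A (mapQ g t)
  | app t u => app (mapQ g t) (mapQ g u)
  | pair t u => pair (mapQ g t) (mapQ g u)
  | letp t u => letp (mapQ g t) (mapQ g u)
  | new => new
  | tt => tt
  | ff => ff
  | meas => meas
  | gate a => gate a
  | ite t u v => ite (mapQ g t) (mapQ g u) (mapQ g v)

/-- Replace the index `k` by a term `s` without free λ-variables (no λ-variable is free in a redex
of a closure, so that `s` never has to be lifted), and lower the indices above `k`. -/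
def subst (s : Tm G) : ℕ → Tm G → Tm G
  | k, var i => if i = k then s else if k < i then var (i - 1) else var i
  | _, qvar r => qvar r
  | k, lam A t => lam A (subst s (k + 1) t)
  | k, app t u => app (subst s k t) (subst s k u)
  | k, pair t u => pair (subst s k t) (subst s k u)
  | k, letp t u => letp (subst s k t) (subst s (k + 2) u)
  | _, new => new
  | _, tt => tt
  | _, ff => ff
  | _, meas => meas
  | _, gate a => gate a
  | k, ite t u v => ite (subst s k t) (subst s k u) (subst s k v)

/-- Values. -/
inductive IsValue : Tm G → Prop
  | qvar (r : ℕ) : IsValue (qvar r)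
  | lam (A : Ty) (t : Tm G) : IsValue (lam A t)
  | pair {a b : Tm G} : IsValue a → IsValue b → IsValue (pair a b)
  | new : IsValue new
  | tt : IsValue tt
  | ff : IsValue ff
  | meas : IsValue meas
  | gate (u : G.Op) : IsValue (gate u)

/-- The tuple `⟨r₁, ⟨r₂, ⋯ rₙ⟩⟩` of quantum variables, for `n ≥ 1`. -/
def tuple : List ℕ → Tm G
  | [] => tt
  | [r] => qvar r
  | r :: r' :: rs => pair (qvar r) (tuple (r' :: rs))

end Tm

/-- Evaluation contexts `E ::= [·] | E t | a E | ⟨E, t⟩ | ⟨a, E⟩ | let ⟨x,y⟩ = E in t |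
if E then t else u`, with `a` a value. -/
inductive EvalCtx (G : GateSet) : Type
  | hole : EvalCtx G
  | appL : EvalCtx G → Tm G → EvalCtx G
  | appR (a : Tm G) : a.IsValue → EvalCtx G → EvalCtx G
  | pairL : EvalCtx G → Tm G → EvalCtx G
  | pairR (a : Tm G) : a.IsValue → EvalCtx G → EvalCtx G
  | letp : EvalCtx G → Tm G → EvalCtx G
  | ite : EvalCtx G → Tm G → Tm G → EvalCtx G

/-- `E[t]`. -/
def EvalCtx.fill {G : GateSet} : EvalCtx G → Tm G → Tm G
  | hole, t => t
  | appL E u, t => .app (E.fill t) u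
  | appR a _ E, t => .app a (E.fill t)
  | pairL E u, t => .pair (E.fill t) u
  | pairR a _ E, t => .pair a (E.fill t)
  | letp E u, t => .letp (E.fill t) u
  | ite E u v, t => .ite (E.fill t) u v

/-- A register together with a term: `[Q, t]`, with `V` the set of variables of `Q`. -/
structure Raw (G : GateSet) where
  V : Finset ℕ
  Q : Reg
  t : Tm G

namespace Raw

variable {G : GateSet}

/-- Rename the quantum variables of a closure, in the register and in the term. -/
def rename (τ : Equiv.Perm ℕ) (c : Raw G) : Raw G :=
  ⟨c.V.map τ.toEmbedding, c.Q.rename τ, c.t.mapQ τ⟩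

/-- `[Q, t]` is a quantum closure of type `A`: `Q` is normalized in `ℍ(SUB(V))` and `V ⊢ t : A`. -/
def IsClosure (A : Ty) (c : Raw G) : Prop :=
  c.Q.IsState c.V ∧ HasType Ctx.nil c.V c.t A

/-- One-step reduction. -/
inductive Step : Raw G → List (ℝ≥0 × Raw G) → Prop
  | beta (V Q) (E : EvalCtx G) (A t u) :
      Step ⟨V, Q, E.fill (.app (.lam A t) u)⟩ [(1, ⟨V, Q, E.fill (Tm.subst u 0 t)⟩)]
  | letp (V Q) (E : EvalCtx G) (t u v) :
      Step ⟨V, Q, E.fill (.letp (.pair t u) v)⟩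
        [(1, ⟨V, Q, E.fill (Tm.subst t 0 (Tm.subst u 0 v))⟩)]
  | iteTT (V Q) (E : EvalCtx G) (t u) :
      Step ⟨V, Q, E.fill (.ite .tt t u)⟩ [(1, ⟨V, Q, E.fill t⟩)]
  | iteFF (V Q) (E : EvalCtx G) (t u) :
      Step ⟨V, Q, E.fill (.ite .ff t u)⟩ [(1, ⟨V, Q, E.fill u⟩)]
  | new (V Q) (E : EvalCtx G) (r) : r ∉ V →
      Step ⟨V, Q, E.fill .new⟩ [(1, ⟨insert r V, Q.addZero r, E.fill (.qvar r)⟩)]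
  | gate (V Q) (E : EvalCtx G) (a : G.Op) (rs : Fin (G.arity a) → ℕ) :
      Step ⟨V, Q, E.fill (.app (.gate a) (Tm.tuple (List.ofFn rs)))⟩
        [(1, ⟨V, Reg.apply (G.den a).1 rs Q, E.fill (Tm.tuple (List.ofFn rs))⟩)]
  | meas (V Q) (E : EvalCtx G) (r) :
      Step ⟨V, Q, E.fill (.app .meas (.qvar r))⟩
        (measList (Reg.prob V Q r) (fun b =>
          ⟨V.erase r, Reg.proj V Q r b, E.fill (if b then .ff else .tt)⟩))

end Raw

/-- Quantum closures of type `A`, modulo renaming of quantum variables. -/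
def Closure (G : GateSet) (A : Ty) : Type :=
  Quot (fun c d : {c : Raw G // c.IsClosure A} => ∃ τ : Equiv.Perm ℕ, d.1 = c.1.rename τ)

namespace Closure

variable {G : GateSet} {A : Ty}

/-- The quantum closure represented by `[Q, t]`. -/
def mk (c : {c : Raw G // c.IsClosure A}) : Closure G A := Quot.mk _ c

/-- One-step reduction `C ↦ 𝒟`. -/
def Step (C : Closure G A) (l : List (ℝ≥0 × Closure G A)) : Prop :=
  ∃ (c : {c : Raw G // c.IsClosure A}) (m : List (ℝ≥0 × {c : Raw G // c.IsClosure A})),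
    mk c = C ∧ c.1.Step (mapList Subtype.val m) ∧ mapList mk m = l

/-- Multi-step reduction `C ⇒ 𝒟`. -/
def Reduces : Closure G A → (Closure G A →₀ ℝ≥0) → Prop := Multi Step

end Closure

/-! ## Formulas and structures -/

/-- Formulas of multiplicative linear logic with units. -/
inductive Formula : Type
  | one : Formula
  | bot : Formula
  | var : ℕ → Formula
  | nvar : ℕ → Formula
  | tens : Formula → Formula → Formula
  | par : Formula → Formula → Formula
  deriving DecidableEq

namespace Formula

/-- Linear negation. -/
def neg : Formula → Formula
  | one => bot
  | bot => one
  | var n => nvar n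
  | nvar n => var n
  | tens A B => par A.neg B.neg
  | par A B => tens A.neg B.neg

/-- Positive formulas `P ::= 1 | P ⊗ P`. -/
def isPos : Formula → Bool
  | one => true
  | tens A B => A.isPos && B.isPos
  | _ => false

/-- Negative formulas `N ::= ⊥ | N ⅋ N`. -/
def isNeg : Formula → Bool
  | bot => true
  | par A B => A.isNeg && B.isNeg
  | _ => false

/-- The number of occurrences of atoms. -/
def atoms : Formula → ℕ
  | tens A B => A.atoms + B.atoms
  | par A B => A.atoms + B.atoms
  | _ => 1

end Formula

/-- Edges: a name (names are lists of numbers, which makes it easy to choose fresh ones) and the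
formula that labels the edge. -/
structure Edge : Type where
  name : List ℕ
  ty : Formula
  deriving DecidableEq

/-- Links (nodes) of structures with boxes, given with their conclusions and premises.
* `ax a b`: an axiom with conclusions `a`, `b`;  `cut a b`: a cut with premises `a`, `b`;
* `tens a b c`, `par a b c`: premises `a`, `b` and conclusion `c`;
* `one q e`: a link of sort `one` with conclusion `e`; `q = some r` says that the variable `r` of
  the quantum register is associated with the link, `q = none` that none is;
* `sync U [(e₁, f₁), …]`: a synchronization link labelled with the unitary operator `U`, with
  premises `e₁, …` and corresponding conclusions `f₁, …`;
* `box l Γ R S`: a box with lock `l` and other conclusions `Γ`, that contains the two structures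
  `R`, `S`, both with conclusions `Γ`. -/
inductive Link : Type
  | ax : Edge → Edge → Link
  | cut : Edge → Edge → Link
  | tens : Edge → Edge → Edge → Link
  | par : Edge → Edge → Edge → Link
  | one : Option ℕ → Edge → Link
  | sync : {n : ℕ} → QGate n → List (Edge × Edge) → Link
  | box : Edge → List Edge → List Link → List Link → Link

mutual
/-- Apply `f` to all edges and `g` to all quantum variables, inside boxes too. -/
def Link.map (f : Edge → Edge) (g : ℕ → ℕ) : Link → Link
  | .ax a b => .ax (f a) (f b)
  | .cut a b => .cut (f a) (f b)
  | .tens a b c => .tens (f a) (f b) (f c)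
  | .par a b c => .par (f a) (f b) (f c)
  | .one q e => .one (q.map g) (f e)
  | .sync U io => .sync U (io.map (fun x => (f x.1, f x.2)))
  | .box l Γ R S => .box (f l) (Γ.map f) (Link.mapList f g R) (Link.mapList f g S)
/-- The same for lists of links. -/
def Link.mapList (f : Edge → Edge) (g : ℕ → ℕ) : List Link → List Link
  | [] => []
  | x :: L => Link.map f g x :: Link.mapList f g L
end

mutual
/-- All edges attached to a link, including the edges in boxes. -/
def Link.edges : Link → List Edge
  | .ax a b => [a, b]
  | .cut a b => [a, b]
  | .tens a b c => [a, b, c]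
  | .par a b c => [a, b, c]
  | .one _ e => [e]
  | .sync _ io => io.map Prod.fst ++ io.map Prod.snd
  | .box l Γ R S => l :: Γ ++ Link.edgesList R ++ Link.edgesList S
/-- The same for lists of links. -/
def Link.edgesList : List Link → List Edge
  | [] => []
  | x :: L => Link.edges x ++ Link.edgesList L
end

mutual
/-- The conclusions of a link and those of the links in boxes; conclusions of the contents of a
box are counted only once, as conclusions of the box. -/
def Link.sources : Link → List Edge
  | .ax a b => [a, b]
  | .cut _ _ => []
  | .tens _ _ c => [c]
  | .par _ _ c => [c]
  | .one _ e => [e]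
  | .sync _ io => io.map Prod.snd
  | .box l Γ R S => l :: Γ ++ (Link.sourcesList R).filter (fun e => decide (e ∉ Γ)) ++
      (Link.sourcesList S).filter (fun e => decide (e ∉ Γ))
/-- The same for lists of links. -/
def Link.sourcesList : List Link → List Edge
  | [] => []
  | x :: L => Link.sources x ++ Link.sourcesList L
end

mutual
/-- The quantum variables associated with `one` links, at all depths. -/
def Link.qvars : Link → List ℕ
  | .one (some r) _ => [r]
  | .box _ _ R S => Link.qvarsList R ++ Link.qvarsList S
  | _ => []
/-- The same for lists of links. -/
def Link.qvarsList : List Link → List ℕ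
  | [] => []
  | x :: L => Link.qvars x ++ Link.qvarsList L
end

namespace Link

/-- The quantum variable associated with a `one` link. -/
def qvar? : Link → Option ℕ
  | one q _ => q
  | _ => none

/-- Premises of a node of the `0`-graph, where boxes count as nodes without premises. -/
def prems : Link → List Edge
  | cut a b => [a, b]
  | tens a b _ => [a, b]
  | par a b _ => [a, b]
  | sync _ io => io.map Prod.fst
  | _ => []

/-- Conclusions of a node of the `0`-graph. -/
def concls : Link → List Edge
  | ax a b => [a, b]
  | cut _ _ => []
  | tens _ _ c => [c]
  | par _ _ c => [c]
  | one _ e => [e]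
  | sync _ io => io.map Prod.snd
  | box l Γ _ _ => l :: Γ

/-- Edges of which a switching path uses at most one: the premises of a `par` link; the out-edges
of a sync link, that is, its positive conclusions and its negative premises. -/
def exclusive : Link → List Edge
  | par a b _ => [a, b]
  | sync _ io => io.map (fun x => if x.1.ty.isPos then x.2 else x.1)
  | _ => []

/-- The labels of the edges at a link are as the sort of the link requires. -/
def Typed : Link → Prop
  | ax a b => b.ty = a.ty.neg
  | cut a b => b.ty = a.ty.neg
  | tens a b c => c.ty = .tens a.ty b.ty
  | par a b c => c.ty = .par a.ty b.ty
  | one _ e => e.ty = .one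
  | sync (n := n) _ io =>
      (∀ x ∈ io, x.1.ty = x.2.ty ∧ (x.1.ty.isPos = true ∨ x.1.ty.isNeg = true)) ∧
      n = (io.map (fun x => x.1.ty.atoms)).sum
  | box l _ _ _ => l.ty = .bot

end Link

/-! ## Correctness -/

/-- The edge `e` joins the nodes `i` and `j` of the `0`-graph of `L`. -/
def Joins (L : List Link) (e : Edge) (i j : Fin L.length) : Prop :=
  (e ∈ (L.get i).concls ∧ e ∈ (L.get j).prems) ∨ (e ∈ (L.get j).concls ∧ e ∈ (L.get i).prems)

/-- There is a cyclic switching path in the `0`-graph of `L`: distinct nodes `v 0, …, v k` and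
distinct edges `e 0, …, e k`, with `e j` joining `v j` to the (cyclically) next node, that use at
most one of the premises of each `par` link and at most one out-edge of each sync link. -/
def SwitchingCycle (L : List Link) : Prop :=
  ∃ (k : ℕ) (v : Fin (k + 1) → Fin L.length) (e : Fin (k + 1) → Edge),
    Function.Injective v ∧ Function.Injective e ∧ (∀ j, Joins L (e j) (v j) (v (j + 1))) ∧
    ∀ x ∈ L, ∀ a ∈ x.exclusive, ∀ b ∈ x.exclusive,
      a ∈ Set.range e → b ∈ Set.range e → a = b

/-- `L` is a correct structure (a net) with conclusions `Γ`.  The conditions say: the labels fit;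
edges are distinct, inside and outside the boxes, and each is the conclusion of one link; each edge
of the `0`-graph is either the premise of one link or pending, the pending edges being `Γ`; the
`0`-graph has no switching cycle; and the contents of the boxes are correct. -/
inductive Correct : List Link → List Edge → Prop
  | intro (L : List Link) (Γ : List Edge) :
      (∀ x ∈ L, x.Typed) →
      (Link.sourcesList L).Nodup →
      (L.flatMap Link.prems ++ Γ).Perm (L.flatMap Link.concls) →
      ¬ SwitchingCycle L →
      (∀ l Δ R S, Link.box l Δ R S ∈ L → Correct R Δ) →
      (∀ l Δ R S, Link.box l Δ R S ∈ L → Correct S Δ) →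
      Correct L Γ

/-! ## Quantum nets -/

/-- A structure (links and conclusions) with a quantum register `Q` on the variables `V`. -/
structure QStruct : Type where
  links : List Link
  concl : List Edge
  V : Finset ℕ
  Q : Reg

/-- `N` is a quantum net: its structure is correct, `Q` is normalized in `ℍ(SUB(V))`, and the
variables in `V` correspond bijectively to some `one` links, all of depth `0`. -/
structure QStruct.IsNet (N : QStruct) : Prop where
  correct : Correct N.links N.concl
  state : N.Q.IsState N.V
  nodup : (N.links.filterMap Link.qvar?).Nodup
  vars : (N.links.filterMap Link.qvar?).toFinset = N.V
  depth : ∀ l Γ R S, Link.box l Γ R S ∈ N.links →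
    Link.qvarsList R = [] ∧ Link.qvarsList S = []

/-- Presentations of the same graph: the links are listed in another order, or the two edges at an
axiom or a cut are exchanged, inside boxes too. -/
inductive SameLinks : List Link → List Link → Prop
  | perm {L L'} : L.Perm L' → SameLinks L L'
  | ax (a b L) : SameLinks (.ax a b :: L) (.ax b a :: L)
  | cut (a b L) : SameLinks (.cut a b :: L) (.cut b a :: L)
  | box (l Γ L) {R R' S S'} : SameLinks R R' → SameLinks S S' →
      SameLinks (.box l Γ R S :: L) (.box l Γ R' S' :: L)
  | trans {L L' L''} : SameLinks L L' → SameLinks L' L'' → SameLinks L L''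

/-- Isomorphism: other presentations of the same graph, label-preserving injective renaming of the
edges, and renaming of the variables of the register. -/
inductive QStruct.Iso : QStruct → QStruct → Prop
  | same {L L'} (Γ V Q) : SameLinks L L' → QStruct.Iso ⟨L, Γ, V, Q⟩ ⟨L', Γ, V, Q⟩
  | edges (L Γ V Q) (f : Edge → Edge) : (∀ e, (f e).ty = e.ty) →
      Set.InjOn f {e | e ∈ Link.edgesList L ∨ e ∈ Γ} →
      QStruct.Iso ⟨L, Γ, V, Q⟩ ⟨Link.mapList f id L, Γ.map f, V, Q⟩
  | qvars (L Γ V Q) (τ : Equiv.Perm ℕ) :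
      QStruct.Iso ⟨L, Γ, V, Q⟩ ⟨Link.mapList id τ L, Γ, V.map τ.toEmbedding, Reg.rename τ Q⟩

/-- Quantum structures up to isomorphism. -/
def QNet : Type := Quot QStruct.Iso

/-- The class of a quantum structure. -/
def QNet.mk (N : QStruct) : QNet := Quot.mk _ N

/-- The class consists of quantum nets. -/
def QNet.IsNet (n : QNet) : Prop := ∃ N : QStruct, QNet.mk N = n ∧ N.IsNet

/-- `e` does not occur in `L` or in `Γ`. -/
def FreshEdge (e : Edge) (L : List Link) (Γ : List Edge) : Prop :=
  e ∉ Link.edgesList L ∧ e ∉ Γ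

/-- One-step reduction, at depth `0`.  The links displayed are the redex, `K` are the others. -/
inductive QStruct.Step : QStruct → List (ℝ≥0 × QStruct) → Prop
  /-- `ax/cut`: the edges `a` and `c` become one edge -/
  | axCut (a b c K Γ V Q) : a ≠ c →
      QStruct.Step ⟨.cut a b :: .ax b c :: K, Γ, V, Q⟩
        [(1, ⟨Link.mapList (Function.update id a c) id K, Γ, V, Q⟩)]
  /-- `⊗/⅋` -/
  | tensPar (a b c a' b' c' K Γ V Q) :
      QStruct.Step ⟨.cut c c' :: .tens a b c :: .par a' b' c' :: K, Γ, V, Q⟩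
        [(1, ⟨.cut a a' :: .cut b b' :: K, Γ, V, Q⟩)]
  /-- `sync/⊗` -/
  | syncTens (a b c f a' b' K Γ V Q) {n : ℕ} (U : QGate n) (io₁ io₂) :
      a'.ty = a.ty → b'.ty = b.ty → a' ≠ b' →
      FreshEdge a' (.tens a b c :: .sync U (io₁ ++ (c, f) :: io₂) :: K) Γ →
      FreshEdge b' (.tens a b c :: .sync U (io₁ ++ (c, f) :: io₂) :: K) Γ →
      QStruct.Step ⟨.tens a b c :: .sync U (io₁ ++ (c, f) :: io₂) :: K, Γ, V, Q⟩
        [(1, ⟨.tens a' b' f :: .sync U (io₁ ++ (a, a') :: (b, b') :: io₂) :: K, Γ, V, Q⟩)]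
  /-- `sync/⅋` -/
  | syncPar (a b c f a' b' K Γ V Q) {n : ℕ} (U : QGate n) (io₁ io₂) :
      a'.ty = a.ty → b'.ty = b.ty → a' ≠ b' →
      FreshEdge a' (.par a b c :: .sync U (io₁ ++ (c, f) :: io₂) :: K) Γ →
      FreshEdge b' (.par a b c :: .sync U (io₁ ++ (c, f) :: io₂) :: K) Γ →
      QStruct.Step ⟨.par a b c :: .sync U (io₁ ++ (c, f) :: io₂) :: K, Γ, V, Q⟩
        [(1, ⟨.par a' b' f :: .sync U (io₁ ++ (a, a') :: (b, b') :: io₂) :: K, Γ, V, Q⟩)]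
  /-- `ax/sync`: from the positive to the negative conclusion of an axiom -/
  | syncAx (e f g g' K Γ V Q) {n : ℕ} (U : QGate n) (io₁ io₂) :
      e.ty.isPos = true → g'.ty = g.ty →
      FreshEdge g' (.ax e g :: .sync U (io₁ ++ (e, f) :: io₂) :: K) Γ →
      QStruct.Step ⟨.ax e g :: .sync U (io₁ ++ (e, f) :: io₂) :: K, Γ, V, Q⟩
        [(1, ⟨.ax f g' :: .sync U (io₁ ++ (g', g) :: io₂) :: K, Γ, V, Q⟩)]
  /-- `cut/sync`: from the negative to the positive premise of a cut -/
  | syncCut (e f g g' K Γ V Q) {n : ℕ} (U : QGate n) (io₁ io₂) :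
      f.ty.isNeg = true → g'.ty = g.ty →
      FreshEdge g' (.cut f g :: .sync U (io₁ ++ (e, f) :: io₂) :: K) Γ →
      QStruct.Step ⟨.cut f g :: .sync U (io₁ ++ (e, f) :: io₂) :: K, Γ, V, Q⟩
        [(1, ⟨.cut e g' :: .sync U (io₁ ++ (g, g') :: io₂) :: K, Γ, V, Q⟩)]
  /-- a `one` link without quantum variable is linked to a new variable with value `0` -/
  | new (e r K Γ V Q) : r ∉ V →
      QStruct.Step ⟨.one none e :: K, Γ, V, Q⟩
        [(1, ⟨.one (some r) e :: K, Γ, insert r V, Reg.addZero Q r⟩)]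
  /-- a sync link all of whose premises come from `one` links linked to the register -/
  | syncOne {n : ℕ} (U : QGate n) (rs : Fin n → ℕ) (es fs : Fin n → Edge) (K Γ V Q) :
      QStruct.Step
        ⟨.sync U (List.ofFn (fun i => (es i, fs i))) ::
          (List.ofFn (fun i => Link.one (some (rs i)) (es i)) ++ K), Γ, V, Q⟩
        [(1, ⟨List.ofFn (fun i => Link.one (some (rs i)) (fs i)) ++ K, Γ, V,
          Reg.apply U.1 rs Q⟩)]
  /-- opening a box: the variable linked to the `one` link is measured, and the outcome `0`
  (`false`) selects the first content, the outcome `1` (`true`) the second -/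
  | box (r e l Δ R S K Γ V Q) :
      QStruct.Step ⟨.cut e l :: .one (some r) e :: .box l Δ R S :: K, Γ, V, Q⟩
        (measList (Reg.prob V Q r) (fun b =>
          ⟨(if b then S else R) ++ K, Γ, V.erase r, Reg.proj V Q r b⟩))

/-- One-step reduction of quantum nets. -/
def QNet.Step (n : QNet) (l : List (ℝ≥0 × QNet)) : Prop :=
  ∃ (N : QStruct) (m : List (ℝ≥0 × QStruct)),
    QNet.mk N = n ∧ N.Step m ∧ mapList QNet.mk m = l

/-- Multi-step reduction of quantum nets to distributions of quantum nets. -/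
def QNet.Reduces : QNet → (QNet →₀ ℝ≥0) → Prop := Multi QNet.Step

/-! ## The translation -/

/-- Translation of types. -/
def Ty.toFormula : Ty → Formula
  | .bool => .one
  | .qbit => .one
  | .arr A B => .par A.toFormula.neg B.toFormula
  | .tens A B => .tens A.toFormula B.toFormula

/-- The identity gate. -/
def gateI : QGate 1 := 1

/-- The matrix of the negation gate. -/
def matX : Matrix (Fin 1 → Bool) (Fin 1 → Bool) ℂ := fun a b => if a 0 = b 0 then 0 else 1

/-- The negation gate. -/
def gateX : QGate 1 := ⟨matX, by
  rw [Matrix.mem_unitaryGroup_iff]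
  ext a b
  have e : ∀ f : (Fin 1 → Bool) → ℂ, ∑ y, f y = f (fun _ => true) + f (fun _ => false) := fun f => by
    rw [← (Equiv.funUnique (Fin 1) Bool).symm.sum_comp]
    have h : ∀ b : Bool, (Equiv.funUnique (Fin 1) Bool).symm b = fun _ => b := fun b => by
      ext i; rw [Subsingleton.elim i default]; rfl
    simp [h]
  have hab : a = b ↔ a 0 = b 0 := ⟨fun h => by rw [h], fun h => by
    ext i; rw [Subsingleton.elim i 0, h]⟩
  rw [Matrix.mul_apply, e, Matrix.one_apply]
  cases ha : a 0 <;> cases hb : b 0 <;> simp [matX, Matrix.star_apply, hab, ha, hb]⟩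

variable {G : GateSet}

/-- The type of the unique derivation for `t`, given the types of the free λ-variables. -/
def tyOf : (ℕ → Ty) → Tm G → Ty
  | Γ, .var i => Γ i
  | _, .qvar _ => .qbit
  | Γ, .lam A t => .arr A (tyOf (scons A Γ) t)
  | Γ, .app t _ => match tyOf Γ t with
    | .arr _ B => B
    | _ => .bool
  | Γ, .pair t u => .tens (tyOf Γ t) (tyOf Γ u)
  | Γ, .letp t u => match tyOf Γ t with
    | .tens A B => tyOf (scons B (scons A Γ)) u
    | _ => .bool
  | _, .new => .qbit
  | _, .tt => .bool
  | _, .ff => .bool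
  | _, .meas => .arr .qbit .bool
  | _, .gate a => .arr (Ty.pow .qbit (G.arity a)) (Ty.pow .qbit (G.arity a))
  | _, .ite _ u _ => tyOf (fun _ => .bool) u

/-- The two components of a tensor type. -/
def Ty.components : Ty → Ty × Ty
  | .tens A B => (A, B)
  | _ => (.bool, .bool)

/-- A name and a type for each free λ-variable; the edge for a variable `x : A` with name `p` is
labelled by `⟨A⟩^⊥`. -/
abbrev Env : Type := ℕ → List ℕ × Ty

/-- The environment for terms without free λ-variables. -/
def Env.nil : Env := fun _ => ([], .bool)

/-- The types in an environment. -/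
def Env.tys (ρ : Env) : ℕ → Ty := fun i => (ρ i).2

/-- Nets for truth values: a `one` link followed by a sync link labelled by `I` for `tt` and by `X`
for `ff`; `p` is the name of the edge in between, `o` the name of the conclusion. -/
def bitNet (U : QGate 1) (p o : List ℕ) : List Link :=
  [.one none ⟨p, .one⟩, .sync U [(⟨p, .one⟩, ⟨o, .one⟩)]]

/-- The translation of the type derivation of `t`, with edges named after the position `p`: the
conclusion for the variable `i` is the edge with name and type given by `ρ i`, and the conclusion
for the type of `t` is named `o`. -/
def translate : Env → List ℕ → List ℕ → Tm G → List Link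
  | ρ, _, o, .var i =>
      [.ax ⟨(ρ i).1, (ρ i).2.toFormula.neg⟩ ⟨o, (ρ i).2.toFormula⟩]
  | _, _, o, .qvar r => [.one (some r) ⟨o, .one⟩]
  | ρ, p, o, .lam A t =>
      let ρ' : Env := scons (1 :: p, A) ρ
      let B := (tyOf ρ'.tys t).toFormula
      .par ⟨1 :: p, A.toFormula.neg⟩ ⟨0 :: p, B⟩ ⟨o, .par A.toFormula.neg B⟩ ::
        translate ρ' (0 :: p) (0 :: p) t
  | ρ, p, o, .app t u =>
      let A := (tyOf ρ.tys u).toFormula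
      let B := (tyOf ρ.tys (.app t u)).toFormula
      .cut ⟨0 :: p, (tyOf ρ.tys t).toFormula⟩ ⟨3 :: p, .tens A B.neg⟩ ::
        .tens ⟨1 :: p, A⟩ ⟨2 :: p, B.neg⟩ ⟨3 :: p, .tens A B.neg⟩ ::
        .ax ⟨2 :: p, B.neg⟩ ⟨o, B⟩ ::
        (translate ρ (0 :: p) (0 :: p) t ++ translate ρ (1 :: p) (1 :: p) u)
  | ρ, p, o, .pair t u =>
      let A := (tyOf ρ.tys t).toFormula
      let B := (tyOf ρ.tys u).toFormula
      .tens ⟨0 :: p, A⟩ ⟨1 :: p, B⟩ ⟨o, .tens A B⟩ ::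
        (translate ρ (0 :: p) (0 :: p) t ++ translate ρ (1 :: p) (1 :: p) u)
  | ρ, p, o, .letp t u =>
      let AB := tyOf ρ.tys t
      let A := AB.components.1
      let B := AB.components.2
      let C : Formula := .par A.toFormula.neg B.toFormula.neg
      .cut ⟨0 :: p, AB.toFormula⟩ ⟨3 :: p, C⟩ ::
        .par ⟨1 :: p, A.toFormula.neg⟩ ⟨2 :: p, B.toFormula.neg⟩ ⟨3 :: p, C⟩ ::
        (translate ρ (0 :: p) (0 :: p) t ++
          translate (scons (2 :: p, B) (scons (1 :: p, A) ρ)) (4 :: p) o u)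
  | _, _, o, .new => [.one none ⟨o, .one⟩]
  | _, p, o, .tt => bitNet gateI (0 :: p) o
  | _, p, o, .ff => bitNet gateX (0 :: p) o
  | _, p, o, .meas =>
      [.par ⟨0 :: p, .bot⟩ ⟨1 :: p, .one⟩ ⟨o, .par .bot .one⟩,
        .box ⟨0 :: p, .bot⟩ [⟨1 :: p, .one⟩]
          (bitNet gateI (2 :: p) (1 :: p)) (bitNet gateX (3 :: p) (1 :: p))]
  | _, p, o, .gate a =>
      let P := (Ty.pow .qbit (G.arity a)).toFormula
      [.par ⟨0 :: p, P.neg⟩ ⟨2 :: p, P⟩ ⟨o, .par P.neg P⟩,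
        .ax ⟨0 :: p, P.neg⟩ ⟨1 :: p, P⟩,
        .sync (G.den a) [(⟨1 :: p, P⟩, ⟨2 :: p, P⟩)]]
  | ρ, p, o, .ite t u v =>
      let A := (tyOf Env.nil.tys u).toFormula
      .cut ⟨0 :: p, .one⟩ ⟨1 :: p, .bot⟩ ::
        .box ⟨1 :: p, .bot⟩ [⟨o, A⟩]
          (translate Env.nil (2 :: p) o u) (translate Env.nil (3 :: p) o v) ::
        translate ρ (0 :: p) (0 :: p) t

/-- The quantum structure of a closure `[Q, t]` of type `A`. -/
def Raw.toQStruct (A : Ty) (c : Raw G) : QStruct :=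
  ⟨translate Env.nil [] [] c.t, [⟨[], A.toFormula⟩], c.V, c.Q⟩

theorem tyOf_mapQ (g : ℕ → ℕ) (Γ : ℕ → Ty) (t : Tm G) : tyOf Γ (t.mapQ g) = tyOf Γ t := by
  induction t generalizing Γ <;> simp_all [Tm.mapQ, tyOf]

theorem mapList_append (f : Edge → Edge) (g : ℕ → ℕ) (L L' : List Link) :
    Link.mapList f g (L ++ L') = Link.mapList f g L ++ Link.mapList f g L' := by
  induction L <;> simp_all [Link.mapList]

theorem translate_mapQ (g : ℕ → ℕ) (ρ : Env) (p o : List ℕ) (t : Tm G) :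
    translate ρ p o (t.mapQ g) = Link.mapList id g (translate ρ p o t) := by
  induction t generalizing ρ p o <;>
    simp_all [Tm.mapQ, translate, Link.mapList, Link.map, mapList_append, tyOf_mapQ, bitNet, tyOf]

/-- The translation of quantum closures into quantum nets. -/
def Closure.toNet {A : Ty} : Closure G A → QNet :=
  Quot.lift (fun c => QNet.mk (c.1.toQStruct A)) (by
    rintro ⟨⟨V, Q, t⟩, hc⟩ ⟨d, hd⟩ ⟨τ, rfl⟩
    refine Quot.sound ?_
    have h := QStruct.Iso.qvars (translate Env.nil [] [] t) [⟨[], A.toFormula⟩] V Q τ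
    rw [← translate_mapQ] at h
    exact h)

end QSMLL

end

/-!
An edge of a translation is named by the path from the root to the subterm that introduces it.
So the edges of a subterm are those whose names extend its position, and freshness, disjointness and
the invariance of the surrounding net under a renaming are read off from names.

*Correctness.* A translation is built by the rules of the sequent calculus, and these preserve the
absence of closed walks that use pairwise distinct edges and at most one exclusive edge of each
link: either the new link leaves no way to return, or the walk would have to use two of its
exclusive premises.

*Simulation.* The translation of `E[t]` is the net of `t` plugged into a context that depends on
`t` only through its type, so it suffices to reduce redexes in an arbitrary context.
For `β` and `let`, a cut between `⊗` and `⅋` becomes two cuts of nets against axioms; because typing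
is linear, eliminating such a cut is substitution. A truth value is a new `one` link followed by
the gate `I` or `X`; it reduces to a variable with a definite value, which is also how a conditional
chooses its branch with probability one. The sync link of a gate moves from the conclusion of its
axiom through the `⊗` tree of the tuple to the `one` links, where it acts on the register.
-/

noncomputable section

namespace QSMLL

/-! ## Links and their edges -/

namespace Link

theorem mem_edgesList {L : List Link} {e : Edge} : e ∈ edgesList L ↔ ∃ x ∈ L, e ∈ x.edges := by
  induction L <;> simp_all [edgesList]

theorem edgesList_append (L L' : List Link) :
    edgesList (L ++ L') = edgesList L ++ edgesList L' := by
  induction L <;> simp_all [edgesList]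

theorem sourcesList_append (L L' : List Link) :
    sourcesList (L ++ L') = sourcesList L ++ sourcesList L' := by
  induction L <;> simp_all [sourcesList]

theorem sourcesList_perm {L L' : List Link} (h : L.Perm L') :
    (sourcesList L).Perm (sourcesList L') := by
  have sourcesList_eq (K : List Link) : sourcesList K = K.flatMap sources := by
    induction K <;> simp_all [sourcesList]
  simpa only [sourcesList_eq] using h.flatMap_right sources

theorem qvarsList_append (L L' : List Link) :
    qvarsList (L ++ L') = qvarsList L ++ qvarsList L' := by
  induction L <;> simp_all [qvarsList]

mutual
theorem sources_subset : ∀ x : Link, x.sources ⊆ x.edges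
  | .ax _ _ | .cut _ _ | .tens _ _ _ | .par _ _ _ | .one _ _ | .sync _ _ => by
    simp [sources, edges]
  | .box l Γ R S => by
    intro e he
    simp only [sources, edges, List.mem_append, List.mem_filter] at he ⊢
    exact he.imp (Or.imp_right fun h => sourcesList_subset R h.1)
      fun h => sourcesList_subset S h.1
theorem sourcesList_subset : ∀ L : List Link, sourcesList L ⊆ edgesList L
  | [] => by simp [sourcesList]
  | x :: L => by
    intro e he
    simp only [sourcesList, edgesList, List.mem_append] at he ⊢
    exact he.imp (fun h => sources_subset x h) fun h => sourcesList_subset L h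
end

theorem concls_sublist_sources (x : Link) : x.concls.Sublist x.sources := by
  cases x <;> simp [concls, sources]

theorem flatMap_concls_sublist_sourcesList (L : List Link) :
    (L.flatMap concls).Sublist (sourcesList L) := by
  induction L with
  | nil => simp
  | cons x L ih => simpa [sourcesList] using x.concls_sublist_sources.append ih

mutual
theorem map_congr {f f' : Edge → Edge} {g : ℕ → ℕ} :
    ∀ x : Link, (∀ e ∈ x.edges, f e = f' e) → x.map f g = x.map f' g
  | .ax _ _, h | .cut _ _, h | .tens _ _ _, h | .par _ _ _, h | .one _ _, h => by
    simp_all [map, edges]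
  | .sync _ io, h => by
    have hio : ∀ x ∈ io, (f x.1, f x.2) = (f' x.1, f' x.2) := fun x hx => by
      rw [h x.1 (List.mem_append_left _ (List.mem_map_of_mem hx)),
        h x.2 (List.mem_append_right _ (List.mem_map_of_mem hx))]
    simp only [map, List.map_congr_left hio]
  | .box l Γ R S, h => by
    simp only [edges, List.mem_append, List.mem_cons] at h
    simp only [map, box.injEq]
    exact ⟨h _ (by simp), List.map_congr_left fun e he => h e (by simp [he]),
      mapList_congr R fun e he => h e (by simp [he]),
      mapList_congr S fun e he => h e (by simp [he])⟩
theorem mapList_congr {f f' : Edge → Edge} {g : ℕ → ℕ} :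
    ∀ L : List Link, (∀ e ∈ edgesList L, f e = f' e) → mapList f g L = mapList f' g L
  | [], _ => rfl
  | x :: L, h => by
    simp only [edgesList, List.mem_append] at h
    simp only [mapList, map_congr x fun e he => h e (Or.inl he),
      mapList_congr L fun e he => h e (Or.inr he)]
end

mutual
theorem map_id_id : ∀ x : Link, x.map id id = x
  | .ax _ _ | .cut _ _ | .tens _ _ _ | .par _ _ _ | .one _ _ | .sync _ _ => by simp [map]
  | .box _ _ R S => by simp [map, mapList_id_id R, mapList_id_id S]
theorem mapList_id_id : ∀ L : List Link, mapList id id L = L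
  | [] => rfl
  | x :: L => by simp [mapList, map_id_id x, mapList_id_id L]
end

theorem mapList_eq_self {f : Edge → Edge} {L : List Link} (h : ∀ e ∈ edgesList L, f e = e) :
    mapList f id L = L := by
  rw [mapList_congr (f' := id) L h, mapList_id_id]

end Link

/-! ## Proof nets by sequent rules -/

namespace Link

/-- The edges at a node of the `0`-graph. -/
def ports (x : Link) : List Edge := x.prems ++ x.concls

/-- The edge `e` joins the nodes `x` and `y`; here nodes are links, not positions in a list. -/
def Joins (e : Edge) (x y : Link) : Prop :=
  (e ∈ x.concls ∧ e ∈ y.prems) ∨ (e ∈ y.concls ∧ e ∈ x.prems)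

theorem Joins.mem_ports_left {e : Edge} {x y : Link} (h : Joins e x y) : e ∈ x.ports :=
  List.mem_append.2 (h.symm.imp And.right And.left)

theorem Joins.mem_ports_right {e : Edge} {x y : Link} (h : Joins e x y) : e ∈ y.ports :=
  List.mem_append.2 (h.imp And.right And.left)

end Link

/-- No closed walk through links of `L` uses pairwise distinct edges and at most one exclusive edge
of each link.  Walks may revisit links, so this is stronger than the absence of switching cycles;
unlike the latter it does not refer to positions in the list `L`. -/
def Acyclic (L : List Link) : Prop :=
  ¬ ∃ (k : ℕ) (v : Fin (k + 1) → Link) (e : Fin (k + 1) → Edge),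
    Function.Injective e ∧ (∀ j, v j ∈ L) ∧ (∀ j, Link.Joins (e j) (v j) (v (j + 1))) ∧
    ∀ x ∈ L, ∀ a ∈ x.exclusive, ∀ b ∈ x.exclusive,
      a ∈ Set.range e → b ∈ Set.range e → a = b

open Fin.NatCast Fin.CommRing in
theorem exists_and_not_succ {k : ℕ} {P : Fin (k + 1) → Prop} {i j : Fin (k + 1)} (hi : P i)
    (hj : ¬ P j) : ∃ l, P l ∧ ¬ P (l + 1) := by
  by_contra! hstep
  have all_after : ∀ n : ℕ, P (i + (n : Fin (k + 1))) := by
    intro n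
    induction n with
    | zero => simpa using hi
    | succ n ih => simpa [add_assoc] using hstep _ ih
  have at_j := all_after (j - i).val
  simp only [Fin.cast_val_eq_self, add_sub_cancel] at at_j
  exact hj at_j

namespace Acyclic

variable {L L' : List Link}

theorem not_switchingCycle (h : Acyclic L) : ¬ SwitchingCycle L := by
  rintro ⟨k, v, e, -, he, hj, hx⟩
  exact h ⟨k, fun j => L.get (v j), e, he, fun j => L.get_mem _, hj, hx⟩

theorem perm (h : Acyclic L) (hL : L.Perm L') : Acyclic L' := by
  rintro ⟨k, v, e, he, hv, hj, hx⟩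
  exact h ⟨k, v, e, he, fun j => hL.mem_iff.2 (hv j), hj, fun x hxL => hx x (hL.mem_iff.1 hxL)⟩

theorem nil : Acyclic [] := by
  rintro ⟨k, v, e, -, hv, -⟩
  exact absurd (hv 0) List.not_mem_nil

theorem singleton {x : Link} (h : x.concls.Disjoint x.prems) : Acyclic [x] := by
  rintro ⟨k, v, e, -, hv, hj, -⟩
  have hv : ∀ j, v j = x := by simpa using hv
  rcases hj 0 with h' | h' <;> rw [hv, hv] at h' <;> exact h h'.1 h'.2

/-- A closed walk that visits both parts crosses between them along two distinct edges. -/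
theorem append (h : Acyclic L) (h' : Acyclic L')
    (hx : ∀ e ∈ L.flatMap Link.ports, e ∈ L'.flatMap Link.ports → ∀ e' ∈ L.flatMap Link.ports,
      e' ∈ L'.flatMap Link.ports → e ≠ e' → ∃ x ∈ L ++ L', e ∈ x.exclusive ∧ e' ∈ x.exclusive) :
    Acyclic (L ++ L') := by
  rintro ⟨k, v, e, he, hv, hj, hex⟩
  by_cases hL : ∀ j, v j ∈ L
  · exact h ⟨k, v, e, he, hL, hj, fun x hxL => hex x (List.mem_append_left _ hxL)⟩
  by_cases hL' : ∀ j, v j ∈ L'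
  · exact h' ⟨k, v, e, he, hL', hj, fun x hxL => hex x (List.mem_append_right _ hxL)⟩
  push Not at hL hL'
  have right_of_not_left : ∀ j, v j ∉ L → v j ∈ L' :=
    fun j hjL => (List.mem_append.1 (hv j)).resolve_left hjL
  obtain ⟨j₁, h₁⟩ := hL
  obtain ⟨j₂, h₂⟩ := hL'
  replace h₂ : v j₂ ∈ L := (List.mem_append.1 (hv j₂)).resolve_right h₂
  obtain ⟨a, ha, ha'⟩ := exists_and_not_succ (P := fun j => v j ∈ L) h₂ h₁
  obtain ⟨b, hb, hb'⟩ := exists_and_not_succ (P := fun j => v j ∉ L) h₁ (not_not.2 h₂)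
  have hab : e a ≠ e b := fun hab => hb (he hab ▸ ha)
  obtain ⟨x, hxL, hxa, hxb⟩ := hx
    (e a) (List.mem_flatMap.2 ⟨_, ha, (hj a).mem_ports_left⟩)
      (List.mem_flatMap.2 ⟨_, right_of_not_left _ ha', (hj a).mem_ports_right⟩)
    (e b) (List.mem_flatMap.2 ⟨_, not_not.1 hb', (hj b).mem_ports_right⟩)
      (List.mem_flatMap.2 ⟨_, right_of_not_left _ hb, (hj b).mem_ports_left⟩) hab
  exact hab (hex x hxL _ hxa _ hxb ⟨a, rfl⟩ ⟨b, rfl⟩)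

theorem append_of_subsingleton (h : Acyclic L) (h' : Acyclic L') {e₀ : Edge}
    (hx : ∀ e ∈ L.flatMap Link.ports, e ∈ L'.flatMap Link.ports → e = e₀) :
    Acyclic (L ++ L') :=
  h.append h' fun e h₁ h₂ e' h₃ h₄ hne => absurd ((hx e h₁ h₂).trans (hx e' h₃ h₄).symm) hne

end Acyclic

/-- A net with conclusions `Γ`.  Compared with `Correct`, acyclicity is strengthened so that nets
are closed under the rules below. -/
structure IsProofNet (L : List Link) (Γ : List Edge) : Prop where
  typed : ∀ x ∈ L, x.Typed
  nodup : (Link.sourcesList L).Nodup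
  balanced : (L.flatMap Link.prems ++ Γ).Perm (L.flatMap Link.concls)
  acyclic : Acyclic L
  boxes : ∀ l Δ R S, Link.box l Δ R S ∈ L → Correct R Δ ∧ Correct S Δ

namespace IsProofNet

variable {L L₁ L₂ : List Link} {Γ Δ : List Edge} {x : Link} {a b : Edge}

theorem correct (h : IsProofNet L Γ) : Correct L Γ :=
  .intro L Γ h.typed h.nodup h.balanced h.acyclic.not_switchingCycle
    (fun l Δ R S hb => (h.boxes l Δ R S hb).1) fun l Δ R S hb => (h.boxes l Δ R S hb).2

theorem perm {L' : List Link} {Γ' : List Edge} (h : IsProofNet L Γ) (hL : L.Perm L')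
    (hΓ : Γ.Perm Γ') : IsProofNet L' Γ' where
  typed x hx := h.typed x (hL.mem_iff.2 hx)
  nodup := (Link.sourcesList_perm hL).nodup_iff.1 h.nodup
  balanced := ((hL.flatMap_right _).symm.append hΓ.symm).trans
    (h.balanced.trans (hL.flatMap_right _))
  acyclic := h.acyclic.perm hL
  boxes l Δ R S hb := h.boxes l Δ R S (hL.mem_iff.2 hb)

theorem perm_concl {Γ' : List Edge} (h : IsProofNet L Γ) (hΓ : Γ.Perm Γ') : IsProofNet L Γ' :=
  h.perm (.refl _) hΓ

theorem concl_nodup (h : IsProofNet L Γ) : Γ.Nodup :=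
  (List.nodup_append.1 (h.balanced.nodup_iff.2
    ((Link.flatMap_concls_sublist_sourcesList L).nodup h.nodup))).2.1

theorem concl_subset (h : IsProofNet L Γ) : Γ ⊆ Link.sourcesList L := fun _ he =>
  (Link.flatMap_concls_sublist_sourcesList L).subset
    (h.balanced.subset (List.mem_append_right _ he))

theorem ports_subset (h : IsProofNet L Γ) : L.flatMap Link.ports ⊆ Link.sourcesList L := by
  intro e he
  apply (Link.flatMap_concls_sublist_sourcesList L).subset
  obtain ⟨x, hx, he⟩ := List.mem_flatMap.1 he
  rcases List.mem_append.1 he with he | he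
  · exact h.balanced.subset (List.mem_append_left _ (List.mem_flatMap.2 ⟨x, hx, he⟩))
  · exact List.mem_flatMap.2 ⟨x, hx, he⟩

theorem nil : IsProofNet [] [] :=
  ⟨by simp, by simp [Link.sourcesList], .refl _, .nil, by simp⟩

theorem append (h₁ : IsProofNet L₁ Γ) (h₂ : IsProofNet L₂ Δ)
    (hd : (Link.sourcesList L₁).Disjoint (Link.sourcesList L₂)) :
    IsProofNet (L₁ ++ L₂) (Γ ++ Δ) where
  typed := List.forall_mem_append.2 ⟨h₁.typed, h₂.typed⟩
  nodup := by
    rw [Link.sourcesList_append]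
    exact h₁.nodup.append h₂.nodup hd
  balanced := by
    simp only [List.flatMap_append]
    refine .trans ?_ (h₁.balanced.append h₂.balanced)
    grind
  acyclic := h₁.acyclic.append h₂.acyclic
    fun _ he he' => absurd (h₂.ports_subset he') (hd (h₁.ports_subset he))
  boxes l Δ R S hb := (List.mem_append.1 hb).elim (h₁.boxes l Δ R S) (h₂.boxes l Δ R S)

/-- The part of the rule for adding a link below `L` that does not depend on how its premises are
connected in `L`. -/
theorem cons_of_acyclic (h : IsProofNet L (x.prems ++ Γ)) (ht : x.Typed) (hn : x.sources.Nodup)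
    (hd : x.sources.Disjoint (Link.sourcesList L))
    (hb : ∀ l Δ R S, Link.box l Δ R S = x → Correct R Δ ∧ Correct S Δ)
    (hac : Acyclic (x :: L)) : IsProofNet (x :: L) (x.concls ++ Γ) where
  typed := List.forall_mem_cons.2 ⟨ht, h.typed⟩
  nodup := hn.append h.nodup hd
  balanced := by
    have := h.balanced
    simp only [List.flatMap_cons]
    grind
  acyclic := hac
  boxes l Δ R S hm := (List.mem_cons.1 hm).elim (hb l Δ R S) (h.boxes l Δ R S)

theorem concls_disjoint_prems (h : IsProofNet L Γ) (hd : x.sources.Disjoint (Link.sourcesList L))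
    (hx : x.prems ⊆ Γ) : x.concls.Disjoint x.prems := fun _ hc hp =>
  hd (x.concls_sublist_sources.subset hc) (h.concl_subset (hx hp))

theorem cons (h : IsProofNet L (x.prems ++ Γ))
    (hex : ∀ e ∈ x.prems, ∀ e' ∈ x.prems, e ≠ e' → e ∈ x.exclusive ∧ e' ∈ x.exclusive)
    (ht : x.Typed) (hn : x.sources.Nodup) (hd : x.sources.Disjoint (Link.sourcesList L))
    (hb : ∀ l Δ R S, Link.box l Δ R S = x → Correct R Δ ∧ Correct S Δ) :
    IsProofNet (x :: L) (x.concls ++ Γ) := by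
  refine h.cons_of_acyclic ht hn hd hb (.append (L := [x])
    (.singleton (h.concls_disjoint_prems hd (by simp))) h.acyclic ?_)
  have mem_prems : ∀ e ∈ [x].flatMap Link.ports, e ∈ L.flatMap Link.ports → e ∈ x.prems := by
    intro e he heL
    rw [List.flatMap_singleton] at he
    exact (List.mem_append.1 he).resolve_right fun hc =>
      hd (x.concls_sublist_sources.subset hc) (h.ports_subset heL)
  exact fun e he heL e' he' heL' hne => ⟨x, by simp,
    hex e (mem_prems e he heL) e' (mem_prems e' he' heL') hne⟩

theorem leaf (hx : x.prems = []) (ht : x.Typed) (hn : x.sources.Nodup)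
    (hb : ∀ l Δ R S, Link.box l Δ R S = x → Correct R Δ ∧ Correct S Δ) :
    IsProofNet [x] x.concls := by
  simpa using cons (x := x) (L := []) (Γ := []) (by simpa [hx] using nil) (by simp [hx]) ht hn
    (by simp [Link.sourcesList]) hb

theorem join (h₁ : IsProofNet L₁ (a :: Γ)) (h₂ : IsProofNet L₂ (b :: Δ)) (hx : x.prems = [a, b])
    (ht : x.Typed) (hn : x.sources.Nodup)
    (hd : (Link.sourcesList L₁).Disjoint (Link.sourcesList L₂))
    (hd₁ : x.sources.Disjoint (Link.sourcesList L₁))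
    (hd₂ : x.sources.Disjoint (Link.sourcesList L₂)) :
    IsProofNet (x :: (L₁ ++ L₂)) (x.concls ++ (Γ ++ Δ)) := by
  have h : IsProofNet (L₁ ++ L₂) (x.prems ++ (Γ ++ Δ)) := by
    rw [hx]
    exact (h₁.append h₂ hd).perm_concl (by grind)
  have hdx : x.sources.Disjoint (Link.sourcesList (L₁ ++ L₂)) := by
    rw [Link.sourcesList_append]
    exact List.disjoint_append_right.2 ⟨hd₁, hd₂⟩
  have ha : a ∈ Link.sourcesList L₁ := h₁.concl_subset (by simp)
  have hb : b ∈ Link.sourcesList L₂ := h₂.concl_subset (by simp)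
  have mem_ports : ∀ e ∈ x.ports, e = a ∨ e = b ∨ e ∈ x.sources := by
    simp only [Link.ports, hx, List.cons_append, List.nil_append, List.mem_cons]
    exact fun e he => he.imp_right (Or.imp_right fun hc => x.concls_sublist_sources.subset hc)
  refine h.cons_of_acyclic ht hn hdx (by rintro l Δ R S rfl; simp [Link.prems] at hx) ?_
  have hx₁ : Acyclic ([x] ++ L₁) := by
    refine .append_of_subsingleton (e₀ := a)
      (.singleton (h.concls_disjoint_prems hdx (by simp))) h₁.acyclic fun e he he₁ => ?_
    replace he₁ := h₁.ports_subset he₁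
    rcases mem_ports e (by simpa using he) with he | rfl | he
    exacts [he, absurd hb (hd he₁), absurd he₁ (hd₁ he)]
  refine hx₁.append_of_subsingleton (e₀ := b) h₂.acyclic fun e he he₂ => ?_
  replace he₂ := h₂.ports_subset he₂
  rw [List.flatMap_append, List.flatMap_singleton, List.mem_append] at he
  rcases he with he | he
  · rcases mem_ports e he with rfl | he | he
    exacts [absurd he₂ (hd ha), he, absurd he₂ (hd₂ he)]
  · exact absurd he₂ (hd (h₁.ports_subset he))

end IsProofNet

/-! ## Positions and environments -/

/-- The entry of the name `z` just before its suffix `p`, if `z` properly extends `p`.  The edges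
named by a translation at position `p` have `branch p` equal to the index of the subterm (or of the
auxiliary edge) to which they belong. -/
def branch (p z : List ℕ) : Option ℕ := if p <:+ z then z.reverse[p.length]? else none

section Branch

variable {p z : List ℕ} {a b : ℕ}

theorem branch_eq_some : branch p z = some a ↔ ∃ w, z = w ++ a :: p := by
  unfold branch
  constructor
  · intro h
    split_ifs at h with hp
    obtain ⟨w, rfl⟩ := hp
    rcases List.eq_nil_or_concat w with rfl | ⟨w, b, rfl⟩
    · simp at h
    · exact ⟨w, by simpa using h⟩
  · rintro ⟨w, rfl⟩
    have hp : p <:+ w ++ a :: p := ⟨w ++ [a], by simp⟩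
    simp [if_pos hp]

@[simp] theorem branch_append (p w : List ℕ) (a : ℕ) : branch p (w ++ a :: p) = some a :=
  branch_eq_some.2 ⟨w, rfl⟩

@[simp] theorem branch_cons_self (p : List ℕ) (a : ℕ) : branch p (a :: p) = some a :=
  branch_append p [] a

@[simp] theorem branch_cons_cons_self (p : List ℕ) (a b : ℕ) :
    branch p (b :: a :: p) = some a :=
  branch_append p [b] a

theorem branch_eq_none_of_length_le (h : z.length ≤ p.length) : branch p z = none := by
  rw [Option.eq_none_iff_forall_ne_some]
  intro a ha
  obtain ⟨w, rfl⟩ := branch_eq_some.1 ha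
  simp at h
  omega

@[simp] theorem branch_self (p : List ℕ) : branch p p = none := branch_eq_none_of_length_le le_rfl

@[simp] theorem branch_nil (p : List ℕ) : branch p [] = none :=
  branch_eq_none_of_length_le (Nat.zero_le _)

theorem branch_of_branch_cons (h : branch (a :: p) z ≠ none) : branch p z = some a := by
  obtain ⟨b, hb⟩ := Option.ne_none_iff_exists'.1 h
  obtain ⟨w, rfl⟩ := branch_eq_some.1 hb
  exact branch_eq_some.2 ⟨w ++ [b], by simp⟩

theorem branch_cons_eq_none (h : branch p z ≠ some a) : branch (a :: p) z = none :=
  of_not_not fun h' => h (branch_of_branch_cons h')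

theorem ne_cons_of_branch_eq_none (h : branch p z = none) (a : ℕ) : z ≠ a :: p := by
  rintro rfl
  simp at h

end Branch

namespace Ctx

variable {Γ Γ₁ Γ₂ : Ctx}

theorem Split.left (h : Split Γ Γ₁ Γ₂) {i : ℕ} {A : Ty} (hi : Γ₁ i = some A) : Γ i = some A := by
  rcases h i with h | h <;> simp_all

theorem Split.right (h : Split Γ Γ₁ Γ₂) {i : ℕ} {A : Ty} (hi : Γ₂ i = some A) : Γ i = some A := by
  rcases h i with h | h <;> simp_all

theorem Split.eq_nil (h : Split nil Γ₁ Γ₂) : Γ₁ = nil ∧ Γ₂ = nil := by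
  constructor <;> funext i <;> rcases h i with h | h <;> simp_all [nil]

end Ctx

/-- The types `τ` agree with the environment `Γ` on its variables. -/
def Agree (Γ : Ctx) (τ : ℕ → Ty) : Prop := ∀ i A, Γ i = some A → τ i = A

namespace Agree

variable {Γ Γ₁ Γ₂ : Ctx} {τ : ℕ → Ty}

theorem nil (τ : ℕ → Ty) : Agree Ctx.nil τ := by simp [Agree, Ctx.nil]

theorem left (h : Agree Γ τ) (hs : Ctx.Split Γ Γ₁ Γ₂) : Agree Γ₁ τ :=
  fun i A hi => h i A (hs.left hi)

theorem right (h : Agree Γ τ) (hs : Ctx.Split Γ Γ₁ Γ₂) : Agree Γ₂ τ :=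
  fun i A hi => h i A (hs.right hi)

theorem scons (h : Agree Γ τ) (A : Ty) :
    Agree (QSMLL.scons (some A) Γ) (QSMLL.scons A τ) := by
  rintro (_ | i) B hi
  · simpa [QSMLL.scons] using hi
  · exact h i B hi

end Agree

namespace Env

@[simp] theorem tys_scons (n : List ℕ) (A : Ty) (ρ : Env) :
    tys (scons (n, A) ρ) = scons A ρ.tys := by
  funext i
  cases i <;> rfl

/-- The conclusion for the variable `i`. -/
def edge (ρ : Env) (i : ℕ) : Edge := ⟨(ρ i).1, (ρ i).2.toFormula.neg⟩

/-- The conclusions for the variables of `Γ`. -/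
def edges (ρ : Env) (Γ : Ctx) : Set Edge := {e | ∃ i A, Γ i = some A ∧ e = ρ.edge i}

variable {ρ : Env} {Γ Γ₁ Γ₂ : Ctx}

@[simp] theorem edges_nil : ρ.edges Ctx.nil = ∅ := by simp [edges, Ctx.nil]

theorem edges_single (i : ℕ) (A : Ty) :
    ρ.edges (Function.update Ctx.nil i (some A)) = {ρ.edge i} := by
  ext e
  simp [edges, Function.update_apply, Ctx.nil]

theorem edges_split (h : Ctx.Split Γ Γ₁ Γ₂) : ρ.edges Γ = ρ.edges Γ₁ ∪ ρ.edges Γ₂ := by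
  ext e
  constructor
  · rintro ⟨i, A, hi, rfl⟩
    rcases h i with ⟨h₁, -⟩ | ⟨-, h₂⟩
    exacts [Or.inl ⟨i, A, h₁.trans hi, rfl⟩, Or.inr ⟨i, A, h₂.trans hi, rfl⟩]
  · rintro (⟨i, A, hi, rfl⟩ | ⟨i, A, hi, rfl⟩)
    exacts [⟨i, A, h.left hi, rfl⟩, ⟨i, A, h.right hi, rfl⟩]

theorem edges_scons (n : List ℕ) (A : Ty) :
    edges (scons (n, A) ρ) (scons (some A) Γ) = insert ⟨n, A.toFormula.neg⟩ (ρ.edges Γ) := by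
  ext e
  constructor
  · rintro ⟨_ | i, B, hi, rfl⟩
    exacts [Or.inl rfl, Or.inr ⟨i, B, hi, rfl⟩]
  · rintro (rfl | ⟨i, B, hi, rfl⟩)
    exacts [⟨0, A, rfl, rfl⟩, ⟨i + 1, B, hi, rfl⟩]

end Env

theorem HasType.tyOf_eq {G : GateSet} {Γ : Ctx} {V : Finset ℕ} {t : Tm G} {B : Ty}
    (h : HasType Γ V t B) {τ : ℕ → Ty} (hτ : Agree Γ τ) : tyOf τ t = B := by
  induction h generalizing τ with
  | var i A => exact hτ i A (by simp)
  | qvar | new | tt | ff | meas | gate => rfl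
  | lam _ ih => simp [tyOf, ih (hτ.scons _)]
  | app hs _ _ _ ih₁ _ => simp [tyOf, ih₁ (hτ.left hs)]
  | pair hs _ _ _ ih₁ ih₂ => simp [tyOf, ih₁ (hτ.left hs), ih₂ (hτ.right hs)]
  | letp hs _ _ _ ih₁ ih₂ =>
    simp [tyOf, ih₁ (hτ.left hs), ih₂ (((hτ.right hs).scons _).scons _)]
  | ite _ _ _ _ ih₂ _ => simp [tyOf, ih₂ (Agree.nil _)]

/-- `ρ` names the variables of `Γ` injectively and with their types; neither these names nor `o` are
below `p`, and `o` is not among them.  These are the environments in which the translation of a term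
at position `p` with conclusion `o` is a net. -/
structure Fits (Γ : Ctx) (ρ : Env) (p o : List ℕ) : Prop where
  agree : Agree Γ ρ.tys
  branch_eq_none : ∀ i A, Γ i = some A → branch p (ρ i).1 = none
  ne_out : ∀ i A, Γ i = some A → (ρ i).1 ≠ o
  inj : ∀ i j A B, Γ i = some A → Γ j = some B → (ρ i).1 = (ρ j).1 → i = j
  branch_out : branch p o = none

namespace Fits

variable {Γ Γ₁ Γ₂ : Ctx} {ρ : Env} {p o : List ℕ}

theorem nil (ρ : Env) (h : branch p o = none) : Fits Ctx.nil ρ p o :=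
  ⟨Agree.nil _, by simp [Ctx.nil], by simp [Ctx.nil], by simp [Ctx.nil], h⟩

theorem mono (h : Fits Γ ρ p o) (hs : ∀ i A, Γ₁ i = some A → Γ i = some A) : Fits Γ₁ ρ p o where
  agree i A hi := h.agree i A (hs i A hi)
  branch_eq_none i A hi := h.branch_eq_none i A (hs i A hi)
  ne_out i A hi := h.ne_out i A (hs i A hi)
  inj i j A B hi hj := h.inj i j A B (hs i A hi) (hs j B hj)
  branch_out := h.branch_out

theorem left (h : Fits Γ ρ p o) (hs : Ctx.Split Γ Γ₁ Γ₂) : Fits Γ₁ ρ p o :=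
  h.mono fun _ _ => hs.left

theorem right (h : Fits Γ ρ p o) (hs : Ctx.Split Γ Γ₁ Γ₂) : Fits Γ₂ ρ p o :=
  h.mono fun _ _ => hs.right

theorem below (h : Fits Γ ρ p o) (c : ℕ) : Fits Γ ρ (c :: p) o :=
  ⟨h.agree, fun i A hi => branch_cons_eq_none (by simp [h.branch_eq_none i A hi]), h.ne_out, h.inj,
    branch_cons_eq_none (by simp [h.branch_out])⟩

theorem name_ne_cons (h : Fits Γ ρ p o) {i : ℕ} {A : Ty} (hi : Γ i = some A) (c : ℕ) :
    (ρ i).1 ≠ c :: p :=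
  ne_cons_of_branch_eq_none (h.branch_eq_none i A hi) c

theorem child (h : Fits Γ ρ p o) (c : ℕ) : Fits Γ ρ (c :: p) (c :: p) :=
  ⟨h.agree, (h.below c).branch_eq_none, fun _ _ hi => h.name_ne_cons hi c, h.inj, branch_self _⟩

theorem scons (h : Fits Γ ρ p o) (A : Ty) {n : List ℕ} (hn : branch p n = none) (hno : n ≠ o)
    (hi : ∀ i A, Γ i = some A → (ρ i).1 ≠ n) :
    Fits (QSMLL.scons (some A) Γ) (QSMLL.scons (n, A) ρ) p o where
  agree := by
    rw [Env.tys_scons]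
    exact h.agree.scons A
  branch_eq_none := by
    rintro (_ | i) B hB
    exacts [hn, h.branch_eq_none i B hB]
  ne_out := by
    rintro (_ | i) B hB
    exacts [hno, h.ne_out i B hB]
  inj := by
    rintro (_ | i) (_ | j) B C hB hC he
    · rfl
    · exact absurd he.symm (hi j C hC)
    · exact absurd he (hi i B hB)
    · exact congrArg _ (h.inj i j B C hB hC he)
  branch_out := h.branch_out

theorem lam (h : Fits Γ ρ p o) (A : Ty) :
    Fits (QSMLL.scons (some A) Γ) (QSMLL.scons (1 :: p, A) ρ) (0 :: p) (0 :: p) :=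
  (h.child 0).scons A (branch_cons_eq_none (by simp)) (by simp) fun _ _ hi => h.name_ne_cons hi 1

theorem letp (h : Fits Γ ρ p o) (A B : Ty) :
    Fits (QSMLL.scons (some B) (QSMLL.scons (some A) Γ))
      (QSMLL.scons (2 :: p, B) (QSMLL.scons (1 :: p, A) ρ)) (4 :: p) o := by
  have ho (a : ℕ) : a :: p ≠ o := (ne_cons_of_branch_eq_none h.branch_out a).symm
  refine ((h.below 4).scons A (branch_cons_eq_none (by simp)) (ho 1)
    fun _ _ hi => h.name_ne_cons hi 1).scons B (branch_cons_eq_none (by simp)) (ho 2) ?_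
  rintro (_ | i) C hi
  exacts [by simp [QSMLL.scons], h.name_ne_cons (i := i) hi 2]

theorem branch_edge (h : Fits Γ ρ p o) {e : Edge} (he : e ∈ ρ.edges Γ) :
    branch p e.name = none := by
  obtain ⟨i, A, hi, rfl⟩ := he
  exact h.branch_eq_none i A hi

theorem edge_ne_out (h : Fits Γ ρ p o) {e : Edge} (he : e ∈ ρ.edges Γ) : e.name ≠ o := by
  obtain ⟨i, A, hi, rfl⟩ := he
  exact h.ne_out i A hi

theorem edges_disjoint (h : Fits Γ ρ p o) (hs : Ctx.Split Γ Γ₁ Γ₂) :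
    Disjoint (ρ.edges Γ₁) (ρ.edges Γ₂) := by
  rw [Set.disjoint_left]
  rintro _ ⟨i, A, hi, rfl⟩ ⟨j, B, hj, he⟩
  obtain rfl := h.inj i j A B (hs.left hi) (hs.right hj) (congrArg Edge.name he)
  rcases hs i with hs | hs <;> simp_all

end Fits

theorem branch_ne_none_of_cons {p z : List ℕ} {c : ℕ} (h : branch (c :: p) z ≠ none) :
    branch p z ≠ none := by
  simp [branch_of_branch_cons h]

theorem HasType.mem_edges {G : GateSet} {Γ : Ctx} {V : Finset ℕ} {t : Tm G} {B : Ty}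
    (h : HasType Γ V t B) {ρ : Env} {p o : List ℕ} (hρ : Agree Γ ρ.tys) {e : Edge}
    (he : e ∈ Link.edgesList (translate ρ p o t)) :
    e = ⟨o, B.toFormula⟩ ∨ branch p e.name ≠ none ∨ e ∈ ρ.edges Γ := by
  induction h generalizing ρ p o with
  | var i A =>
    have hi : (ρ i).2 = A := hρ i A (by simp)
    simp only [translate, Link.edgesList, Link.edges, List.mem_append, List.mem_cons,
      List.not_mem_nil, or_false, hi] at he
    simp only [Env.edges_single, Env.edge, hi, Set.mem_singleton_iff]
    tauto
  | qvar | new | tt | ff | meas | gate =>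
    simp only [translate, bitNet, Link.edgesList, Link.edges, Ty.toFormula, Formula.neg,
      List.mem_append, List.mem_cons, List.map_cons, List.map_nil, List.not_mem_nil,
      or_false] at he ⊢
    grind [branch_cons_self]
  | @lam Γ V A B t h ih =>
    simp only [translate, Link.edgesList, Link.edges, List.mem_append, List.mem_cons,
      List.not_mem_nil, or_false, Env.tys_scons, h.tyOf_eq (hρ.scons A)] at he
    have hA := @ih (scons (1 :: p, A) ρ) (0 :: p) (0 :: p) (by simpa using hρ.scons A)
    rw [Env.edges_scons] at hA
    grind [Ty.toFormula, branch_cons_self, branch_ne_none_of_cons]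
  | @app Γ Γ₁ Γ₂ _ _ A B t u hs _ h₁ h₂ ih₁ ih₂ =>
    have hB := (HasType.app hs ‹_› h₁ h₂).tyOf_eq hρ
    simp only [translate, Link.edgesList, Link.edges, Link.edgesList_append, List.mem_append,
      List.mem_cons, List.not_mem_nil, or_false, hB] at he
    have he₁ := @ih₁ ρ (0 :: p) (0 :: p) (hρ.left hs)
    have he₂ := @ih₂ ρ (1 :: p) (1 :: p) (hρ.right hs)
    rw [Env.edges_split hs]
    grind [branch_cons_self, branch_ne_none_of_cons]
  | @pair Γ Γ₁ Γ₂ _ _ A B t u hs _ h₁ h₂ ih₁ ih₂ =>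
    simp only [translate, Link.edgesList, Link.edges, Link.edgesList_append, List.mem_append,
      List.mem_cons, List.not_mem_nil, or_false, h₁.tyOf_eq (hρ.left hs),
      h₂.tyOf_eq (hρ.right hs)] at he
    have he₁ := @ih₁ ρ (0 :: p) (0 :: p) (hρ.left hs)
    have he₂ := @ih₂ ρ (1 :: p) (1 :: p) (hρ.right hs)
    rw [Env.edges_split hs]
    grind [Ty.toFormula, branch_cons_self, branch_ne_none_of_cons]
  | @letp Γ Γ₁ Γ₂ _ _ A B C t u hs _ h₁ _ ih₁ ih₂ =>
    simp only [translate, Link.edgesList, Link.edges, Link.edgesList_append, List.mem_append,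
      List.mem_cons, List.not_mem_nil, or_false, h₁.tyOf_eq (hρ.left hs), Ty.components] at he
    have he₁ := @ih₁ ρ (0 :: p) (0 :: p) (hρ.left hs)
    have he₂ := @ih₂ (scons (2 :: p, B) (scons (1 :: p, A) ρ)) (4 :: p) o
      (by simpa using ((hρ.right hs).scons A).scons B)
    rw [Env.edges_scons, Env.edges_scons] at he₂
    rw [Env.edges_split hs]
    grind [branch_cons_self, branch_ne_none_of_cons]
  | ite _ h₂ _ ih₁ ih₂ ih₃ =>
    simp only [translate, Link.edgesList, Link.edges, List.mem_append, List.mem_cons,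
      List.not_mem_nil, or_false, h₂.tyOf_eq (Agree.nil _)] at he
    have he₁ := @ih₁ ρ (0 :: p) (0 :: p) hρ
    have he₂ := @ih₂ Env.nil (2 :: p) o (Agree.nil _)
    have he₃ := @ih₃ Env.nil (3 :: p) o (Agree.nil _)
    rw [Env.edges_nil] at he₂ he₃
    grind [branch_cons_self, branch_ne_none_of_cons]

/-! ## Correctness of translations -/

@[simp] theorem Formula.neg_neg (A : Formula) : A.neg.neg = A := by
  induction A <;> simp_all [neg]

/-- `L` is a net whose conclusions are the elements of `S`, in any order. -/
def ProofNetOn (L : List Link) (S : Set Edge) : Prop :=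
  ∃ Γ, IsProofNet L Γ ∧ ∀ e, e ∈ Γ ↔ e ∈ S

namespace ProofNetOn

variable {L L₁ L₂ : List Link} {S T : Set Edge} {a b c : Edge} {x : Link}

theorem exists_append (h : ProofNetOn L S) (l : List Edge) (hl : l.Nodup)
    (hS : ∀ e, e ∈ S ↔ e ∈ l ∨ e ∈ T) (hT : ∀ e ∈ l, e ∉ T) :
    ∃ Γ, IsProofNet L (l ++ Γ) ∧ ∀ e, e ∈ Γ ↔ e ∈ T := by
  obtain ⟨Γ, hΓ, hΓS⟩ := h
  refine ⟨Γ.filter (· ∉ l), hΓ.perm_concl ?_, by grind⟩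
  have hd : l.Disjoint (Γ.filter (· ∉ l)) := fun e he => by simp [he]
  rw [List.perm_ext_iff_of_nodup hΓ.concl_nodup (hl.append (hΓ.concl_nodup.filter _) hd)]
  grind

theorem perm (h : ProofNetOn L₁ S) (hL : L₁.Perm L₂) (hS : S = T) : ProofNetOn L₂ T := by
  obtain ⟨Γ, hΓ, hΓS⟩ := h
  exact ⟨Γ, hΓ.perm hL (.refl _), hS ▸ hΓS⟩

theorem leaf (hx : x.prems = []) (ht : x.Typed) (hn : x.sources.Nodup)
    (hb : ∀ l Δ R S, Link.box l Δ R S = x → Correct R Δ ∧ Correct S Δ) :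
    ProofNetOn [x] {e | e ∈ x.concls} :=
  ⟨_, .leaf hx ht hn hb, fun _ => Iff.rfl⟩

theorem ax (ht : b.ty = a.ty.neg) (hab : a ≠ b) : ProofNetOn [.ax a b] {a, b} :=
  (leaf (x := .ax a b) rfl ht (by simpa [Link.sources] using hab) (by simp)).perm (.refl _)
    (by ext; simp [Link.concls])

theorem one (q : Option ℕ) (ht : a.ty = .one) : ProofNetOn [.one q a] {a} :=
  (leaf (x := .one q a) rfl ht (by simp [Link.sources]) (by simp)).perm (.refl _)
    (by ext; simp [Link.concls])

theorem par (h : ProofNetOn L (insert a (insert b S))) (hab : a ≠ b) (ha : a ∉ S) (hb : b ∉ S)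
    (ht : c.ty = .par a.ty b.ty) (hc : c ∉ Link.sourcesList L) :
    ProofNetOn (.par a b c :: L) (insert c S) := by
  obtain ⟨Γ, hΓ, hS⟩ := h.exists_append [a, b] (T := S) (by simpa using hab)
    (by simp [or_assoc]) (by simp [ha, hb])
  refine ⟨_, hΓ.cons (x := .par a b c) ?_ ht ?_ ?_ (by simp), ?_⟩ <;>
    simp [Link.prems, Link.exclusive, Link.sources, Link.concls, hS, hc]

theorem sync {n : ℕ} {U : QGate n} (h : ProofNetOn L (insert a S)) (ha : a ∉ S)
    (hab : a.ty = b.ty) (hpos : b.ty.isPos = true) (hn : n = a.ty.atoms)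
    (hb : b ∉ Link.sourcesList L) : ProofNetOn (.sync U [(a, b)] :: L) (insert b S) := by
  obtain ⟨Γ, hΓ, hS⟩ := h.exists_append [a] (T := S) (by simp) (by simp) (by simpa using ha)
  refine ⟨_, hΓ.cons (x := .sync U [(a, b)]) ?_ ?_ ?_ ?_ (by simp), ?_⟩ <;>
    simp [Link.prems, Link.Typed, Link.sources, Link.concls, hS, hb, hpos, hab, hn]

theorem tens (h₁ : ProofNetOn L₁ (insert a S)) (h₂ : ProofNetOn L₂ (insert b T)) (ha : a ∉ S)
    (hb : b ∉ T) (ht : c.ty = .tens a.ty b.ty)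
    (hd : (Link.sourcesList L₁).Disjoint (Link.sourcesList L₂))
    (hc₁ : c ∉ Link.sourcesList L₁) (hc₂ : c ∉ Link.sourcesList L₂) :
    ProofNetOn (.tens a b c :: (L₁ ++ L₂)) (insert c (S ∪ T)) := by
  obtain ⟨Γ, hΓ, hS⟩ := h₁.exists_append [a] (T := S) (by simp) (by simp) (by simpa using ha)
  obtain ⟨Δ, hΔ, hT⟩ := h₂.exists_append [b] (T := T) (by simp) (by simp) (by simpa using hb)
  refine ⟨_, hΓ.join hΔ (x := .tens a b c) rfl ht ?_ hd ?_ ?_, ?_⟩ <;>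
    simp [Link.sources, Link.concls, hS, hT, hc₁, hc₂]

theorem cut (h₁ : ProofNetOn L₁ (insert a S)) (h₂ : ProofNetOn L₂ (insert b T)) (ha : a ∉ S)
    (hb : b ∉ T) (ht : b.ty = a.ty.neg)
    (hd : (Link.sourcesList L₁).Disjoint (Link.sourcesList L₂)) :
    ProofNetOn (.cut a b :: (L₁ ++ L₂)) (S ∪ T) := by
  obtain ⟨Γ, hΓ, hS⟩ := h₁.exists_append [a] (T := S) (by simp) (by simp) (by simpa using ha)
  obtain ⟨Δ, hΔ, hT⟩ := h₂.exists_append [b] (T := T) (by simp) (by simp) (by simpa using hb)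
  refine ⟨_, hΓ.join hΔ (x := .cut a b) rfl ht ?_ hd ?_ ?_, ?_⟩ <;>
    simp [Link.sources, Link.concls, hS, hT]

theorem correct (h : ProofNetOn L {a}) : Correct L [a] := by
  obtain ⟨Γ, hΓ, hS⟩ := h.exists_append [a] (T := ∅) (by simp) (by simp) (by simp)
  obtain rfl : Γ = [] := List.eq_nil_iff_forall_not_mem.2 (by simp [hS])
  exact hΓ.correct

end ProofNetOn

theorem Correct.sources_nodup {Γ : List Edge} (h : Correct L Γ) : (Link.sourcesList L).Nodup := by
  cases h
  assumption

theorem ProofNetOn.box {R S : List Link} {l a : Edge} (hR : Correct R [a]) (hS : Correct S [a])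
    (hl : l.ty = .bot) (hla : l ≠ a) (hlR : l ∉ Link.sourcesList R) (hlS : l ∉ Link.sourcesList S)
    (hRS : ∀ e ∈ Link.sourcesList R, e ∈ Link.sourcesList S → e = a) :
    ProofNetOn [.box l [a] R S] {l, a} := by
  refine (leaf (x := .box l [a] R S) rfl hl ?_
    (by rintro _ _ _ _ ⟨⟩; exact ⟨hR, hS⟩)).perm (.refl _) (by ext; simp [Link.concls])
  simp only [Link.sources]
  grind [List.Nodup.filter, hR.sources_nodup, hS.sources_nodup]

theorem ProofNetOn.bitNet (U : QGate 1) {p o : List ℕ} (h : p ≠ o) :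
    ProofNetOn (bitNet U p o) {⟨o, .one⟩} := by
  have h₁ := ProofNetOn.one (a := ⟨p, .one⟩) none rfl
  rw [← insert_empty_eq] at h₁
  exact ((h₁.sync (U := U) (b := ⟨o, .one⟩) (by simp) rfl rfl rfl
    (by simpa [Link.sourcesList, Link.sources] using h.symm)).perm (.swap _ _ _) (by simp))

theorem Ty.pow_qbit_isPos (n : ℕ) : (Ty.pow .qbit n).toFormula.isPos = true := by
  fun_induction Ty.pow .qbit n <;> simp_all [toFormula, Formula.isPos]

theorem Ty.pow_qbit_atoms {n : ℕ} (hn : 0 < n) : (Ty.pow .qbit n).toFormula.atoms = n := by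
  induction n with
  | zero => exact absurd hn (lt_irrefl 0)
  | succ n ih =>
    rcases n with _ | n
    · rfl
    · simp [pow, toFormula, Formula.atoms, ih, Nat.add_comm]

theorem ProofNetOn.gate {G : GateSet} (u : G.Op) (ρ : Env) (p o : List ℕ)
    (ho : branch p o = none) :
    ProofNetOn (translate ρ p o (.gate u))
      {⟨o, (Ty.arr (.pow .qbit (G.arity u)) (.pow .qbit (G.arity u))).toFormula⟩} := by
  have hne (c : ℕ) : o ≠ c :: p := ne_cons_of_branch_eq_none ho c
  set P := (Ty.pow .qbit (G.arity u)).toFormula with hP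
  have hax : ProofNetOn [.ax ⟨0 :: p, P.neg⟩ ⟨1 :: p, P⟩] {⟨1 :: p, P⟩, ⟨0 :: p, P.neg⟩} :=
    (ProofNetOn.ax (by simp) (by simp)).perm (.refl _) (Set.pair_comm _ _)
  have hsync := (hax.sync (U := G.den u) (b := ⟨2 :: p, P⟩) (by simp) rfl
    (Ty.pow_qbit_isPos _) (Ty.pow_qbit_atoms (G.arity_pos u)).symm
    (by simp [Link.sourcesList, Link.sources]))
  rw [Set.pair_comm, ← insert_empty_eq] at hsync
  exact (hsync.par (c := ⟨o, .par P.neg P⟩) (by simp) (by simp) (by simp) rfl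
    (by simp [Link.sourcesList, Link.sources, hne])).perm (.cons _ (.swap _ _ _))
    (by simp [hP, Ty.toFormula])

theorem Fits.cons_notMem_edges {Γ : Ctx} {ρ : Env} {p o : List ℕ} (h : Fits Γ ρ p o) (c : ℕ)
    (A : Formula) : (⟨c :: p, A⟩ : Edge) ∉ ρ.edges Γ :=
  fun he => ne_cons_of_branch_eq_none (h.branch_edge he) c rfl

theorem Fits.out_notMem_edges {Γ : Ctx} {ρ : Env} {p o : List ℕ} (h : Fits Γ ρ p o) (A : Formula) :
    (⟨o, A⟩ : Edge) ∉ ρ.edges Γ :=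
  fun he => h.edge_ne_out he rfl

theorem Fits.out_ne_cons {Γ : Ctx} {ρ : Env} {p o : List ℕ} (h : Fits Γ ρ p o) (c : ℕ) :
    o ≠ c :: p :=
  ne_cons_of_branch_eq_none h.branch_out c

namespace HasType

variable {G : GateSet} {Γ Γ₁ Γ₂ : Ctx} {V V₁ V₂ : Finset ℕ} {t u v : Tm G} {A B C : Ty} {ρ : Env}
  {p o : List ℕ}

theorem mem_sources (h : HasType Γ V t B) (hρ : Agree Γ ρ.tys) {c : ℕ} {e : Edge}
    (he : e ∈ Link.sourcesList (translate ρ (c :: p) o t)) :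
    e = ⟨o, B.toFormula⟩ ∨ branch p e.name = some c ∨ e ∈ ρ.edges Γ :=
  (h.mem_edges hρ (Link.sourcesList_subset _ he)).imp_right (Or.imp_left branch_of_branch_cons)

theorem mem_child_sources (h : HasType Γ V t B) (hρ : Agree Γ ρ.tys) {c : ℕ} {e : Edge}
    (he : e ∈ Link.sourcesList (translate ρ (c :: p) (c :: p) t)) :
    branch p e.name = some c ∨ e ∈ ρ.edges Γ := by
  rcases h.mem_sources hρ he with rfl | he
  exacts [.inl (branch_cons_self p c), he]

theorem cons_notMem_child_sources (h : HasType Γ V t B) (hρ : Fits Γ ρ p o) {c d : ℕ}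
    (hcd : d ≠ c) (A : Formula) :
    (⟨d :: p, A⟩ : Edge) ∉ Link.sourcesList (translate ρ (c :: p) (c :: p) t) := fun he =>
  (h.mem_child_sources hρ.agree he).elim (by simp [hcd]) (hρ.cons_notMem_edges d A)

theorem out_notMem_child_sources (h : HasType Γ V t B) (hρ : Fits Γ ρ p o) (c : ℕ) (A : Formula) :
    (⟨o, A⟩ : Edge) ∉ Link.sourcesList (translate ρ (c :: p) (c :: p) t) := fun he =>
  (h.mem_child_sources hρ.agree he).elim (by simp [hρ.branch_out]) (hρ.out_notMem_edges A)

theorem proofNetOn_lam (h : HasType (scons (some A) Γ) V t B) (hρ : Fits Γ ρ p o)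
    (ht : ProofNetOn (translate (scons (1 :: p, A) ρ) (0 :: p) (0 :: p) t)
      (insert ⟨0 :: p, B.toFormula⟩
        (Env.edges (scons (1 :: p, A) ρ) (scons (some A) Γ)))) :
    ProofNetOn (translate ρ p o (.lam A t))
      (insert ⟨o, (Ty.arr A B).toFormula⟩ (ρ.edges Γ)) := by
  have hA := (hρ.lam A).agree
  simp only [translate, h.tyOf_eq hA]
  rw [Env.edges_scons, Set.insert_comm] at ht
  refine ht.par (by simp) (hρ.cons_notMem_edges _ _) (hρ.cons_notMem_edges _ _) rfl fun ho => ?_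
  have := h.mem_child_sources hA ho
  simp [Env.edges_scons, hρ.branch_out, hρ.out_ne_cons, hρ.out_notMem_edges] at this

theorem children_disjoint (hs : Ctx.Split Γ Γ₁ Γ₂) (h₁ : HasType Γ₁ V₁ t A)
    (h₂ : HasType Γ₂ V₂ u B) (hρ : Fits Γ ρ p o) :
    (Link.sourcesList (translate ρ (0 :: p) (0 :: p) t)).Disjoint
      (Link.sourcesList (translate ρ (1 :: p) (1 :: p) u)) := by
  intro e he₁ he₂
  rcases h₁.mem_child_sources (hρ.left hs).agree he₁ with he₁ | he₁ <;>
    rcases h₂.mem_child_sources (hρ.right hs).agree he₂ with he₂ | he₂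
  · simp [he₁] at he₂
  · simp [(hρ.right hs).branch_edge he₂] at he₁
  · simp [(hρ.left hs).branch_edge he₁] at he₂
  · exact Set.disjoint_left.1 (hρ.edges_disjoint hs) he₁ he₂

theorem proofNetOn_pair (hs : Ctx.Split Γ Γ₁ Γ₂) (h₁ : HasType Γ₁ V₁ t A)
    (h₂ : HasType Γ₂ V₂ u B) (hρ : Fits Γ ρ p o)
    (ht : ProofNetOn (translate ρ (0 :: p) (0 :: p) t) (insert ⟨0 :: p, A.toFormula⟩ (ρ.edges Γ₁)))
    (hu : ProofNetOn (translate ρ (1 :: p) (1 :: p) u)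
      (insert ⟨1 :: p, B.toFormula⟩ (ρ.edges Γ₂))) :
    ProofNetOn (translate ρ p o (.pair t u))
      (insert ⟨o, (Ty.tens A B).toFormula⟩ (ρ.edges Γ)) := by
  have hρ₁ := hρ.left hs
  have hρ₂ := hρ.right hs
  simp only [translate, h₁.tyOf_eq hρ₁.agree, h₂.tyOf_eq hρ₂.agree, Env.edges_split hs]
  exact ht.tens hu (hρ₁.cons_notMem_edges _ _) (hρ₂.cons_notMem_edges _ _) rfl
    (children_disjoint hs h₁ h₂ hρ) (h₁.out_notMem_child_sources hρ₁ _ _)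
    (h₂.out_notMem_child_sources hρ₂ _ _)

theorem proofNetOn_app (hs : Ctx.Split Γ Γ₁ Γ₂) (h₁ : HasType Γ₁ V₁ t (.arr A B))
    (h₂ : HasType Γ₂ V₂ u A) (hρ : Fits Γ ρ p o)
    (ht : ProofNetOn (translate ρ (0 :: p) (0 :: p) t)
      (insert ⟨0 :: p, (Ty.arr A B).toFormula⟩ (ρ.edges Γ₁)))
    (hu : ProofNetOn (translate ρ (1 :: p) (1 :: p) u)
      (insert ⟨1 :: p, A.toFormula⟩ (ρ.edges Γ₂))) :
    ProofNetOn (translate ρ p o (.app t u)) (insert ⟨o, B.toFormula⟩ (ρ.edges Γ)) := by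
  have hρ₁ := hρ.left hs
  have hρ₂ := hρ.right hs
  have hax : ProofNetOn [.ax ⟨2 :: p, B.toFormula.neg⟩ ⟨o, B.toFormula⟩]
      {⟨2 :: p, B.toFormula.neg⟩, ⟨o, B.toFormula⟩} :=
    .ax (by simp) (by simp [(hρ.out_ne_cons 2).symm])
  have htens := hu.tens hax (c := ⟨3 :: p, .tens A.toFormula B.toFormula.neg⟩)
    (hρ₂.cons_notMem_edges _ _) (by simp [(hρ.out_ne_cons 2).symm]) rfl
    (by simp [Link.sourcesList, Link.sources, h₂.cons_notMem_child_sources hρ₂,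
      h₂.out_notMem_child_sources hρ₂])
    (h₂.cons_notMem_child_sources hρ₂ (by simp) _)
    (by simp [Link.sourcesList, Link.sources, (hρ.out_ne_cons 3).symm])
  have hcut := ht.cut htens (hρ₁.cons_notMem_edges _ _)
    (by simp [hρ₂.cons_notMem_edges, (hρ.out_ne_cons 3).symm])
    (by simp [Ty.toFormula, Formula.neg])
    (by simp [Link.sourcesList, Link.sources, Link.sourcesList_append,
      children_disjoint hs h₁ h₂ hρ, h₁.cons_notMem_child_sources hρ₁,
      h₁.out_notMem_child_sources hρ₁])
  simp only [translate, tyOf, h₁.tyOf_eq hρ₁.agree, h₂.tyOf_eq hρ₂.agree, Env.edges_split hs]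
  exact hcut.perm (.cons _ (List.perm_middle.trans (.cons _
    (by rw [← List.append_assoc]; exact List.perm_append_singleton _ _)))) (by grind)

theorem letp_disjoint (hs : Ctx.Split Γ Γ₁ Γ₂) (h₁ : HasType Γ₁ V₁ t (.tens A B))
    (h₂ : HasType (scons (some B) (scons (some A) Γ₂)) V₂ u C) (hρ : Fits Γ ρ p o) :
    (Link.sourcesList (translate ρ (0 :: p) (0 :: p) t)).Disjoint
      (Link.sourcesList
        (translate (scons (2 :: p, B) (scons (1 :: p, A) ρ)) (4 :: p) o u)) := by
  intro e he₁ he₂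
  have he₂ := h₂.mem_sources ((hρ.right hs).letp A B).agree he₂
  rw [Env.edges_scons, Env.edges_scons] at he₂
  rcases he₂ with rfl | he₂ | rfl | rfl | he₂
  · exact h₁.out_notMem_child_sources (hρ.left hs) _ _ he₁
  · rcases h₁.mem_child_sources (hρ.left hs).agree he₁ with he₁ | he₁
    · simp [he₁] at he₂
    · simp [(hρ.left hs).branch_edge he₁] at he₂
  · exact h₁.cons_notMem_child_sources (hρ.left hs) (by simp) _ he₁
  · exact h₁.cons_notMem_child_sources (hρ.left hs) (by simp) _ he₁
  · rcases h₁.mem_child_sources (hρ.left hs).agree he₁ with he₁ | he₁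
    · simp [(hρ.right hs).branch_edge he₂] at he₁
    · exact Set.disjoint_left.1 (hρ.edges_disjoint hs) he₁ he₂

theorem proofNetOn_letp (hs : Ctx.Split Γ Γ₁ Γ₂) (h₁ : HasType Γ₁ V₁ t (.tens A B))
    (h₂ : HasType (scons (some B) (scons (some A) Γ₂)) V₂ u C) (hρ : Fits Γ ρ p o)
    (ht : ProofNetOn (translate ρ (0 :: p) (0 :: p) t)
      (insert ⟨0 :: p, (Ty.tens A B).toFormula⟩ (ρ.edges Γ₁)))
    (hu : ProofNetOn (translate (scons (2 :: p, B) (scons (1 :: p, A) ρ)) (4 :: p) o u)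
      (insert ⟨o, C.toFormula⟩ (Env.edges (scons (2 :: p, B) (scons (1 :: p, A) ρ))
        (scons (some B) (scons (some A) Γ₂))))) :
    ProofNetOn (translate ρ p o (.letp t u)) (insert ⟨o, C.toFormula⟩ (ρ.edges Γ)) := by
  have hρ₁ := hρ.left hs
  have hρ₂ := hρ.right hs
  have h₃ : (⟨3 :: p, .par A.toFormula.neg B.toFormula.neg⟩ : Edge) ∉ Link.sourcesList
      (translate (scons (2 :: p, B) (scons (1 :: p, A) ρ)) (4 :: p) o u) := fun he => by
    have := h₂.mem_sources (hρ₂.letp A B).agree he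
    simp [Env.edges_scons, hρ₂.cons_notMem_edges, (hρ.out_ne_cons 3).symm] at this
  have hpar := (hu.perm (.refl _) (T := insert ⟨1 :: p, A.toFormula.neg⟩
    (insert ⟨2 :: p, B.toFormula.neg⟩ (insert ⟨o, C.toFormula⟩ (ρ.edges Γ₂))))
    (by grind [Env.edges_scons])).par (c := ⟨3 :: p, .par A.toFormula.neg B.toFormula.neg⟩)
    (by simp) (by simp [hρ₂.cons_notMem_edges, (hρ.out_ne_cons 1).symm])
    (by simp [hρ₂.cons_notMem_edges, (hρ.out_ne_cons 2).symm]) rfl h₃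
  have hcut := ht.cut hpar (hρ₁.cons_notMem_edges _ _)
    (by simp [hρ₂.cons_notMem_edges, (hρ.out_ne_cons 3).symm])
    (by simp [Ty.toFormula, Formula.neg])
    (by simp [Link.sourcesList, Link.sources, letp_disjoint hs h₁ h₂ hρ,
      h₁.cons_notMem_child_sources hρ₁])
  simp only [translate, h₁.tyOf_eq hρ₁.agree, Ty.components, Env.edges_split hs]
  exact hcut.perm (.cons _ List.perm_middle) (by grind)

theorem proofNetOn_ite (h : HasType Γ V t .bool) (h₁ : HasType Ctx.nil V₁ u A)
    (h₂ : HasType Ctx.nil V₂ v A) (hρ : Fits Γ ρ p o)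
    (ht : ProofNetOn (translate ρ (0 :: p) (0 :: p) t)
      (insert ⟨0 :: p, Ty.bool.toFormula⟩ (ρ.edges Γ)))
    (hu : ProofNetOn (translate Env.nil (2 :: p) o u) {⟨o, A.toFormula⟩})
    (hv : ProofNetOn (translate Env.nil (3 :: p) o v) {⟨o, A.toFormula⟩}) :
    ProofNetOn (translate ρ p o (.ite t u v)) (insert ⟨o, A.toFormula⟩ (ρ.edges Γ)) := by
  have hmem {V : Finset ℕ} {w : Tm G} {c : ℕ} (hw : HasType Ctx.nil V w A) {e : Edge}
      (he : e ∈ Link.sourcesList (translate Env.nil (c :: p) o w)) :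
      e = ⟨o, A.toFormula⟩ ∨ branch p e.name = some c := by
    simpa using hw.mem_sources (Agree.nil _) he
  have hlock {V : Finset ℕ} {w : Tm G} {c : ℕ} (hw : HasType Ctx.nil V w A) (hc : 1 ≠ c) :
      (⟨1 :: p, .bot⟩ : Edge) ∉ Link.sourcesList (translate Env.nil (c :: p) o w) := fun he => by
    simpa [(hρ.out_ne_cons 1).symm, hc] using hmem hw he
  have hbox := ProofNetOn.box hu.correct hv.correct (l := ⟨1 :: p, .bot⟩) rfl
    (by simp [(hρ.out_ne_cons 1).symm]) (hlock h₁ (by simp)) (hlock h₂ (by simp))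
    fun e he₁ he₂ => by grind
  have hcut := ht.cut hbox (hρ.cons_notMem_edges _ _) (by simp [(hρ.out_ne_cons 1).symm])
    (by simp [Ty.toFormula, Formula.neg]) (by
      intro e he he'
      have h₀ := h.mem_child_sources hρ.agree he
      simp only [Link.sourcesList, Link.sources, List.mem_append, List.mem_cons,
        List.mem_filter, List.not_mem_nil, or_false] at he'
      grind [hρ.branch_edge, hρ.edge_ne_out, hρ.branch_out, branch_cons_self])
  simp only [translate, h₁.tyOf_eq (Agree.nil _)]
  exact hcut.perm (.cons _ (List.perm_append_singleton _ _)) (Set.union_comm _ _)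

theorem proofNetOn_meas (ρ : Env) (ho : branch p o = none) :
    ProofNetOn (translate ρ p o (.meas : Tm G)) {⟨o, (Ty.arr .qbit .bool).toFormula⟩} := by
  have hne (c : ℕ) : o ≠ c :: p := ne_cons_of_branch_eq_none ho c
  have hbox := ProofNetOn.box
    (ProofNetOn.bitNet gateI (p := 2 :: p) (o := 1 :: p) (by simp)).correct
    (ProofNetOn.bitNet gateX (p := 3 :: p) (o := 1 :: p) (by simp)).correct
    (l := ⟨0 :: p, .bot⟩) rfl (by simp) (by simp [bitNet, Link.sourcesList, Link.sources])
    (by simp [bitNet, Link.sourcesList, Link.sources])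
    (by simp [bitNet, Link.sourcesList, Link.sources])
  rw [← insert_empty_eq (x := (⟨1 :: p, .one⟩ : Edge))] at hbox
  exact (hbox.par (c := ⟨o, .par .bot .one⟩) (by simp) (by simp) (by simp) rfl
    (by simp [bitNet, Link.sourcesList, Link.sources, hne])).perm (.refl _)
    (by simp [Ty.toFormula, Formula.neg])

theorem proofNetOn (h : HasType Γ V t B) (hρ : Fits Γ ρ p o) :
    ProofNetOn (translate ρ p o t) (insert ⟨o, B.toFormula⟩ (ρ.edges Γ)) := by
  induction h generalizing ρ p o with
  | var i A =>
    have hi : (ρ i).2 = A := hρ.agree i A (by simp)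
    have hax : ProofNetOn [.ax (ρ.edge i) ⟨o, A.toFormula⟩] {ρ.edge i, ⟨o, A.toFormula⟩} :=
      .ax (by simp [Env.edge, hi]) (by simp [Env.edge, hρ.ne_out i A (by simp)])
    rw [Env.edges_single, Set.pair_comm]
    simpa only [translate, Env.edge, hi] using hax
  | qvar r => simpa [translate, Ty.toFormula] using .one (a := ⟨o, .one⟩) (some r) rfl
  | new => simpa [translate, Ty.toFormula] using .one (a := ⟨o, .one⟩) none rfl
  | tt => simpa [translate, Ty.toFormula] using .bitNet gateI (hρ.out_ne_cons 0).symm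
  | ff => simpa [translate, Ty.toFormula] using .bitNet gateX (hρ.out_ne_cons 0).symm
  | meas => simpa using proofNetOn_meas ρ hρ.branch_out
  | gate u => simpa using ProofNetOn.gate u ρ p o hρ.branch_out
  | @lam _ _ A _ _ h ih => exact proofNetOn_lam h hρ (ih (hρ.lam A))
  | app hs _ h₁ h₂ ih₁ ih₂ =>
    exact proofNetOn_app hs h₁ h₂ hρ (ih₁ ((hρ.left hs).child 0)) (ih₂ ((hρ.right hs).child 1))
  | pair hs _ h₁ h₂ ih₁ ih₂ =>
    exact proofNetOn_pair hs h₁ h₂ hρ (ih₁ ((hρ.left hs).child 0)) (ih₂ ((hρ.right hs).child 1))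
  | @letp _ _ _ _ _ A B _ _ _ hs _ h₁ h₂ ih₁ ih₂ =>
    exact proofNetOn_letp hs h₁ h₂ hρ (ih₁ ((hρ.left hs).child 0)) (ih₂ ((hρ.right hs).letp A B))
  | ite h h₁ h₂ ih ih₁ ih₂ =>
    have ho (c : ℕ) : branch (c :: p) o = none := branch_cons_eq_none (by simp [hρ.branch_out])
    exact proofNetOn_ite h h₁ h₂ hρ (ih (hρ.child 0)) (by simpa using ih₁ (.nil Env.nil (ho 2)))
      (by simpa using ih₂ (.nil Env.nil (ho 3)))

theorem correct (h : HasType Ctx.nil V t B) (ρ : Env) (ho : branch p o = none) :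
    Correct (translate ρ p o t) [⟨o, B.toFormula⟩] := by
  have hnet := h.proofNetOn (Fits.nil ρ ho)
  rw [Env.edges_nil, insert_empty_eq] at hnet
  exact hnet.correct

/-! ## Quantum variables of translations -/

theorem mem_qvarsList (h : HasType Γ V t B) {r : ℕ}
    (hr : r ∈ Link.qvarsList (translate ρ p o t)) : r ∈ V := by
  induction h generalizing ρ p o with
  | var | new | tt | ff | meas | gate =>
    simp [translate, bitNet, Link.qvarsList, Link.qvars] at hr
  | qvar => simpa [translate, Link.qvarsList, Link.qvars] using hr
  | lam _ ih => exact ih (by simpa [translate, Link.qvarsList, Link.qvars] using hr)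
  | app _ _ _ _ ih₁ ih₂ | pair _ _ _ _ ih₁ ih₂ | letp _ _ _ _ ih₁ ih₂ =>
    simp only [translate, Link.qvarsList, Link.qvars, Link.qvarsList_append, List.nil_append,
      List.mem_append] at hr
    exact Finset.mem_union.2 (hr.imp ih₁ ih₂)
  | ite _ _ _ ih ih₁ ih₂ =>
    simp only [translate, Link.qvarsList, Link.qvars, List.nil_append, List.mem_append] at hr
    rcases hr with (hr | hr) | hr
    · exact absurd (ih₁ hr) (by simp)
    · exact absurd (ih₂ hr) (by simp)
    · exact ih hr

theorem qvarsList_eq_nil (h : HasType Γ ∅ t B) : Link.qvarsList (translate ρ p o t) = [] :=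
  List.eq_nil_iff_forall_not_mem.2 fun r hr => by simpa using h.mem_qvarsList hr

theorem nodup_qvars_and_toFinset_qvars (h : HasType Γ V t B) :
    ((translate ρ p o t).filterMap Link.qvar?).Nodup ∧
      ((translate ρ p o t).filterMap Link.qvar?).toFinset = V := by
  induction h generalizing ρ p o with
  | var | new | tt | ff | meas | gate | qvar =>
    simp [translate, bitNet, Link.qvar?, List.filterMap_cons]
  | lam _ ih | ite _ _ _ ih => simpa [translate, List.filterMap_cons, Link.qvar?] using ih
  | app _ hd _ _ ih₁ ih₂ | pair _ hd _ _ ih₁ ih₂ | letp _ hd _ _ ih₁ ih₂ =>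
    simp only [translate, List.filterMap_cons, Link.qvar?, List.filterMap_append,
      List.toFinset_append, ih₁, ih₂, and_true]
    refine List.Nodup.append ih₁.1 ih₂.1 fun r hr hr' => ?_
    rw [← List.mem_toFinset, ih₁.2] at hr
    rw [← List.mem_toFinset, ih₂.2] at hr'
    exact Finset.disjoint_left.1 hd hr hr'

theorem qvarsList_box_eq_nil (h : HasType Γ V t B) {l : Edge} {Δ : List Edge} {R S : List Link}
    (hb : Link.box l Δ R S ∈ translate ρ p o t) :
    Link.qvarsList R = [] ∧ Link.qvarsList S = [] := by
  induction h generalizing ρ p o with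
  | var | qvar | new | tt | ff | gate => simp [translate, bitNet] at hb
  | meas =>
    simp only [translate, List.mem_cons, List.not_mem_nil, or_false, reduceCtorEq, false_or,
      Link.box.injEq] at hb
    obtain ⟨rfl, rfl, rfl, rfl⟩ := hb
    simp [bitNet, Link.qvarsList, Link.qvars]
  | lam _ ih => exact ih (by simpa [translate] using hb)
  | app _ _ _ _ ih₁ ih₂ | pair _ _ _ _ ih₁ ih₂ | letp _ _ _ _ ih₁ ih₂ =>
    simp only [translate, List.mem_cons, reduceCtorEq, false_or, List.mem_append] at hb
    exact hb.elim ih₁ ih₂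
  | ite _ h₁ h₂ ih =>
    simp only [translate, List.mem_cons, reduceCtorEq, false_or, Link.box.injEq] at hb
    rcases hb with ⟨rfl, rfl, rfl, rfl⟩ | hb
    exacts [⟨h₁.qvarsList_eq_nil, h₂.qvarsList_eq_nil⟩, ih hb]

end HasType

theorem Raw.IsClosure.isNet {G : GateSet} {A : Ty} {c : Raw G} (h : c.IsClosure A) :
    (c.toQStruct A).IsNet where
  correct := h.2.correct Env.nil (branch_nil _)
  state := h.1
  nodup := h.2.nodup_qvars_and_toFinset_qvars.1
  vars := h.2.nodup_qvars_and_toFinset_qvars.2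
  depth _ _ _ _ := h.2.qvarsList_box_eq_nil

theorem Closure.isNet {G : GateSet} {A : Ty} (C : Closure G A) : C.toNet.IsNet := by
  induction C using Quot.ind with
  | mk c => exact ⟨_, rfl, c.2.isNet⟩

/-! ## Renaming the edges of translations -/

theorem HasType.mapList_translate {G : GateSet} {Γ : Ctx} {V : Finset ℕ} {t : Tm G} {B : Ty}
    (h : HasType Γ V t B) {f : Edge → Edge} {ρ ρ' : Env} {p p' o o' : List ℕ}
    (hρ : Agree Γ ρ.tys) (hρ' : Agree Γ ρ'.tys)
    (hp : ∀ w a A, f ⟨w ++ a :: p, A⟩ = ⟨w ++ a :: p', A⟩)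
    (ho : f ⟨o, B.toFormula⟩ = ⟨o', B.toFormula⟩)
    (hi : ∀ i A, Γ i = some A → f (ρ.edge i) = ρ'.edge i) :
    Link.mapList f id (translate ρ p o t) = translate ρ' p' o' t := by
  have hchild {p p' : List ℕ} (hp : ∀ w a A, f ⟨w ++ a :: p, A⟩ = ⟨w ++ a :: p', A⟩) (c : ℕ) :
      ∀ w a A, f ⟨w ++ a :: c :: p, A⟩ = ⟨w ++ a :: c :: p', A⟩ := fun w a A => by
    simpa using hp (w ++ [a]) c A
  have hcons {p p' : List ℕ} (hp : ∀ w a A, f ⟨w ++ a :: p, A⟩ = ⟨w ++ a :: p', A⟩) (c : ℕ)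
      (A : Formula) : f ⟨c :: p, A⟩ = ⟨c :: p', A⟩ := hp [] c A
  induction h generalizing ρ ρ' p p' o o' with
  | var i A =>
    have h₁ := hi i A (by simp)
    have h₂ : (ρ i).2 = A := hρ i A (by simp)
    have h₃ : (ρ' i).2 = A := hρ' i A (by simp)
    simp only [Env.edge, h₂, h₃] at h₁
    simp [translate, Link.mapList, Link.map, h₁, h₂, h₃, ho]
  | qvar | new | tt | ff | meas | gate =>
    simp only [Ty.toFormula, Formula.neg] at ho
    simp [translate, bitNet, Link.mapList, Link.map, ho, hcons hp]
  | @lam _ _ A _ _ h ih =>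
    have hA := hρ.scons A
    have hA' := hρ'.scons A
    have ih := @ih (scons (1 :: p, A) ρ) (scons (1 :: p', A) ρ') (0 :: p) (0 :: p') (0 :: p)
      (0 :: p') (by simpa using hA) (by simpa using hA') (hchild hp 0) (hcons hp 0 _)
      (by rintro (_ | i) C hC; exacts [hcons hp 1 _, hi i C hC])
    simp only [Ty.toFormula] at ho
    simp [translate, Link.mapList, Link.map, ho, hcons hp, ih, h.tyOf_eq hA, h.tyOf_eq hA']
  | app hs _ h₁ h₂ ih₁ ih₂ =>
    have ih₁ := ih₁ (hρ.left hs) (hρ'.left hs) (hchild hp 0) (hcons hp 0 _)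
      fun i C hC => hi i C (hs.left hC)
    have ih₂ := ih₂ (hρ.right hs) (hρ'.right hs) (hchild hp 1) (hcons hp 1 _)
      fun i C hC => hi i C (hs.right hC)
    simp only [translate, tyOf, Link.mapList, Link.map, mapList_append, ho, hcons hp, ih₁, ih₂,
      h₁.tyOf_eq (hρ.left hs), h₂.tyOf_eq (hρ.right hs), h₁.tyOf_eq (hρ'.left hs),
      h₂.tyOf_eq (hρ'.right hs)]
  | pair hs _ h₁ h₂ ih₁ ih₂ =>
    have ih₁ := ih₁ (hρ.left hs) (hρ'.left hs) (hchild hp 0) (hcons hp 0 _)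
      fun i C hC => hi i C (hs.left hC)
    have ih₂ := ih₂ (hρ.right hs) (hρ'.right hs) (hchild hp 1) (hcons hp 1 _)
      fun i C hC => hi i C (hs.right hC)
    simp only [Ty.toFormula] at ho
    simp only [translate, Link.mapList, Link.map, mapList_append, ho, hcons hp, ih₁, ih₂,
      h₁.tyOf_eq (hρ.left hs), h₂.tyOf_eq (hρ.right hs), h₁.tyOf_eq (hρ'.left hs),
      h₂.tyOf_eq (hρ'.right hs)]
  | @letp _ _ _ _ _ A B _ _ _ hs _ h₁ _ ih₁ ih₂ =>
    have ih₁ := ih₁ (hρ.left hs) (hρ'.left hs) (hchild hp 0) (hcons hp 0 _)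
      fun i C hC => hi i C (hs.left hC)
    have ih₂ := @ih₂ (scons (2 :: p, B) (scons (1 :: p, A) ρ))
      (scons (2 :: p', B) (scons (1 :: p', A) ρ')) (4 :: p) (4 :: p') o o'
      (by simpa using ((hρ.right hs).scons A).scons B)
      (by simpa using ((hρ'.right hs).scons A).scons B) (hchild hp 4) ho (by
        rintro (_ | _ | i) C hC
        exacts [hcons hp 2 _, hcons hp 1 _, hi i C (hs.right hC)])
    simp only [translate, Link.mapList, Link.map, mapList_append, hcons hp, ih₁, ih₂,
      h₁.tyOf_eq (hρ.left hs), h₁.tyOf_eq (hρ'.left hs), Ty.components]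
  | ite _ h₁ _ ih ih₁ ih₂ =>
    have ih := ih hρ hρ' (hchild hp 0) (hcons hp 0 _) hi
    have ih₁ := @ih₁ Env.nil Env.nil (2 :: p) (2 :: p') o o' (.nil _) (.nil _) (hchild hp 2) ho
      (by simp [Ctx.nil])
    have ih₂ := @ih₂ Env.nil Env.nil (3 :: p) (3 :: p') o o' (.nil _) (.nil _) (hchild hp 3) ho
      (by simp [Ctx.nil])
    simp only [translate, Link.mapList, Link.map, hcons hp, ho, ih, ih₁, ih₂, List.map_cons,
      List.map_nil, h₁.tyOf_eq (.nil _)]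

theorem HasType.translate_congr {G : GateSet} {Γ : Ctx} {V : Finset ℕ} {t : Tm G} {B : Ty}
    (h : HasType Γ V t B) {ρ ρ' : Env} (p o : List ℕ) (hρ : Agree Γ ρ.tys)
    (hi : ∀ i A, Γ i = some A → ρ i = ρ' i) : translate ρ p o t = translate ρ' p o t := by
  have hρ' : Agree Γ ρ'.tys := fun i A hA => by
    rw [← hρ i A hA, Env.tys, Env.tys, hi i A hA]
  have hmap := h.mapList_translate (f := id) (p := p) (o := o) hρ hρ' (fun _ _ _ => rfl) rfl
    fun i A hA => by simp [Env.edge, hi i A hA]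
  rwa [Link.mapList_id_id] at hmap

theorem HasType.mapList_update_translate {G : GateSet} {Γ : Ctx} {V : Finset ℕ} {t : Tm G}
    {B : Ty} (h : HasType Γ V t B) {ρ : Env} {p o : List ℕ} (o' : List ℕ) (hρ : Fits Γ ρ p o) :
    Link.mapList (Function.update id ⟨o, B.toFormula⟩ ⟨o', B.toFormula⟩) id (translate ρ p o t) =
      translate ρ p o' t := by
  refine h.mapList_translate hρ.agree hρ.agree (fun w a A => ?_) (by simp) fun i A hA => ?_
  · have : w ++ a :: p ≠ o := fun h => by simpa [← h] using hρ.branch_out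
    simp [this]
  · simp [Env.edge, hρ.ne_out i A hA]

/-- Move the names below `p` to names below `q`. -/
def reloc (p q : List ℕ) (e : Edge) : Edge :=
  ⟨if branch p e.name = none then e.name else e.name.rdrop p.length ++ q, e.ty⟩

theorem reloc_append (p q w : List ℕ) (a : ℕ) (A : Formula) :
    reloc p q ⟨w ++ a :: p, A⟩ = ⟨w ++ a :: q, A⟩ := by
  have hdrop : (w ++ a :: p).rdrop p.length = w ++ [a] := by
    rw [← List.singleton_append, ← List.append_assoc, List.rdrop_append_length]
  simp [reloc, hdrop]

theorem reloc_eq_self {p : List ℕ} (q : List ℕ) {e : Edge} (h : branch p e.name = none) :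
    reloc p q e = e := by
  simp [reloc, h]

theorem reloc_injOn (p q : List ℕ) :
    Set.InjOn (reloc p q) {e | branch p e.name = none → branch q e.name = none} := by
  have moved {e : Edge} (h : branch p e.name ≠ none) :
      ∃ w a, e.name = w ++ a :: p ∧ reloc p q e = ⟨w ++ a :: q, e.ty⟩ := by
    obtain ⟨a, ha⟩ := Option.ne_none_iff_exists'.1 h
    obtain ⟨w, hw⟩ := branch_eq_some.1 ha
    exact ⟨w, a, hw, by rw [← reloc_append p q, ← hw]⟩
  intro e he e' he' hee
  by_cases h : branch p e.name = none <;> by_cases h' : branch p e'.name = none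
  · rwa [reloc_eq_self q h, reloc_eq_self q h'] at hee
  · obtain ⟨w, a, -, hr⟩ := moved h'
    rw [reloc_eq_self q h, hr] at hee
    simpa [hee] using he h
  · obtain ⟨w, a, -, hr⟩ := moved h
    rw [reloc_eq_self q h', hr] at hee
    simpa [← hee] using he' h'
  · obtain ⟨w, a, hw, hr⟩ := moved h
    obtain ⟨w', a', hw', hr'⟩ := moved h'
    have hname : (w ++ [a]) ++ q = (w' ++ [a']) ++ q := by
      simpa [hr, hr'] using congrArg Edge.name hee
    have hty : e.ty = e'.ty := by simpa [hr, hr'] using congrArg Edge.ty hee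
    have hwa := List.append_cancel_right hname
    have : e.name = e'.name := by
      rw [hw, hw', ← List.singleton_append, ← List.append_assoc, hwa]
      simp
    cases e
    cases e'
    simp_all

theorem QNet.mk_perm {L L' : List Link} (h : L.Perm L') (Γ : List Edge) (V : Finset ℕ)
    (Q : Reg) : QNet.mk ⟨L, Γ, V, Q⟩ = QNet.mk ⟨L', Γ, V, Q⟩ :=
  Quot.sound (.same Γ V Q (.perm h))

theorem QNet.mk_relocate {G : GateSet} {W : Finset ℕ} {t : Tm G} {A : Ty}
    (h : HasType Ctx.nil W t A) {p q o : List ℕ} {K : List Link} {Γ : List Edge} (V : Finset ℕ)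
    (Q : Reg) (hp : branch p o = none) (hq : branch q o = none)
    (hK : ∀ e ∈ Link.edgesList K, branch p e.name = none ∧ branch q e.name = none)
    (hΓ : ∀ e ∈ Γ, branch p e.name = none ∧ branch q e.name = none) :
    QNet.mk ⟨translate Env.nil p o t ++ K, Γ, V, Q⟩ =
      QNet.mk ⟨translate Env.nil q o t ++ K, Γ, V, Q⟩ := by
  have hinj : Set.InjOn (reloc p q)
      {e | e ∈ Link.edgesList (translate Env.nil p o t ++ K) ∨ e ∈ Γ} := by
    refine (reloc_injOn p q).mono ?_
    rintro e (he | he) hd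
    · rw [Link.edgesList_append, List.mem_append] at he
      rcases he with he | he
      · rcases h.mem_edges (Agree.nil _) he with rfl | he | he
        exacts [hq, absurd hd he, by simp at he]
      · exact (hK e he).2
    · exact (hΓ e he).2
  have hiso := QStruct.Iso.edges (translate Env.nil p o t ++ K) Γ V Q (reloc p q)
    (fun _ => rfl) hinj
  rw [mapList_append, h.mapList_translate (Agree.nil _) (Agree.nil _) (reloc_append p q)
      (reloc_eq_self q hp) (by simp [Ctx.nil]),
    Link.mapList_eq_self fun e he => reloc_eq_self q (hK e he).1,
    (List.map_congr_left fun e he => reloc_eq_self q (hΓ e he).1).trans (List.map_id' Γ)] at hiso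
  exact Quot.sound hiso

/-! ## Reductions of probability one -/

namespace QNet

/-- Reduction by steps of probability one. -/
def Red : QNet → QNet → Prop := Relation.ReflTransGen fun n n' => n.Step [(1, n')]

/-- `n` reduces to the points of `l` with the probabilities of `l`, so that the reductions of these
points extend to reductions of `n`. -/
def Reach (n : QNet) (l : List (ℝ≥0 × QNet)) : Prop :=
  ∀ E : Fin l.length → QNet →₀ ℝ≥0, (∀ i, (l.get i).2.Reduces (E i)) →
    n.Reduces (∑ i, (l.get i).1 • E i)

variable {n n' n'' : QNet} {l : List (ℝ≥0 × QNet)}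

theorem Red.trans (h : n.Red n') (h' : n'.Red n'') : n.Red n'' := Relation.ReflTransGen.trans h h'

theorem Red.of_eq (h : n = n') : n.Red n' := h ▸ Relation.ReflTransGen.refl

theorem Red.of_step {N N' : QStruct} (h : N.Step [(1, N')]) : (mk N).Red (mk N') :=
  Relation.ReflTransGen.single ⟨N, _, rfl, h, rfl⟩

theorem Reach.of_step (h : n.Step l) : n.Reach l := fun E hE => Multi.step n l E h hE

theorem Reach.head (h : n.Red n') (h' : n'.Reach l) : n.Reach l := by
  induction h using Relation.ReflTransGen.head_induction_on with
  | refl => exact h'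
  | @head n n' hs _ ih =>
    intro E hE
    simpa [Reduces] using Multi.step n [(1, n')] (fun _ => ∑ i, (l.get i).1 • E i) hs fun i => by
      obtain rfl : i = 0 := Subsingleton.elim (α := Fin 1) i 0
      exact ih E hE

theorem Red.reach (h : n.Red n') : n.Reach [(1, n')] :=
  Reach.head h fun E hE => by simpa using hE 0

variable {L K : List Link} {a b c a' b' c' : Edge}

theorem mk_cut_swap (a b : Edge) (L : List Link) (Γ : List Edge) (V : Finset ℕ) (Q : Reg) :
    mk ⟨.cut a b :: L, Γ, V, Q⟩ = mk ⟨.cut b a :: L, Γ, V, Q⟩ :=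
  Quot.sound (.same Γ V Q (.cut a b L))

theorem Red.axCut (h : L.Perm (.cut a b :: .ax b c :: K)) (hac : a ≠ c) (Γ : List Edge)
    (V : Finset ℕ) (Q : Reg) :
    (mk ⟨L, Γ, V, Q⟩).Red (mk ⟨Link.mapList (Function.update id a c) id K, Γ, V, Q⟩) := by
  rw [mk_perm h]
  exact .of_step (.axCut a b c K Γ V Q hac)

theorem Red.tensPar (h : L.Perm (.cut c c' :: .tens a b c :: .par a' b' c' :: K))
    (Γ : List Edge) (V : Finset ℕ) (Q : Reg) :
    (mk ⟨L, Γ, V, Q⟩).Red (mk ⟨.cut a a' :: .cut b b' :: K, Γ, V, Q⟩) := by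
  rw [mk_perm h]
  exact .of_step (.tensPar a b c a' b' c' K Γ V Q)

end QNet

/-! ## Substitution -/

/-- Remove the index `k` from a map on de Bruijn indices, lowering the indices above `k`. -/
def skip {α : Type*} (k : ℕ) (f : ℕ → α) : ℕ → α := fun i => if i < k then f i else f (i + 1)

section Skip

variable {α : Type*} {Γ Γ₁ Γ₂ : Ctx}

theorem skip_succ_scons (k : ℕ) (a : α) (f : ℕ → α) :
    skip (k + 1) (scons a f) = scons a (skip k f) := by
  funext i
  rcases i with _ | i <;> simp [skip, scons]

theorem skip_zero_scons (a : α) (f : ℕ → α) : skip 0 (scons a f) = f := rfl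

@[simp] theorem skip_ctxNil (k : ℕ) : skip k Ctx.nil = Ctx.nil := by
  funext i
  simp [skip, Ctx.nil]

@[simp] theorem skip_envNil (k : ℕ) : skip k Env.nil = Env.nil := by
  funext i
  simp [skip, Env.nil]

@[simp] theorem Env.tys_skip (k : ℕ) (ρ : Env) : Env.tys (skip k ρ) = skip k ρ.tys := by
  funext i
  simp only [Env.tys, skip]
  split <;> rfl

theorem skip_update_self (k : ℕ) (A : Ty) :
    skip k (Function.update Ctx.nil k (some A)) = Ctx.nil := by
  funext i
  grind [skip, Ctx.nil, Function.update_apply]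

theorem skip_update_of_ne {i k : ℕ} (h : i ≠ k) (A : Ty) :
    skip k (Function.update Ctx.nil i (some A)) =
      Function.update Ctx.nil (if k < i then i - 1 else i) (some A) := by
  funext j
  grind [skip, Ctx.nil, Function.update_apply]

theorem Ctx.Split.skip (h : Split Γ Γ₁ Γ₂) (k : ℕ) :
    Split (skip k Γ) (QSMLL.skip k Γ₁) (QSMLL.skip k Γ₂) := by
  intro i
  simp only [QSMLL.skip]
  split
  exacts [h i, h (i + 1)]

theorem Agree.skip {τ : ℕ → Ty} (h : Agree Γ τ) (k : ℕ) :
    Agree (QSMLL.skip k Γ) (QSMLL.skip k τ) := by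
  intro i A hi
  simp only [QSMLL.skip] at hi ⊢
  split_ifs at hi ⊢
  exacts [h i A hi, h (i + 1) A hi]

end Skip

section Subst

variable {G : GateSet} {Γ : Ctx} {V W : Finset ℕ} {t s : Tm G} {A B : Ty} {k : ℕ}

/-- The quantum variables that a term brings in when it replaces the variable `k` of `Γ`. -/
def Ctx.qvarsAt (Γ : Ctx) (k : ℕ) (W : Finset ℕ) : Finset ℕ := if Γ k = none then ∅ else W

theorem Ctx.Split.union_qvarsAt {Γ₁ Γ₂ : Ctx} (h : Split Γ Γ₁ Γ₂) (k : ℕ) (V₁ V₂ W : Finset ℕ) :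
    V₁ ∪ V₂ ∪ Γ.qvarsAt k W = (V₁ ∪ Γ₁.qvarsAt k W) ∪ (V₂ ∪ Γ₂.qvarsAt k W) := by
  rw [Finset.union_union_union_comm]
  rcases h k with ⟨h₁, h₂⟩ | ⟨h₁, h₂⟩ <;> simp [qvarsAt, h₁, h₂]

theorem Ctx.Split.disjoint_union_qvarsAt {Γ₁ Γ₂ : Ctx} (h : Split Γ Γ₁ Γ₂) (k : ℕ)
    {V₁ V₂ W : Finset ℕ} (hV : Disjoint V₁ V₂) (hW : Disjoint (V₁ ∪ V₂) W) :
    Disjoint (V₁ ∪ Γ₁.qvarsAt k W) (V₂ ∪ Γ₂.qvarsAt k W) := by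
  rw [Finset.disjoint_union_left] at hW
  rcases h k with ⟨h₁, h₂⟩ | ⟨h₁, h₂⟩ <;> simp only [qvarsAt, h₁, h₂] <;> split_ifs <;>
    simp [hV, hW, hW.2.symm]

theorem HasType.subst (h : HasType Γ V t B) (hs : ∀ A, Γ k = some A → HasType Ctx.nil W s A)
    (hW : Disjoint V W) : HasType (skip k Γ) (V ∪ Γ.qvarsAt k W) (Tm.subst s k t) B := by
  induction h generalizing k with
  | var i A =>
    by_cases hik : i = k
    · subst hik
      simpa [Tm.subst, skip_update_self, Ctx.qvarsAt] using hs A (by simp)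
    · have hk : Ctx.qvarsAt (Function.update Ctx.nil i (some A)) k W = ∅ := by
        simp [Ctx.qvarsAt, Function.update_of_ne (Ne.symm hik), Ctx.nil]
      rw [skip_update_of_ne hik, Tm.subst, if_neg hik, hk, Finset.union_empty,
        ← apply_ite Tm.var]
      exact .var _ A
  | qvar | new | tt | ff | meas | gate =>
    rw [show Ctx.nil.qvarsAt k W = ∅ from if_pos rfl, Finset.union_empty, skip_ctxNil]
    constructor
  | lam _ ih =>
    refine .lam ?_
    rw [← skip_succ_scons]
    exact ih hs hW
  | app hΓ hV _ _ ih₁ ih₂ =>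
    rw [hΓ.union_qvarsAt]
    exact .app (hΓ.skip k) (hΓ.disjoint_union_qvarsAt k hV hW)
      (ih₁ (fun A hA => hs A (hΓ.left hA)) (Finset.disjoint_union_left.1 hW).1)
      (ih₂ (fun A hA => hs A (hΓ.right hA)) (Finset.disjoint_union_left.1 hW).2)
  | pair hΓ hV _ _ ih₁ ih₂ =>
    rw [hΓ.union_qvarsAt]
    exact .pair (hΓ.skip k) (hΓ.disjoint_union_qvarsAt k hV hW)
      (ih₁ (fun A hA => hs A (hΓ.left hA)) (Finset.disjoint_union_left.1 hW).1)
      (ih₂ (fun A hA => hs A (hΓ.right hA)) (Finset.disjoint_union_left.1 hW).2)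
  | letp hΓ hV _ _ ih₁ ih₂ =>
    rw [hΓ.union_qvarsAt]
    refine .letp (hΓ.skip k) (hΓ.disjoint_union_qvarsAt k hV hW)
      (ih₁ (fun A hA => hs A (hΓ.left hA)) (Finset.disjoint_union_left.1 hW).1) ?_
    rw [← skip_succ_scons, ← skip_succ_scons]
    exact ih₂ (k := k + 2) (fun A hA => hs A (hΓ.right hA)) (Finset.disjoint_union_left.1 hW).2
  | ite _ _ _ ih₁ ih₂ ih₃ =>
    refine .ite (ih₁ hs hW) ?_ ?_
    · simpa [Ctx.qvarsAt, Ctx.nil] using ih₂ (k := k) (by simp [Ctx.nil]) (by simp)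
    · simpa [Ctx.qvarsAt, Ctx.nil] using ih₃ (k := k) (by simp [Ctx.nil]) (by simp)

theorem HasType.tyOf_subst (h : HasType Γ V t B)
    (hs : ∀ A, Γ k = some A → HasType Ctx.nil W s A) (hW : Disjoint V W) {τ : ℕ → Ty}
    (hτ : Agree Γ τ) : tyOf (skip k τ) (Tm.subst s k t) = B :=
  (h.subst hs hW).tyOf_eq (hτ.skip k)

end Subst

/-! ## Occurrences of subterms -/

theorem branch_eq_none_of_suffix {p q z : List ℕ} (h : p <:+ q) (hz : branch p z = none) :
    branch q z = none := by
  obtain ⟨w, rfl⟩ := h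
  induction w with
  | nil => exact hz
  | cons a w ih => exact branch_cons_eq_none (by simp [ih])

@[simp] theorem branch_sibling (p : List ℕ) (a b : ℕ) : branch (a :: p) (b :: p) = none :=
  branch_eq_none_of_length_le (by simp)

/-- The structures `X i q x` occur in the structures `L i`, all at the same position `q` below `p`
and with the same conclusion `x`; the other links do not depend on `i` and have no edge below
`q`. -/
def Occurs {ι : Type*} (p : List ℕ) (X : ι → List ℕ → List ℕ → List Link)
    (L : ι → List Link) : Prop :=
  ∃ q x K, p <:+ q ∧ branch q x = none ∧ (∀ e ∈ Link.edgesList K, branch q e.name = none) ∧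
    ∀ i, (L i).Perm (X i q x ++ K)

namespace Occurs

variable {ι : Type*} {p : List ℕ} {c : ℕ} {X : ι → List ℕ → List ℕ → List Link}
  {L L' : ι → List Link} {K R : List Link}

theorem refl (X : ι → List ℕ → List ℕ → List Link) {o : List ℕ} (ho : branch p o = none) :
    Occurs p X fun i => X i p o :=
  ⟨p, o, [], List.suffix_rfl, ho, by simp [Link.edgesList], by simp⟩

theorem left (h : Occurs (c :: p) X L) (hL : ∀ i, L' i = K ++ (L i ++ R))
    (hK : ∀ e ∈ Link.edgesList K, branch (c :: p) e.name = none)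
    (hR : ∀ e ∈ Link.edgesList R, branch (c :: p) e.name = none) : Occurs p X L' := by
  obtain ⟨q, x, M, hq, hx, hM, hperm⟩ := h
  refine ⟨q, x, M ++ (K ++ R), (List.suffix_cons c p).trans hq, hx, fun e he => ?_, fun i => ?_⟩
  · simp only [Link.edgesList_append, List.mem_append] at he
    rcases he with he | he | he
    exacts [hM e he, branch_eq_none_of_suffix hq (hK e he), branch_eq_none_of_suffix hq (hR e he)]
  · rw [hL, ← List.append_assoc (X i q x)]
    exact (List.perm_append_comm_assoc _ _ _).trans ((hperm i).append_right _)

theorem right (h : Occurs (c :: p) X L) (hL : ∀ i, L' i = K ++ (R ++ L i))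
    (hK : ∀ e ∈ Link.edgesList K, branch (c :: p) e.name = none)
    (hR : ∀ e ∈ Link.edgesList R, branch (c :: p) e.name = none) : Occurs p X L' := by
  refine h.left (K := K ++ R) (R := []) (by simp [hL]) (fun e he => ?_) (by simp [Link.edgesList])
  rw [Link.edgesList_append, List.mem_append] at he
  exact he.elim (hK e) (hR e)

theorem append_left (h : Occurs (c :: p) X L) (hL : ∀ i, L' i = K ++ L i)
    (hK : ∀ e ∈ Link.edgesList K, branch (c :: p) e.name = none) : Occurs p X L' :=
  h.left (R := []) (by simpa using hL) hK (by simp [Link.edgesList])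

end Occurs

section

variable {G : GateSet} {Γ : Ctx} {V W : Finset ℕ} {t u s : Tm G} {A B : Ty}

theorem HasType.branch_sibling_eq_none (h : HasType Γ V t B) {ρ : Env} {p o : List ℕ} {c d : ℕ}
    (hρ : Agree Γ ρ.tys) (hcd : c ≠ d) (ho : branch (c :: p) o = none)
    (hΓ : ∀ i A, Γ i = some A → branch (c :: p) (ρ i).1 = none) {e : Edge}
    (he : e ∈ Link.edgesList (translate ρ (d :: p) o t)) : branch (c :: p) e.name = none := by
  rcases h.mem_edges hρ he with rfl | he | ⟨i, A, hi, rfl⟩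
  · exact ho
  · exact branch_cons_eq_none (by simp [branch_of_branch_cons he, hcd.symm])
  · exact hΓ i A hi

theorem Fits.branch_eq_none_of_mem {ρ : Env} {p o : List ℕ} (hρ : Fits Γ ρ p o)
    (h : HasType Γ V t B) {c d : ℕ} (hcd : c ≠ d) :
    ∀ e ∈ Link.edgesList (translate ρ (d :: p) (d :: p) t), branch (c :: p) e.name = none :=
  fun _ => h.branch_sibling_eq_none hρ.agree hcd (by simp) (hρ.below c).branch_eq_none

theorem HasType.branch_ite_eq_none {C : Ty} {F : Formula} (h₁ : HasType Ctx.nil V t C)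
    (h₂ : HasType Ctx.nil W u C) {p o : List ℕ} (ho : branch p o = none) :
    ∀ e ∈ Link.edgesList [.cut ⟨0 :: p, .one⟩ ⟨1 :: p, .bot⟩,
      .box ⟨1 :: p, .bot⟩ [⟨o, F⟩] (translate Env.nil (2 :: p) o t)
        (translate Env.nil (3 :: p) o u)], branch (0 :: p) e.name = none := by
  have ho' : branch (0 :: p) o = none := branch_cons_eq_none (by simp [ho])
  have hw {w : Tm G} {X : Finset ℕ} (h : HasType Ctx.nil X w C) {c : ℕ} (hc : 0 ≠ c) (e : Edge) :=
    h.branch_sibling_eq_none (e := e) (Agree.nil Env.nil.tys) hc ho' (by simp [Ctx.nil])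
  simpa [Link.edgesList, Link.edges, ho', or_imp, forall_and] using
    And.intro (hw h₁ (show 0 ≠ 2 by decide)) (hw h₂ (show 0 ≠ 3 by decide))

/-- The two structures exchanged by the substitution of `s` for a variable: for `false` the axiom
between the conclusion `e` for this variable and the conclusion for its type `A`, for `true` the net
of `s`. -/
def substHole (e : Edge) (A : Ty) (s : Tm G) : Bool → List ℕ → List ℕ → List Link
  | false, _, x => [.ax e ⟨x, A.toFormula⟩]
  | true, q, x => translate Env.nil q x s

/-- The effect of a substitution for the variable `k`: the structures `X` occur in `L` if `k` is a
variable of `Γ`, and `L` is constant if not. -/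
def SubstOccurs (Γ : Ctx) (k : ℕ) (p : List ℕ) (X : Bool → List ℕ → List ℕ → List Link)
    (L : Bool → List Link) : Prop :=
  if Γ k = none then L true = L false else Occurs p X L

namespace SubstOccurs

variable {Γ₁ Γ₂ : Ctx} {k c d : ℕ} {p : List ℕ} {X : Bool → List ℕ → List ℕ → List Link}
  {L L' L₁ L₂ : Bool → List Link} {K : List Link}

theorem append_left (h : SubstOccurs Γ k (c :: p) X L)
    (hL : L' false = K ++ L false ∧ L' true = K ++ L true)
    (hK : ∀ e ∈ Link.edgesList K, branch (c :: p) e.name = none) : SubstOccurs Γ k p X L' := by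
  unfold SubstOccurs at h ⊢
  split_ifs at h ⊢
  · rw [hL.1, hL.2, h]
  · exact h.append_left (Bool.forall_bool.2 hL) hK

theorem append (hΓ : Ctx.Split Γ Γ₁ Γ₂) (h₁ : SubstOccurs Γ₁ k (c :: p) X L₁)
    (h₂ : SubstOccurs Γ₂ k (d :: p) X L₂)
    (hL : L' false = K ++ (L₁ false ++ L₂ false) ∧ L' true = K ++ (L₁ true ++ L₂ true))
    (hK : ∀ e ∈ Link.edgesList K, branch (c :: p) e.name = none ∧ branch (d :: p) e.name = none)
    (hL₁ : ∀ e ∈ Link.edgesList (L₁ false), branch (d :: p) e.name = none)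
    (hL₂ : ∀ e ∈ Link.edgesList (L₂ false), branch (c :: p) e.name = none) :
    SubstOccurs Γ k p X L' := by
  unfold SubstOccurs at h₁ h₂ ⊢
  rcases hΓ k with ⟨hk₁, hk₂⟩ | ⟨hk₁, hk₂⟩
  · rw [if_pos hk₂] at h₂
    rw [hk₁] at h₁
    split_ifs at h₁ ⊢
    · rw [hL.1, hL.2, h₁, h₂]
    · exact h₁.left (Bool.forall_bool.2 ⟨hL.1, h₂ ▸ hL.2⟩) (fun e he => (hK e he).1) hL₂
  · rw [if_pos hk₁] at h₁
    rw [hk₂] at h₂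
    split_ifs at h₂ ⊢
    · rw [hL.1, hL.2, h₁, h₂]
    · exact h₂.right (Bool.forall_bool.2 ⟨hL.1, h₁ ▸ hL.2⟩) (fun e he => (hK e he).2) hL₁

end SubstOccurs

/-- The translations of `t` before (`false`) and after (`true`) the substitution of `s` for the
variable `k`. -/
def substLinks (ρ : Env) (k : ℕ) (s : Tm G) (p o : List ℕ) (t : Tm G) : Bool → List Link
  | false => translate ρ p o t
  | true => translate (skip k ρ) p o (Tm.subst s k t)

section Split

variable {Γ₁ Γ₂ : Ctx} {V₁ V₂ : Finset ℕ} {C D : Ty} {ρ : Env} {k : ℕ} {p o : List ℕ}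
  {X : Bool → List ℕ → List ℕ → List Link}

theorem SubstOccurs.app (hΓ : Ctx.Split Γ Γ₁ Γ₂) (hρ : Fits Γ ρ p o)
    (h₁ : HasType Γ₁ V₁ t (.arr A B)) (h₂ : HasType Γ₂ V₂ u A)
    (ht : tyOf (skip k ρ.tys) (Tm.subst s k t) = .arr A B)
    (hu : tyOf (skip k ρ.tys) (Tm.subst s k u) = A)
    (hi₁ : SubstOccurs Γ₁ k (0 :: p) X (substLinks ρ k s (0 :: p) (0 :: p) t))
    (hi₂ : SubstOccurs Γ₂ k (1 :: p) X (substLinks ρ k s (1 :: p) (1 :: p) u)) :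
    SubstOccurs Γ k p X (substLinks ρ k s p o (.app t u)) := by
  have hρ₁ := hρ.left hΓ
  have hρ₂ := hρ.right hΓ
  refine hi₁.append hΓ hi₂ (K := [_, _, _]) ⟨rfl, ?_⟩ ?_
    (hρ₁.branch_eq_none_of_mem h₁ one_ne_zero) (hρ₂.branch_eq_none_of_mem h₂ zero_ne_one)
  · simp [substLinks, Tm.subst, translate, tyOf, ht, hu, h₁.tyOf_eq hρ₁.agree,
      h₂.tyOf_eq hρ₂.agree]
  · simp [Link.edgesList, Link.edges, (hρ.below _).branch_out]

theorem SubstOccurs.pair (hΓ : Ctx.Split Γ Γ₁ Γ₂) (hρ : Fits Γ ρ p o)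
    (h₁ : HasType Γ₁ V₁ t A) (h₂ : HasType Γ₂ V₂ u B)
    (ht : tyOf (skip k ρ.tys) (Tm.subst s k t) = A)
    (hu : tyOf (skip k ρ.tys) (Tm.subst s k u) = B)
    (hi₁ : SubstOccurs Γ₁ k (0 :: p) X (substLinks ρ k s (0 :: p) (0 :: p) t))
    (hi₂ : SubstOccurs Γ₂ k (1 :: p) X (substLinks ρ k s (1 :: p) (1 :: p) u)) :
    SubstOccurs Γ k p X (substLinks ρ k s p o (.pair t u)) := by
  have hρ₁ := hρ.left hΓ
  have hρ₂ := hρ.right hΓ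
  refine hi₁.append hΓ hi₂ (K := [_]) ⟨rfl, ?_⟩ ?_
    (hρ₁.branch_eq_none_of_mem h₁ one_ne_zero) (hρ₂.branch_eq_none_of_mem h₂ zero_ne_one)
  · simp [substLinks, Tm.subst, translate, ht, hu, h₁.tyOf_eq hρ₁.agree, h₂.tyOf_eq hρ₂.agree]
  · simp [Link.edgesList, Link.edges, (hρ.below _).branch_out]

theorem SubstOccurs.letp (hΓ : Ctx.Split Γ Γ₁ Γ₂) (hρ : Fits Γ ρ p o)
    (h₁ : HasType Γ₁ V₁ t (.tens C D))
    (h₂ : HasType (scons (some D) (scons (some C) Γ₂)) V₂ u B)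
    (ht : tyOf (skip k ρ.tys) (Tm.subst s k t) = .tens C D)
    (hi₁ : SubstOccurs Γ₁ k (0 :: p) X (substLinks ρ k s (0 :: p) (0 :: p) t))
    (hi₂ : SubstOccurs Γ₂ k (4 :: p) X
      (substLinks (scons (2 :: p, D) (scons (1 :: p, C) ρ)) (k + 2) s (4 :: p) o u)) :
    SubstOccurs Γ k p X (substLinks ρ k s p o (.letp t u)) := by
  have hρ₁ := hρ.left hΓ
  have hρ₂ := hρ.right hΓ
  let F : Formula := .par C.toFormula.neg D.toFormula.neg
  refine hi₁.append hΓ hi₂ (K := [.cut ⟨0 :: p, (Ty.tens C D).toFormula⟩ ⟨3 :: p, F⟩,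
    .par ⟨1 :: p, C.toFormula.neg⟩ ⟨2 :: p, D.toFormula.neg⟩ ⟨3 :: p, F⟩]) ⟨?_, ?_⟩ ?_
    (hρ₁.branch_eq_none_of_mem h₁ (by decide)) fun e =>
      h₂.branch_sibling_eq_none (hρ₂.letp C D).agree (by decide) (hρ.below 0).branch_out ?_
  · simp [substLinks, translate, h₁.tyOf_eq hρ₁.agree, Ty.components, F]
  · simp [substLinks, Tm.subst, translate, ht, skip_succ_scons, Ty.components, F]
  · simp [Link.edgesList, Link.edges]
  · rintro (_ | _ | i) A hA
    exacts [branch_sibling .., branch_sibling .., (hρ₂.below 0).branch_eq_none i A hA]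

end Split

theorem HasType.substOccurs (h : HasType Γ V t B) {k : ℕ}
    (hs : ∀ A, Γ k = some A → HasType Ctx.nil W s A) (hW : Disjoint V W) {ρ : Env} {p o : List ℕ}
    (hρ : Fits Γ ρ p o) :
    SubstOccurs Γ k p (substHole (ρ.edge k) (ρ k).2 s) (substLinks ρ k s p o t) := by
  induction h generalizing k ρ p o with
  | var i A =>
    by_cases hik : i = k
    · subst hik
      have hs' := (hs A (by simp)).translate_congr p o (Agree.nil (Env.tys (skip i ρ)))
        (ρ' := Env.nil) (by simp [Ctx.nil])
      rw [SubstOccurs, if_neg (by simp)]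
      convert Occurs.refl _ hρ.branch_out using 1
      funext b
      cases b <;> simp [substLinks, substHole, translate, Tm.subst, Env.edge, hs']
    · rw [SubstOccurs, if_pos (by simp [Function.update_of_ne (Ne.symm hik), Ctx.nil])]
      grind [substLinks, Tm.subst, translate, skip]
  | qvar | new | tt | ff | meas | gate => rfl
  | @lam Γ _ A B t h ih =>
    have ht := h.tyOf_subst (k := k + 1) hs hW (hρ.agree.scons A)
    have hi : SubstOccurs Γ k (0 :: p) (substHole (ρ.edge k) (ρ k).2 s) _ :=
      ih (k := k + 1) hs hW (hρ.lam A)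
    refine hi.append_left (K := [_]) ⟨rfl, ?_⟩ ?_
    · rw [skip_succ_scons] at ht
      simp [substLinks, Tm.subst, translate, skip_succ_scons, ht, h.tyOf_eq (hρ.agree.scons A)]
    · simp [Link.edgesList, Link.edges, (hρ.below 0).branch_out]
  | app hΓ _ h₁ h₂ ih₁ ih₂ | pair hΓ _ h₁ h₂ ih₁ ih₂ =>
    obtain ⟨hW₁, hW₂⟩ := Finset.disjoint_union_left.1 hW
    have hρ₁ := hρ.left hΓ
    have hρ₂ := hρ.right hΓ
    have hs₁ A hA := hs A (hΓ.left hA)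
    have hs₂ A hA := hs A (hΓ.right hA)
    have ht := h₁.tyOf_subst hs₁ hW₁ hρ₁.agree
    have hu := h₂.tyOf_subst hs₂ hW₂ hρ₂.agree
    have hi₁ := ih₁ hs₁ hW₁ (hρ₁.child 0)
    have hi₂ := ih₂ hs₂ hW₂ (hρ₂.child 1)
    first
    | exact .app hΓ hρ h₁ h₂ ht hu hi₁ hi₂
    | exact .pair hΓ hρ h₁ h₂ ht hu hi₁ hi₂
  | letp hΓ _ h₁ h₂ ih₁ ih₂ =>
    obtain ⟨hW₁, hW₂⟩ := Finset.disjoint_union_left.1 hW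
    have hρ₁ := hρ.left hΓ
    have hs₁ A hA := hs A (hΓ.left hA)
    exact .letp hΓ hρ h₁ h₂ (h₁.tyOf_subst hs₁ hW₁ hρ₁.agree) (ih₁ hs₁ hW₁ (hρ₁.child 0))
      (ih₂ (k := k + 2) (fun A hA => hs A (hΓ.right hA)) hW₂ ((hρ.right hΓ).letp _ _))
  | @ite Γ _ C t u v _ h₂ h₃ ih₁ ih₂ ih₃ =>
    have hi₁ := ih₁ hs hW (hρ.child 0)
    have hu : translate Env.nil (2 :: p) o (Tm.subst s k u) = translate Env.nil (2 :: p) o u := by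
      simpa [SubstOccurs, substLinks, Ctx.nil] using ih₂ (k := k) (by simp [Ctx.nil]) (by simp)
        (Fits.nil Env.nil (hρ.below 2).branch_out)
    have hv : translate Env.nil (3 :: p) o (Tm.subst s k v) = translate Env.nil (3 :: p) o v := by
      simpa [SubstOccurs, substLinks, Ctx.nil] using ih₃ (k := k) (by simp [Ctx.nil]) (by simp)
        (Fits.nil Env.nil (hρ.below 3).branch_out)
    have hC := h₂.tyOf_subst (s := s) (W := W) (k := k) (by simp [Ctx.nil]) (by simp)
      (Agree.nil Env.nil.tys)
    rw [← Env.tys_skip, skip_envNil] at hC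
    refine hi₁.append_left (K := [_, _]) ⟨rfl, ?_⟩ ?_
    · simp [substLinks, Tm.subst, translate, hu, hv, hC, h₂.tyOf_eq (Agree.nil _)]
    · exact h₂.branch_ite_eq_none h₃ hρ.branch_out

theorem EvalCtx.tyOf_fill (E : EvalCtx G) {τ : ℕ → Ty} {u : Tm G} (h : tyOf τ u = tyOf τ t) :
    tyOf τ (E.fill u) = tyOf τ (E.fill t) := by
  induction E <;> simp_all [EvalCtx.fill, tyOf]

theorem HasType.lam_inv (h : HasType Γ V (.lam A t) B) :
    ∃ C, B = .arr A C ∧ HasType (scons (some A) Γ) V t C := by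
  cases h with | lam h => exact ⟨_, rfl, h⟩

theorem HasType.app_inv (h : HasType Ctx.nil V (.app t u) B) : ∃ V₁ V₂ A, V = V₁ ∪ V₂ ∧
    Disjoint V₁ V₂ ∧ HasType Ctx.nil V₁ t (.arr A B) ∧ HasType Ctx.nil V₂ u A := by
  generalize hΓ : Ctx.nil = Γ at h
  cases h with
  | app hs hV h₁ h₂ =>
    subst hΓ
    obtain ⟨rfl, rfl⟩ := hs.eq_nil
    exact ⟨_, _, _, rfl, hV, h₁, h₂⟩

theorem HasType.pair_inv (h : HasType Ctx.nil V (.pair t u) C) : ∃ V₁ V₂ A B, V = V₁ ∪ V₂ ∧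
    Disjoint V₁ V₂ ∧ C = .tens A B ∧ HasType Ctx.nil V₁ t A ∧ HasType Ctx.nil V₂ u B := by
  generalize hΓ : Ctx.nil = Γ at h
  cases h with
  | pair hs hV h₁ h₂ =>
    subst hΓ
    obtain ⟨rfl, rfl⟩ := hs.eq_nil
    exact ⟨_, _, _, _, rfl, hV, rfl, h₁, h₂⟩

theorem HasType.letp_inv (h : HasType Ctx.nil V (.letp t u) C) : ∃ V₁ V₂ A B, V = V₁ ∪ V₂ ∧
    Disjoint V₁ V₂ ∧ HasType Ctx.nil V₁ t (.tens A B) ∧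
    HasType (scons (some B) (scons (some A) Ctx.nil)) V₂ u C := by
  generalize hΓ : Ctx.nil = Γ at h
  cases h with
  | letp hs hV h₁ h₂ =>
    subst hΓ
    obtain ⟨rfl, rfl⟩ := hs.eq_nil
    exact ⟨_, _, _, _, rfl, hV, h₁, h₂⟩

theorem HasType.ite_inv {v : Tm G} (h : HasType Γ V (.ite t u v) A) :
    HasType Γ V t .bool ∧ HasType Ctx.nil ∅ u A ∧ HasType Ctx.nil ∅ v A := by
  cases h with | ite h₁ h₂ h₃ => exact ⟨h₁, h₂, h₃⟩

theorem EvalCtx.hasType_hole (E : EvalCtx G) {C : Ty} (h : HasType Ctx.nil W (E.fill t) C) :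
    ∃ W₀ B, HasType Ctx.nil W₀ t B := by
  induction E generalizing W C with
  | hole => exact ⟨W, C, h⟩
  | appL E v ih =>
    obtain ⟨_, _, _, _, _, h, _⟩ := h.app_inv
    exact ih h
  | appR a ha E ih =>
    obtain ⟨_, _, _, _, _, _, h⟩ := h.app_inv
    exact ih h
  | pairL E v ih =>
    obtain ⟨_, _, _, _, _, _, _, h, _⟩ := h.pair_inv
    exact ih h
  | pairR a ha E ih =>
    obtain ⟨_, _, _, _, _, _, _, _, h⟩ := h.pair_inv
    exact ih h
  | letp E v ih =>
    obtain ⟨_, _, _, _, _, _, h, _⟩ := h.letp_inv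
    exact ih h
  | ite E v w ih => exact ih h.ite_inv.1

theorem EvalCtx.occurs_fill (E : EvalCtx G) {C : Ty} (h : HasType Ctx.nil W (E.fill t) C)
    {p o : List ℕ} (ho : branch p o = none) :
    Occurs p (fun (u : {u : Tm G // tyOf Env.nil.tys u = tyOf Env.nil.tys t}) q x =>
      translate Env.nil q x u.1) fun u => translate Env.nil p o (E.fill u.1) := by
  have hE (E : EvalCtx G) (u : {u : Tm G // tyOf Env.nil.tys u = tyOf Env.nil.tys t}) :
      tyOf Env.nil.tys (E.fill u.1) = tyOf Env.nil.tys (E.fill t) := E.tyOf_fill u.2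
  have hρ : Fits Ctx.nil Env.nil p o := .nil _ ho
  induction E generalizing W C p o with
  | hole => exact .refl _ ho
  | appL E v ih =>
    obtain ⟨_, _, _, _, _, h₁, h₂⟩ := h.app_inv
    simp only [EvalCtx.fill, translate, tyOf, hE]
    refine (ih h₁ (branch_self _) (hρ.child 0)).left (K := [_, _, _]) (fun _ => rfl) ?_
      (hρ.branch_eq_none_of_mem h₂ (by decide))
    simp [Link.edgesList, Link.edges, (hρ.below _).branch_out]
  | appR a _ E ih =>
    obtain ⟨_, _, _, _, _, h₁, h₂⟩ := h.app_inv
    simp only [EvalCtx.fill, translate, tyOf, hE]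
    refine (ih h₂ (branch_self _) (hρ.child 1)).right (K := [_, _, _]) (fun _ => rfl) ?_
      (hρ.branch_eq_none_of_mem h₁ (by decide))
    simp [Link.edgesList, Link.edges, (hρ.below _).branch_out]
  | pairL E v ih =>
    obtain ⟨_, _, _, _, _, _, _, h₁, h₂⟩ := h.pair_inv
    simp only [EvalCtx.fill, translate, hE]
    refine (ih h₁ (branch_self _) (hρ.child 0)).left (K := [_]) (fun _ => rfl) ?_
      (hρ.branch_eq_none_of_mem h₂ (by decide))
    simp [Link.edgesList, Link.edges, (hρ.below _).branch_out]
  | pairR a _ E ih =>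
    obtain ⟨_, _, _, _, _, _, _, h₁, h₂⟩ := h.pair_inv
    simp only [EvalCtx.fill, translate, hE]
    refine (ih h₂ (branch_self _) (hρ.child 1)).right (K := [_]) (fun _ => rfl) ?_
      (hρ.branch_eq_none_of_mem h₁ (by decide))
    simp [Link.edgesList, Link.edges, (hρ.below _).branch_out]
  | letp E v ih =>
    obtain ⟨_, _, A, B, _, _, h₁, h₂⟩ := h.letp_inv
    simp only [EvalCtx.fill, translate, hE, h₁.tyOf_eq (Agree.nil _), Ty.components]
    refine (ih h₁ (branch_self _) (hρ.child 0)).left (K := [_, _]) (fun _ => rfl) ?_ fun e =>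
      h₂.branch_sibling_eq_none (hρ.letp A B).agree (by decide) (hρ.below 0).branch_out ?_
    · simp [Link.edgesList, Link.edges]
    · rintro (_ | _ | i) D hD
      exacts [branch_sibling .., branch_sibling .., (hρ.below 0).branch_eq_none i D hD]
  | ite E v w ih =>
    obtain ⟨h₁, h₂, h₃⟩ := h.ite_inv
    simp only [EvalCtx.fill, translate]
    refine (ih h₁ (branch_self _) (hρ.child 0)).append_left (K := [_, _]) (fun _ => rfl)
      (h₂.branch_ite_eq_none h₃ ho)

end

/-! ## Redexes without quantum effects -/

theorem Link.mapList_update_eq_self {a : Edge} (c : Edge) {L : List Link}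
    (h : ∀ e ∈ edgesList L, e ≠ a) : mapList (Function.update id a c) id L = L :=
  mapList_eq_self fun e he => by simp [h e he]

theorem HasType.branch_eq_some_of_mem {G : GateSet} {W : Finset ℕ} {t : Tm G} {B : Ty}
    (h : HasType Ctx.nil W t B) {p : List ℕ} {d : ℕ} {e : Edge}
    (he : e ∈ Link.edgesList (translate Env.nil (d :: p) (d :: p) t)) :
    branch p e.name = some d := by
  rcases h.mem_edges (.nil _) he with rfl | he | he
  exacts [branch_cons_self p d, branch_of_branch_cons he, by simp at he]

namespace QNet.Red

theorem axCut_symm {a b c : Edge} {L K : List Link} (h : L.Perm (.cut b a :: .ax b c :: K))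
    (hac : a ≠ c) (Γ : List Edge) (V : Finset ℕ) (Q : Reg) :
    (mk ⟨L, Γ, V, Q⟩).Red (mk ⟨Link.mapList (Function.update id a c) id K, Γ, V, Q⟩) := by
  rw [mk_perm h, mk_cut_swap]
  exact axCut (.refl _) hac Γ V Q

theorem tensPar_symm {a b c a' b' c' : Edge} {L K : List Link}
    (h : L.Perm (.cut c' c :: .tens a b c :: .par a' b' c' :: K)) (Γ : List Edge) (V : Finset ℕ)
    (Q : Reg) : (mk ⟨L, Γ, V, Q⟩).Red (mk ⟨.cut a a' :: .cut b b' :: K, Γ, V, Q⟩) := by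
  rw [mk_perm h, mk_cut_swap]
  exact tensPar (.refl _) Γ V Q

variable {G : GateSet} {W W₁ W₂ : Finset ℕ} {s t u v : Tm G} {A B C : Ty} {p x : List ℕ}
  {K : List Link} {Δ : List Edge}

theorem cut_subst {Γ : Ctx} (h : HasType Γ W₁ t B) (hs : HasType Ctx.nil W₂ s A)
    (hW : Disjoint W₁ W₂) {k : ℕ} (hk : Γ k = some A) {ρ : Env} (hρ : Fits Γ ρ p x) {r : List ℕ}
    {d : ℕ} (ht : ∀ e ∈ Link.edgesList (translate ρ p x t), branch r e.name ≠ some d)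
    (hK : ∀ e ∈ Link.edgesList K, branch r e.name ≠ some d ∧ branch p e.name = none)
    (hΔ : ∀ e ∈ Δ, branch r e.name ≠ some d ∧ branch p e.name = none) (V : Finset ℕ) (Q : Reg) :
    (mk ⟨.cut ⟨d :: r, A.toFormula⟩ (ρ.edge k) ::
      (translate ρ p x t ++ (translate Env.nil (d :: r) (d :: r) s ++ K)), Δ, V, Q⟩).Red
    (mk ⟨translate (skip k ρ) p x (Tm.subst s k t) ++ K, Δ, V, Q⟩) := by
  have hocc := h.substOccurs (fun A' hA' => Option.some.inj (hk.symm.trans hA') ▸ hs) hW hρ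
  rw [SubstOccurs, if_neg (by simp [hk]), show (ρ k).2 = A from hρ.agree k A hk] at hocc
  obtain ⟨q, y, L, hpq, hy, hL, hperm⟩ := hocc
  have hvar : (translate ρ p x t).Perm (.ax (ρ.edge k) ⟨y, A.toFormula⟩ :: L) := hperm false
  have ht' (e : Edge) (he : e = ⟨y, A.toFormula⟩ ∨ e ∈ Link.edgesList L) :
      branch r e.name ≠ some d := by
    refine ht e ?_
    simp only [Link.mem_edgesList, hvar.mem_iff, List.mem_cons, exists_eq_or_imp, Link.edges]
    rw [← Link.mem_edgesList]
    grind
  have hLK : ∀ e ∈ Link.edgesList (L ++ K),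
      branch r e.name ≠ some d ∧ branch (d :: r) e.name = none ∧ branch q e.name = none := by
    have := @branch_eq_none_of_suffix p q
    have := @branch_cons_eq_none r
    grind [Link.edgesList_append]
  have hred := axCut (L := .cut ⟨d :: r, A.toFormula⟩ (ρ.edge k) ::
      (translate ρ p x t ++ (translate Env.nil (d :: r) (d :: r) s ++ K)))
    (b := ρ.edge k) (c := ⟨y, A.toFormula⟩) (a := ⟨d :: r, A.toFormula⟩)
    (K := translate Env.nil (d :: r) (d :: r) s ++ (L ++ K))
    (.cons _ ((hvar.append_right _).trans (.cons _ (List.perm_append_comm_assoc _ _ _))))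
    (fun h => ht' _ (.inl rfl) (by rw [← h]; simp)) Δ V Q
  rw [mapList_append, hs.mapList_update_translate y (.nil _ (branch_self _)),
    Link.mapList_update_eq_self _ fun e he h => (hLK e he).1 (by simp [h]),
    mk_relocate hs V Q (branch_cons_eq_none (ht' _ (.inl rfl))) hy (fun e he => (hLK e he).2)
      fun e he => ⟨branch_cons_eq_none (hΔ e he).1, branch_eq_none_of_suffix hpq (hΔ e he).2⟩]
    at hred
  refine hred.trans (.of_eq (mk_perm ?_ Δ V Q))
  rw [← List.append_assoc]
  exact (hperm true).symm.append_right K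

theorem app_lam {τ : Env} (ht : HasType (scons (some A) Ctx.nil) W₁ t B)
    (hu : HasType Ctx.nil W₂ u A) (hx : branch p x = none)
    (hK : ∀ e ∈ Link.edgesList K, branch p e.name = none)
    (hτ : τ = scons (1 :: 0 :: p, A) Env.nil) (Δ : List Edge) (V : Finset ℕ) (Q : Reg) :
    (mk ⟨translate Env.nil p x (.app (.lam A t) u) ++ K, Δ, V, Q⟩).Red
    (mk ⟨.cut ⟨1 :: p, A.toFormula⟩ (τ.edge 0) ::
      (translate τ (0 :: 0 :: p) x t ++ (translate Env.nil (1 :: p) (1 :: p) u ++ K)), Δ, V,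
      Q⟩) := by
  have hnil := Agree.nil Env.nil.tys
  have hfit := hτ ▸ ((Fits.nil Env.nil (branch_self p)).child 0).lam A
  have hx' : x ≠ 0 :: 0 :: p := ne_cons_of_branch_eq_none
    (branch_eq_none_of_suffix (List.suffix_cons 0 p) hx) 0
  have hcut := tensPar_symm (L := translate Env.nil p x (.app (.lam A t) u) ++ K)
    (a := ⟨1 :: p, A.toFormula⟩) (b := ⟨2 :: p, B.toFormula.neg⟩) (c := ⟨3 :: p, _⟩)
    (a' := τ.edge 0) (b' := ⟨0 :: 0 :: p, B.toFormula⟩) (c' := ⟨0 :: p, _⟩)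
    (K := .ax ⟨2 :: p, B.toFormula.neg⟩ ⟨x, B.toFormula⟩ ::
      (translate τ (0 :: 0 :: p) (0 :: 0 :: p) t ++ translate Env.nil (1 :: p) (1 :: p) u ++ K))
    (by
      simp only [translate, ← hτ, tyOf, ht.tyOf_eq (hnil.scons A), hu.tyOf_eq hnil,
        Ty.toFormula, ht.tyOf_eq hfit.agree]
      rw [hτ]
      exact .cons _ (.cons _ (.swap _ _ _))) Δ V Q
  have hax := axCut_symm (L := .cut ⟨1 :: p, A.toFormula⟩ (τ.edge 0) :: .cut _ _ :: .ax _ _ ::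
      (translate τ (0 :: 0 :: p) (0 :: 0 :: p) t ++ translate Env.nil (1 :: p) (1 :: p) u ++ K))
    (a := ⟨0 :: 0 :: p, B.toFormula⟩) (b := ⟨2 :: p, B.toFormula.neg⟩)
    (c := ⟨x, B.toFormula⟩) (K := translate τ (0 :: 0 :: p) (0 :: 0 :: p) t ++
      (.cut ⟨1 :: p, A.toFormula⟩ (τ.edge 0) :: (translate Env.nil (1 :: p) (1 :: p) u ++ K)))
    (by
      refine ((List.Perm.swap _ _ _).trans (.cons _ (.swap _ _ _))).trans (.cons _ (.cons _ ?_))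
      rw [List.append_assoc]
      exact List.perm_middle.symm) (by simpa using hx'.symm) Δ V Q
  rw [mapList_append, ht.mapList_update_translate x hfit, Link.mapList_update_eq_self _ (by
    have hτ₀ : τ.edge 0 = ⟨1 :: 0 :: p, A.toFormula.neg⟩ := by rw [hτ]; rfl
    have hu' : ∀ e ∈ Link.edgesList (translate Env.nil (1 :: p) (1 :: p) u),
        branch p e.name = some 1 := fun e => hu.branch_eq_some_of_mem
    grind [Link.edgesList, Link.edgesList_append, Link.edges, branch_cons_cons_self])] at hax
  exact hcut.trans (hax.trans (.of_eq (mk_perm List.perm_middle Δ V Q)))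

theorem beta (h : HasType Ctx.nil W (.app (.lam A t) u) B) (hx : branch p x = none)
    (hK : ∀ e ∈ Link.edgesList K, branch p e.name = none) (hΔ : ∀ e ∈ Δ, branch p e.name = none)
    (V : Finset ℕ) (Q : Reg) :
    (mk ⟨translate Env.nil p x (.app (.lam A t) u) ++ K, Δ, V, Q⟩).Red
      (mk ⟨translate Env.nil p x (Tm.subst u 0 t) ++ K, Δ, V, Q⟩) := by
  obtain ⟨V₁, V₂, A', rfl, hV, hlam, hu⟩ := h.app_inv
  obtain ⟨B', hAB, ht⟩ := hlam.lam_inv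
  obtain ⟨rfl, rfl⟩ := Ty.arr.inj hAB
  have hbelow (z : List ℕ) (hz : branch p z = none) : branch (0 :: 0 :: p) z = none :=
    branch_eq_none_of_suffix (List.suffix_append [0, 0] p) hz
  have hx' : 1 :: 0 :: p ≠ x := fun h => by simp [← h] at hx
  have hfit := (Fits.nil Env.nil (hbelow x hx)).scons A' (branch_sibling _ 0 1) hx'
    (by simp [Ctx.nil])
  have htp : ∀ e ∈ Link.edgesList (translate (scons (1 :: 0 :: p, A') Env.nil) (0 :: 0 :: p) x t),
      branch p e.name ≠ some 1 := by
    intro e he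
    have := ht.mem_edges hfit.agree he
    simp only [Env.edges_scons, Env.edges_nil] at this
    grind [branch_cons_cons_self, branch_ne_none_of_cons, branch_of_branch_cons]
  have hsubst := cut_subst ht hu hV (k := 0) rfl hfit htp (K := K) (Δ := Δ)
    (fun e he => by simp [hK e he, hbelow]) (fun e he => by simp [hΔ e he, hbelow]) V Q
  refine (app_lam ht hu hx hK rfl Δ V Q).trans (hsubst.trans (.of_eq ?_))
  have ht' := ht.subst (k := 0) (fun _ h => Option.some.inj h ▸ hu) hV
  exact mk_relocate ht' V Q (hbelow x hx) hx (fun e he => ⟨hbelow _ (hK e he), hK e he⟩)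
    fun e he => ⟨hbelow _ (hΔ e he), hΔ e he⟩

theorem letp_pair {ρ₁ ρ₂ : Env} (ht : HasType Ctx.nil W₁ t A) (hu : HasType Ctx.nil W₂ u B)
    (htu : tyOf Env.nil.tys (.pair t u) = .tens A B) (hρ₁ : ρ₁ = scons (1 :: p, A) Env.nil)
    (hρ₂ : ρ₂ = scons (2 :: p, B) ρ₁) (K : List Link) (Δ : List Edge) (V : Finset ℕ) (Q : Reg) :
    (mk ⟨translate Env.nil p x (.letp (.pair t u) v) ++ K, Δ, V, Q⟩).Red
    (mk ⟨.cut ⟨1 :: 0 :: p, B.toFormula⟩ (ρ₂.edge 0) :: (translate ρ₂ (4 :: p) x v ++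
      (translate Env.nil (1 :: 0 :: p) (1 :: 0 :: p) u ++
        .cut ⟨0 :: 0 :: p, A.toFormula⟩ (ρ₁.edge 0) ::
          (translate Env.nil (0 :: 0 :: p) (0 :: 0 :: p) t ++ K))), Δ, V, Q⟩) := by
  refine (tensPar (a := ⟨0 :: 0 :: p, A.toFormula⟩) (b := ⟨1 :: 0 :: p, B.toFormula⟩)
    (c := ⟨0 :: p, .tens A.toFormula B.toFormula⟩) (a' := ρ₁.edge 0) (b' := ρ₂.edge 0)
    (c' := ⟨3 :: p, .par A.toFormula.neg B.toFormula.neg⟩)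
    (K := translate Env.nil (0 :: 0 :: p) (0 :: 0 :: p) t ++
      translate Env.nil (1 :: 0 :: p) (1 :: 0 :: p) u ++ translate ρ₂ (4 :: p) x v ++ K)
    ?_ Δ V Q).trans (.of_eq (mk_perm ?_ Δ V Q))
  · simp only [translate, htu, ht.tyOf_eq (.nil Env.nil.tys), hu.tyOf_eq (.nil Env.nil.tys),
      Ty.toFormula, Ty.components, ← hρ₁, ← hρ₂]
    rw [hρ₂, hρ₁]
    exact .cons _ (.swap _ _ _)
  · classical
    simp only [List.perm_iff_count, List.count_cons, List.count_append]
    omega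

theorem cut_subst_subst {ρ₁ ρ₂ : Env} (hv : HasType (scons (some B) (scons (some A) Ctx.nil)) W v C)
    (ht : HasType Ctx.nil W₁ t A) (hu : HasType Ctx.nil W₂ u B) (hvu : Disjoint W W₂)
    (hvt : Disjoint (W ∪ W₂) W₁) (hx : branch p x = none)
    (hρ₁ : ρ₁ = scons (1 :: p, A) Env.nil) (hρ₂ : ρ₂ = scons (2 :: p, B) ρ₁)
    (hK : ∀ e ∈ Link.edgesList K, branch p e.name = none) (hΔ : ∀ e ∈ Δ, branch p e.name = none)
    (V : Finset ℕ) (Q : Reg) :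
    (mk ⟨.cut ⟨1 :: 0 :: p, B.toFormula⟩ (ρ₂.edge 0) :: (translate ρ₂ (4 :: p) x v ++
      (translate Env.nil (1 :: 0 :: p) (1 :: 0 :: p) u ++
        .cut ⟨0 :: 0 :: p, A.toFormula⟩ (ρ₁.edge 0) ::
          (translate Env.nil (0 :: 0 :: p) (0 :: 0 :: p) t ++ K))), Δ, V, Q⟩).Red
    (mk ⟨translate Env.nil (4 :: p) x (Tm.subst t 0 (Tm.subst u 0 v)) ++ K, Δ, V, Q⟩) := by
  have hbody := hv.subst (k := 0) (fun _ h => Option.some.inj h ▸ hu) hvu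
  have hfit₁ : Fits (scons (some A) Ctx.nil) ρ₁ (4 :: p) x :=
    hρ₁ ▸ ((Fits.nil Env.nil hx).below 4).scons A (branch_sibling p 4 1)
      (ne_cons_of_branch_eq_none hx 1).symm (by simp [Ctx.nil])
  have hfit₂ : Fits _ ρ₂ (4 :: p) x := hρ₂ ▸ hρ₁ ▸ (Fits.nil Env.nil hx).letp A B
  have hbelow {z : List ℕ} (hz : branch p z = none) (a : ℕ) : branch (a :: p) z = none :=
    branch_cons_eq_none (by simp [hz])
  have hedge₁ : ρ₁.edge 0 = ⟨1 :: p, A.toFormula.neg⟩ := by rw [hρ₁]; rfl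
  have hv0 : ∀ e ∈ Link.edgesList (translate ρ₂ (4 :: p) x v), branch (0 :: p) e.name = none := by
    refine fun e => hv.branch_sibling_eq_none hfit₂.agree (by decide) (hbelow hx 0) ?_
    rw [hρ₂, hρ₁]
    rintro (_ | _ | _) D hD
    exacts [branch_sibling .., branch_sibling .., by simp [scons, Ctx.nil] at hD]
  have hbody0 : ∀ e ∈ Link.edgesList (translate ρ₁ (4 :: p) x (Tm.subst u 0 v)),
      branch (0 :: p) e.name = none := by
    refine fun e => hbody.branch_sibling_eq_none hfit₁.agree (by decide) (hbelow hx 0) ?_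
    rw [hρ₁]
    rintro (_ | _) D hD
    exacts [branch_sibling .., by simp [skip_zero_scons, scons, Ctx.nil] at hD]
  have ht0 : ∀ e ∈ Link.edgesList (translate Env.nil (0 :: 0 :: p) (0 :: 0 :: p) t),
      branch (0 :: p) e.name = some 0 := fun e => ht.branch_eq_some_of_mem
  have hsubst_u := cut_subst hv hu hvu (k := 0) rfl hfit₂ (r := 0 :: p) (d := 1)
    (fun e he => by simp [hv0 e he]) (K := .cut ⟨0 :: 0 :: p, A.toFormula⟩ (ρ₁.edge 0) ::
      (translate Env.nil (0 :: 0 :: p) (0 :: 0 :: p) t ++ K))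
    (by grind [Link.edgesList, Link.edgesList_append, Link.edges, branch_cons_eq_none,
      branch_sibling, branch_cons_self, branch_cons_cons_self]) (Δ := Δ)
    (fun e he => by simp [hbelow (hΔ e he)]) V Q
  have hsubst_t := cut_subst hbody ht hvt (k := 0) rfl hfit₁ (r := 0 :: p) (d := 0) (K := K)
    (Δ := Δ) (fun e he => by simp [hbody0 e he]) (fun e he => by simp [hbelow (hK e he)])
    (fun e he => by simp [hbelow (hΔ e he)]) V Q
  rw [show skip 0 ρ₂ = ρ₁ from hρ₂ ▸ rfl] at hsubst_u
  rw [show skip 0 ρ₁ = Env.nil from hρ₁ ▸ rfl] at hsubst_t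
  exact hsubst_u.trans (.trans (.of_eq (mk_perm List.perm_middle Δ V Q)) hsubst_t)

theorem letp (h : HasType Ctx.nil W (.letp (.pair t u) v) C) (hx : branch p x = none)
    (hK : ∀ e ∈ Link.edgesList K, branch p e.name = none) (hΔ : ∀ e ∈ Δ, branch p e.name = none)
    (V : Finset ℕ) (Q : Reg) :
    (mk ⟨translate Env.nil p x (.letp (.pair t u) v) ++ K, Δ, V, Q⟩).Red
      (mk ⟨translate Env.nil p x (Tm.subst t 0 (Tm.subst u 0 v)) ++ K, Δ, V, Q⟩) := by
  obtain ⟨_, V₃, A, B, rfl, hV, htu, hv⟩ := h.letp_inv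
  have htuTy := htu.tyOf_eq (.nil Env.nil.tys)
  obtain ⟨V₁, V₂, A', B', rfl, hV', hAB, ht, hu⟩ := htu.pair_inv
  obtain ⟨rfl, rfl⟩ := Ty.tens.inj hAB
  rw [Finset.disjoint_union_left] at hV
  have hV'' : Disjoint (V₃ ∪ V₂) V₁ := Finset.disjoint_union_left.2 ⟨hV.1.symm, hV'.symm⟩
  have hbelow {z : List ℕ} (hz : branch p z = none) : branch (4 :: p) z = none :=
    branch_cons_eq_none (by simp [hz])
  have hbody := (hv.subst (k := 0) (fun _ h => Option.some.inj h ▸ hu) hV.2.symm).subst (k := 0)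
    (fun _ h => Option.some.inj h ▸ ht) hV''
  refine (letp_pair ht hu htuTy rfl rfl K Δ V Q).trans
    ((cut_subst_subst hv ht hu hV.2.symm hV'' hx rfl rfl hK hΔ V Q).trans (.of_eq ?_))
  exact mk_relocate hbody V Q (hbelow hx) hx (fun e he => ⟨hbelow (hK e he), hK e he⟩)
    fun e he => ⟨hbelow (hΔ e he), hΔ e he⟩

end QNet.Red

/-! ## Registers and measurements -/

namespace Reg

/-- The vector `Q ⊗ |r ← b⟩`, where `r` is a variable that is not in the register `Q`. -/
def addBit (b : Bool) (Q : Reg) (r : ℕ) : Reg :=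
  fun s => if decide (r ∈ s) = b then Q (s.erase r) else 0

theorem addBit_false (Q : Reg) (r : ℕ) : addBit false Q r = addZero Q r := by
  funext s
  by_cases h : r ∈ s <;> simp [addZero, addBit, h]

theorem addBit_apply_of_notMem {r : ℕ} {s : Finset ℕ} (hs : r ∉ s) (b c : Bool) (Q : Reg) :
    addBit b Q r (if c then insert r s else s) = if c = b then Q s else 0 := by
  cases c <;> simp [addBit, hs]

theorem apply_one (U : Matrix (Fin 1 → Bool) (Fin 1 → Bool) ℂ) (r : ℕ) (Q : Reg) (s : Finset ℕ) :
    apply U (fun _ => r) Q s =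
      U (fun _ => decide (r ∈ s)) (fun _ => true) * Q (insert r s) +
        U (fun _ => decide (r ∈ s)) (fun _ => false) * Q (s.erase r) := by
  have hsum (f : (Fin 1 → Bool) → ℂ) : ∑ y, f y = f (fun _ => true) + f (fun _ => false) :=
    ((Equiv.funUnique (Fin 1) Bool).symm.sum_comp f).symm.trans (Fintype.sum_bool _)
  have htrue : setBits (fun _ : Fin 1 => r) (fun _ => true) s = insert r s := by
    ext x; simp [setBits]
  have hfalse : setBits (fun _ : Fin 1 => r) (fun _ => false) s = s.erase r := by
    ext x; simp [setBits, and_comm]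
  rw [apply, hsum, htrue, hfalse]

theorem apply_gateI_addZero (Q : Reg) (r : ℕ) :
    apply gateI.1 (fun _ => r) (addZero Q r) = addBit false Q r := by
  funext s
  rw [← addBit_false, apply_one]
  by_cases h : r ∈ s <;> simp [addBit, gateI, h, funext_iff]

theorem apply_gateX_addZero (Q : Reg) (r : ℕ) :
    apply gateX.1 (fun _ => r) (addZero Q r) = addBit true Q r := by
  funext s
  rw [← addBit_false, apply_one]
  by_cases h : r ∈ s <;> simp [addBit, gateX, h, matX]

variable {V : Finset ℕ} {Q : Reg} {r : ℕ}

theorem prob_insert (hr : r ∉ V) (Q : Reg) (b : Bool) :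
    prob (insert r V) Q r b = ∑ s ∈ V.powerset, ‖Q (if b then insert r s else s)‖₊ ^ 2 := by
  have hs : ∀ s ∈ V.powerset, r ∉ s := fun s hs hrs => hr (Finset.mem_powerset.1 hs hrs)
  rw [prob, Finset.sum_filter, Finset.sum_powerset_insert hr, ← Finset.sum_add_distrib]
  refine Finset.sum_congr rfl fun s h => ?_
  cases b <;> simp [hs s h]

theorem prob_addBit (hQ : Q.IsState V) (hr : r ∉ V) (b c : Bool) :
    prob (insert r V) (addBit b Q r) r c = if c = b then 1 else 0 := by
  have hnorm : ∑ s ∈ V.powerset, ‖Q s‖₊ ^ 2 = 1 := NNReal.coe_injective (by simpa using hQ.2)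
  calc prob (insert r V) (addBit b Q r) r c
      = ∑ s ∈ V.powerset, ‖if c = b then Q s else 0‖₊ ^ 2 := by
        rw [prob_insert hr]
        refine Finset.sum_congr rfl fun s hs => ?_
        rw [addBit_apply_of_notMem fun hrs => hr (Finset.mem_powerset.1 hs hrs)]
    _ = if c = b then 1 else 0 := by split_ifs <;> simp [hnorm]

theorem proj_addBit (hQ : Q.IsState V) (hr : r ∉ V) (b : Bool) :
    proj (insert r V) (addBit b Q r) r b = Q := by
  funext s
  rw [proj, prob_addBit hQ hr]
  by_cases hs : r ∈ s
  · rw [if_pos hs, hQ.1 s fun hsV => hr (hsV hs)]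
  · rw [if_neg hs, addBit_apply_of_notMem hs]
    simp

end Reg

theorem measList_eq_singleton {X : Type*} {p : Bool → ℝ≥0} {b : Bool}
    (h : ∀ c, p c = if c = b then 1 else 0) (x : Bool → X) : measList p x = [(1, x b)] := by
  cases b <;> simp [measList, h]

theorem mapList_measList {X Y : Type*} (f : X → Y) (p : Bool → ℝ≥0) (x : Bool → X) :
    mapList f (measList p x) = measList p fun b => f (x b) := by
  simp [mapList, measList]

theorem forall_mem_measList {X : Type*} {p : Bool → ℝ≥0} {x : Bool → X} {P : ℝ≥0 × X → Prop}
    (h : ∀ b, P (p b, x b)) : ∀ d ∈ measList p x, P d :=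
  List.forall_mem_map.2 fun b _ => h b

/-! ## Redexes of bits and measurements -/

namespace QNet

variable {G : GateSet} {p x : List ℕ} {K : List Link} {Δ : List Edge}

theorem Red.bitNet (U : QGate 1) (q o : List ℕ) {r : ℕ} {V : Finset ℕ} (hr : r ∉ V) (K : List Link)
    (Δ : List Edge) (Q : Reg) :
    (mk ⟨QSMLL.bitNet U q o ++ K, Δ, V, Q⟩).Red (mk ⟨.one (some r) ⟨o, .one⟩ :: K, Δ, insert r V,
      Reg.apply U.1 (fun _ => r) (Reg.addZero Q r)⟩) := by
  have hsync := QStruct.Step.syncOne U (fun _ => r) (fun _ => ⟨q, .one⟩) (fun _ => ⟨o, .one⟩) K Δ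
    (insert r V) (Reg.addZero Q r)
  simp only [List.ofFn_succ, List.ofFn_zero, List.singleton_append] at hsync
  exact (Red.of_step (.new _ r (.sync U _ :: K) Δ V Q hr)).trans
    (.trans (.of_eq (mk_perm (.swap _ _ _) _ _ _)) (.of_step hsync))

theorem Red.ite {u v : Tm G} {A : Ty} (hu : HasType Ctx.nil ∅ u A) (hv : HasType Ctx.nil ∅ v A)
    (hx : branch p x = none) (hK : ∀ e ∈ Link.edgesList K, branch p e.name = none)
    (hΔ : ∀ e ∈ Δ, branch p e.name = none) {V : Finset ℕ} {Q : Reg} (hQ : Q.IsState V)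
    {b : Bool} {U : QGate 1}
    (hU : ∀ r, Reg.apply U.1 (fun _ => r) (Reg.addZero Q r) = Reg.addBit b Q r) :
    (mk ⟨.cut ⟨0 :: p, .one⟩ ⟨1 :: p, .bot⟩ :: .box ⟨1 :: p, .bot⟩ [⟨x, A.toFormula⟩]
        (translate Env.nil (2 :: p) x u) (translate Env.nil (3 :: p) x v) ::
        (QSMLL.bitNet U (0 :: 0 :: p) (0 :: p) ++ K), Δ, V, Q⟩).Red
      (mk ⟨translate Env.nil p x (if b then v else u) ++ K, Δ, V, Q⟩) := by
  obtain ⟨r, hr⟩ := Infinite.exists_notMem_finset V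
  have hbit := Red.bitNet U (0 :: 0 :: p) (0 :: p) hr (.cut ⟨0 :: p, .one⟩ ⟨1 :: p, .bot⟩ ::
    .box ⟨1 :: p, .bot⟩ [⟨x, A.toFormula⟩] (translate Env.nil (2 :: p) x u)
      (translate Env.nil (3 :: p) x v) :: K) Δ Q
  have hbox := QStruct.Step.box r ⟨0 :: p, .one⟩ ⟨1 :: p, .bot⟩ [⟨x, A.toFormula⟩]
    (translate Env.nil (2 :: p) x u) (translate Env.nil (3 :: p) x v) K Δ (insert r V)
    (Reg.addBit b Q r)
  rw [measList_eq_singleton (Reg.prob_addBit hQ hr b), Reg.proj_addBit hQ hr,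
    Finset.erase_insert hr] at hbox
  rw [hU] at hbit
  have hbelow {c : ℕ} {z : List ℕ} (hz : branch p z = none) : branch (c :: p) z = none :=
    branch_cons_eq_none (by simp [hz])
  have hmove {w : Tm G} (c : ℕ) (h : HasType Ctx.nil ∅ w A) :=
    mk_relocate (p := c :: p) h V Q (hbelow hx) hx (fun e he => ⟨hbelow (hK e he), hK e he⟩)
      fun e he => ⟨hbelow (hΔ e he), hΔ e he⟩
  refine .trans (.of_eq (mk_perm ?_ _ _ _)) (hbit.trans (.trans (.of_eq
    (mk_perm (.swap _ _ _) _ _ _)) ((Red.of_step hbox).trans (.of_eq ?_))))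
  · exact List.perm_append_comm_assoc [_, _] [_, _] K
  · cases b
    exacts [hmove 2 hu, hmove 3 hv]

theorem mk_bitNet_rename (U : QGate 1) {q q' o : List ℕ} (hq : o ≠ q) (hq' : o ≠ q')
    (hK : ∀ e ∈ Link.edgesList K, e.name ≠ q ∧ e.name ≠ q') (hΔ : ∀ e ∈ Δ, e.name ≠ q ∧ e.name ≠ q')
    (V : Finset ℕ) (Q : Reg) :
    mk ⟨bitNet U q o ++ K, Δ, V, Q⟩ = mk ⟨bitNet U q' o ++ K, Δ, V, Q⟩ := by
  let f : Equiv.Perm Edge := Equiv.swap ⟨q, .one⟩ ⟨q', .one⟩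
  have hf (e : Edge) (he : e.name ≠ q ∧ e.name ≠ q') : f e = e :=
    Equiv.swap_apply_of_ne_of_ne (fun h => he.1 (by rw [h])) fun h => he.2 (by rw [h])
  have hfty (e : Edge) : (f e).ty = e.ty := by
    rw [Equiv.swap_apply_def]
    split_ifs with h h <;> simp [h]
  have hbit : Link.mapList f id (bitNet U q o) = bitNet U q' o := by
    simp [bitNet, Link.mapList, Link.map, hf ⟨o, .one⟩ ⟨hq, hq'⟩, f]
  have hiso := QStruct.Iso.edges (bitNet U q o ++ K) Δ V Q f hfty f.injective.injOn
  rw [mapList_append, hbit, Link.mapList_eq_self fun e he => hf e (hK e he),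
    (List.map_congr_left fun e he => hf e (hΔ e he)).trans (List.map_id' Δ)] at hiso
  exact Quot.sound hiso

theorem Red.app_meas (r : ℕ) (hx : branch p x = none)
    (hK : ∀ e ∈ Link.edgesList K, branch p e.name = none) (V : Finset ℕ) (Q : Reg) :
    (mk ⟨translate (G := G) Env.nil p x (.app .meas (.qvar r)) ++ K, Δ, V, Q⟩).Red
      (mk ⟨.one (some r) ⟨1 :: p, .one⟩ :: .cut ⟨1 :: p, .one⟩ ⟨0 :: 0 :: p, .bot⟩ ::
        .box ⟨0 :: 0 :: p, .bot⟩ [⟨x, .one⟩] (QSMLL.bitNet gateI (2 :: 0 :: p) x)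
          (QSMLL.bitNet gateX (3 :: 0 :: p) x) :: K, Δ, V, Q⟩) := by
  have htens := tensPar_symm
    (L := translate (G := G) Env.nil p x (.app .meas (.qvar r)) ++ K)
    (a := ⟨1 :: p, .one⟩) (b := ⟨2 :: p, .bot⟩) (c := ⟨3 :: p, .tens .one .bot⟩)
    (a' := ⟨0 :: 0 :: p, .bot⟩) (b' := ⟨1 :: 0 :: p, .one⟩) (c' := ⟨0 :: p, .par .bot .one⟩)
    (K := .ax ⟨2 :: p, .bot⟩ ⟨x, .one⟩ :: .box ⟨0 :: 0 :: p, .bot⟩ [⟨1 :: 0 :: p, .one⟩]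
      (QSMLL.bitNet gateI (2 :: 0 :: p) (1 :: 0 :: p))
      (QSMLL.bitNet gateX (3 :: 0 :: p) (1 :: 0 :: p)) :: .one (some r) ⟨1 :: p, .one⟩ :: K)
    (.cons _ (.cons _ (.swap _ _ _))) Δ V Q
  have hax := axCut_symm (L := .cut ⟨1 :: p, .one⟩ ⟨0 :: 0 :: p, .bot⟩ ::
      .cut ⟨2 :: p, .bot⟩ ⟨1 :: 0 :: p, .one⟩ :: .ax ⟨2 :: p, .bot⟩ ⟨x, .one⟩ ::
      .box ⟨0 :: 0 :: p, .bot⟩ [⟨1 :: 0 :: p, .one⟩]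
        (QSMLL.bitNet gateI (2 :: 0 :: p) (1 :: 0 :: p))
        (QSMLL.bitNet gateX (3 :: 0 :: p) (1 :: 0 :: p)) :: .one (some r) ⟨1 :: p, .one⟩ :: K)
    (a := ⟨1 :: 0 :: p, .one⟩) (b := ⟨2 :: p, .bot⟩) (c := ⟨x, .one⟩)
    ((List.Perm.swap _ _ _).trans (.cons _ (.swap _ _ _)))
    (by grind [branch_cons_cons_self]) Δ V Q
  have hK' : Link.mapList (Function.update id ⟨1 :: 0 :: p, .one⟩ ⟨x, .one⟩) id K = K :=
    Link.mapList_update_eq_self _ fun e he h => by simpa [h] using hK e he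
  have hne : 1 :: p ≠ 1 :: 0 :: p := fun h => by simpa using congrArg (branch p) h
  refine htens.trans (hax.trans (.of_eq (mk_perm ?_ _ _ _)))
  simp only [Link.mapList, Link.map, hK', QSMLL.bitNet, Function.update_apply, id_eq,
    List.map_cons, List.map_nil, Edge.mk.injEq, hne, List.cons.injEq, and_true,
    if_true, if_false, reduceCtorEq, zero_ne_one, OfNat.ofNat_ne_one, and_false]
  exact List.perm_append_comm_assoc [_, _] [_] K

theorem Reach.meas (r : ℕ) (hx : branch p x = none)
    (hK : ∀ e ∈ Link.edgesList K, branch p e.name = none)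
    (hΔ : ∀ e ∈ Δ, branch p e.name = none) (V : Finset ℕ) (Q : Reg) :
    (mk ⟨translate (G := G) Env.nil p x (.app .meas (.qvar r)) ++ K, Δ, V, Q⟩).Reach
      (measList (Reg.prob V Q r) fun b =>
        mk ⟨translate (G := G) Env.nil p x (if b then .ff else .tt) ++ K, Δ, V.erase r,
          Reg.proj V Q r b⟩) := by
  have hbox := QStruct.Step.box r ⟨1 :: p, .one⟩ ⟨0 :: 0 :: p, .bot⟩ [⟨x, .one⟩]
    (bitNet gateI (2 :: 0 :: p) x) (bitNet gateX (3 :: 0 :: p) x) K Δ V Q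
  have hstep : (mk _).Step _ := ⟨_, _, rfl, hbox, rfl⟩
  rw [mapList_measList] at hstep
  refine Reach.head ((Red.app_meas r hx hK V Q).trans (.of_eq (mk_perm (.swap _ _ _) _ _ _))) ?_
  convert Reach.of_step hstep using 3 with b
  have hne {z : List ℕ} (hz : branch p z = none) (c : ℕ) : z ≠ 0 :: p ∧ z ≠ c :: 0 :: p := by
    constructor <;> rintro rfl <;> simp at hz
  have hbit (U : QGate 1) (c : ℕ) := mk_bitNet_rename U (hne hx 0).1 (hne hx c).2
    (fun e he => hne (hK e he) c) (fun e he => hne (hΔ e he) c) (V.erase r) (Reg.proj V Q r b)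
  cases b
  exacts [hbit gateI 2, hbit gateX 3]

end QNet

/-! ## Unitary gates -/

/-- The edges at the leaves of the tree of `⊗` links that translates a tuple of `n + 1` quantum
variables, where `q` is the path of the tuple and `x` the name of the root. -/
def leaves : (n : ℕ) → List ℕ → List ℕ → Fin (n + 1) → Edge
  | 0, _, x => fun _ => ⟨x, .one⟩
  | n + 1, q, _ => Fin.cons ⟨0 :: q, .one⟩ (leaves n (1 :: q) (1 :: q))

/-- The `⊗` links of the translation of a tuple of `n + 1` quantum variables, where `q` is the path
of the tuple and `x` the name of the root. -/
def tensTree : ℕ → List ℕ → List ℕ → List Link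
  | 0, _, _ => []
  | n + 1, q, x => .tens ⟨0 :: q, .one⟩ ⟨1 :: q, (Ty.pow .qbit (n + 1)).toFormula⟩
      ⟨x, (Ty.pow .qbit (n + 2)).toFormula⟩ :: tensTree n (1 :: q) (1 :: q)

theorem leaves_name (n : ℕ) (q x : List ℕ) (i : Fin (n + 1)) :
    (leaves n q x i).name = x ∨ branch q (leaves n q x i).name ≠ none := by
  induction n generalizing q x with
  | zero => exact .inl rfl
  | succ n ih =>
    cases i using Fin.cases with
    | zero => simp [leaves]
    | succ i =>
      have := ih (1 :: q) (1 :: q) i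
      simp only [leaves, Fin.cons_succ]
      grind [branch_cons_self, branch_ne_none_of_cons]

theorem tensTree_edges_name {n : ℕ} {q x : List ℕ} {e : Edge}
    (he : e ∈ Link.edgesList (tensTree n q x)) : e.name = x ∨ branch q e.name ≠ none := by
  induction n generalizing q x with
  | zero => simp [tensTree, Link.edgesList] at he
  | succ n ih =>
    have := @ih (1 :: q) (1 :: q)
    grind [tensTree, Link.edgesList, Link.edges, branch_cons_self, branch_ne_none_of_cons]

theorem tyOf_tuple {G : GateSet} (τ : ℕ → Ty) (r : ℕ) (rs : List ℕ) :
    tyOf τ (Tm.tuple (G := G) (r :: rs)) = Ty.pow .qbit (rs.length + 1) := by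
  induction rs generalizing r with
  | nil => rfl
  | cons r' rs ih => simp [Tm.tuple, tyOf, Ty.pow, ih]

theorem translate_tuple {G : GateSet} {n : ℕ} (rs : Fin (n + 1) → ℕ) (q x : List ℕ) :
    (translate Env.nil q x (Tm.tuple (G := G) (List.ofFn rs))).Perm
      (List.ofFn (fun i => Link.one (some (rs i)) (leaves n q x i)) ++ tensTree n q x) := by
  induction n generalizing q x with
  | zero => simp [Tm.tuple, translate, tensTree, leaves]
  | succ n ih =>
    have hih := ih (fun i => rs i.succ) (1 :: q) (1 :: q)
    simp only [List.ofFn_succ, Tm.tuple, translate, tyOf_tuple, tyOf, List.length_ofFn, tensTree,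
      leaves, Ty.toFormula, Ty.pow, Fin.cons_zero, Fin.cons_succ] at hih ⊢
    exact (((hih.cons _).cons _).trans (.swap _ _ _)).trans (.cons _ List.perm_middle.symm)

namespace QNet.Red

variable {G : GateSet} {K : List Link} {Δ : List Edge}

theorem sync_tens {m : ℕ} (U : QGate m) {q x q' y : List ℕ} {io : List (Edge × Edge)}
    (hq : ∀ z, branch q z ≠ none → branch q' z = none) (hx : branch q' x = none)
    (hy : branch q' y = none)
    (hio : ∀ e ∈ io, branch q' e.1.name = none ∧ branch q' e.2.name = none)
    (hK : ∀ e ∈ Link.edgesList K, branch q' e.name = none)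
    (hΔ : ∀ e ∈ Δ, branch q' e.name = none) (A B : Formula) (V : Finset ℕ) (Q : Reg) :
    (mk ⟨.sync U (io ++ [(⟨x, .tens A B⟩, ⟨y, .tens A B⟩)]) ::
        .tens ⟨0 :: q, A⟩ ⟨1 :: q, B⟩ ⟨x, .tens A B⟩ :: K, Δ, V, Q⟩).Red
      (mk ⟨.sync U ((io ++ [(⟨0 :: q, A⟩, ⟨0 :: q', A⟩)]) ++ [(⟨1 :: q, B⟩, ⟨1 :: q', B⟩)]) ::
        .tens ⟨0 :: q', A⟩ ⟨1 :: q', B⟩ ⟨y, .tens A B⟩ :: K, Δ, V, Q⟩) := by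
  have hc (c : ℕ) : branch q' (c :: q) = none := hq _ (by simp)
  have hL : ∀ e ∈ Link.edgesList (.tens ⟨0 :: q, A⟩ ⟨1 :: q, B⟩ ⟨x, .tens A B⟩ ::
      .sync U (io ++ [(⟨x, .tens A B⟩, ⟨y, .tens A B⟩)]) :: K), branch q' e.name = none := by
    simp only [Link.edgesList, Link.edges, List.mem_append, List.mem_cons, List.mem_map,
      List.not_mem_nil, or_false]
    rintro e ((rfl | rfl | rfl) | (⟨a, ha | rfl, rfl⟩ | ⟨a, ha | rfl, rfl⟩) | he)
    exacts [hc 0, hc 1, hx, (hio a ha).1, hx, (hio a ha).2, hy, hK e he]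
  have hfresh (c : ℕ) (C : Formula) : FreshEdge ⟨c :: q', C⟩
      (.tens ⟨0 :: q, A⟩ ⟨1 :: q, B⟩ ⟨x, .tens A B⟩ ::
        .sync U (io ++ [(⟨x, .tens A B⟩, ⟨y, .tens A B⟩)]) :: K) Δ :=
    ⟨fun h => by simpa using hL _ h, fun h => by simpa using hΔ _ h⟩
  have hstep := QStruct.Step.syncTens ⟨0 :: q, A⟩ ⟨1 :: q, B⟩ _ _ ⟨0 :: q', A⟩ ⟨1 :: q', B⟩ _ Δ V Q
    U io [] rfl rfl (by simp) (hfresh _ _) (hfresh _ _)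
  rw [List.append_assoc]
  exact .trans (.of_eq (mk_perm (.swap _ _ _) _ _ _)) ((Red.of_step hstep).trans
    (.of_eq (mk_perm (.swap _ _ _) _ _ _)))

theorem sync_tensTree {m : ℕ} (U : QGate m) (n : ℕ) {q x q' y : List ℕ} {io : List (Edge × Edge)}
    (hq : ∀ z, branch q z ≠ none → branch q' z = none) (hx : branch q' x = none)
    (hy : branch q' y = none)
    (hio : ∀ e ∈ io, branch q' e.1.name = none ∧ branch q' e.2.name = none)
    (hK : ∀ e ∈ Link.edgesList K, branch q' e.name = none)
    (hΔ : ∀ e ∈ Δ, branch q' e.name = none) (V : Finset ℕ) (Q : Reg) :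
    (mk ⟨.sync U (io ++ [(⟨x, (Ty.pow .qbit (n + 1)).toFormula⟩,
        ⟨y, (Ty.pow .qbit (n + 1)).toFormula⟩)]) :: (tensTree n q x ++ K), Δ, V, Q⟩).Red
      (mk ⟨.sync U (io ++ List.ofFn fun i => (leaves n q x i, leaves n q' y i)) ::
        (tensTree n q' y ++ K), Δ, V, Q⟩) := by
  induction n generalizing q x q' y io K with
  | zero => exact .of_eq (by simp [leaves, tensTree, Ty.pow, Ty.toFormula])
  | succ n ih =>
    set F := (Ty.pow .qbit (n + 1)).toFormula
    have hbelow {z : List ℕ} (hz : branch q' z = none) : branch (1 :: q') z = none :=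
      branch_cons_eq_none (by simp [hz])
    have hc (c : ℕ) : branch q' (c :: q) = none := hq _ (by simp)
    have hroot := sync_tens U hq hx hy hio (K := tensTree n (1 :: q) (1 :: q) ++ K) (Δ := Δ)
      (by grind [Link.edgesList_append, tensTree_edges_name, branch_ne_none_of_cons]) hΔ .one F V Q
    have hsub := ih (q := 1 :: q) (x := 1 :: q) (q' := 1 :: q') (y := 1 :: q')
      (io := io ++ [(⟨0 :: q, .one⟩, ⟨0 :: q', .one⟩)])
      (K := .tens ⟨0 :: q', .one⟩ ⟨1 :: q', F⟩ ⟨y, .tens .one F⟩ :: K)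
      (fun z hz => hbelow (hq z (branch_ne_none_of_cons hz))) (hbelow (hc 1)) (branch_self _)
      (by grind [branch_cons_eq_none, branch_cons_self])
      (by grind [Link.edgesList, Link.edges, branch_cons_eq_none, branch_cons_self, branch_self])
      (fun e he => hbelow (hΔ e he))
    have hofFn : List.ofFn (fun i => (leaves (n + 1) q x i, leaves (n + 1) q' y i)) =
        (⟨0 :: q, .one⟩, ⟨0 :: q', .one⟩) ::
          List.ofFn fun i => (leaves n (1 :: q) (1 :: q) i, leaves n (1 :: q') (1 :: q') i) :=
      List.ofFn_succ
    rw [hofFn, List.append_cons io (⟨0 :: q, .one⟩, _)]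
    exact hroot.trans (.trans (.of_eq (mk_perm (.cons _ List.perm_middle.symm) _ _ _))
      (hsub.trans (.of_eq (mk_perm (.cons _ List.perm_middle) _ _ _))))

theorem sync_tuple {n : ℕ} (hn : 0 < n) (U : QGate n) (rs : Fin n → ℕ) {q x q' y : List ℕ}
    (hq : ∀ z, branch q z ≠ none → branch q' z = none) (hx : branch q' x = none)
    (hy : branch q' y = none) (hK : ∀ e ∈ Link.edgesList K, branch q' e.name = none)
    (hΔ : ∀ e ∈ Δ, branch q' e.name = none) (V : Finset ℕ) (Q : Reg) :
    (mk ⟨.sync U [(⟨x, (Ty.pow .qbit n).toFormula⟩, ⟨y, (Ty.pow .qbit n).toFormula⟩)] ::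
        (translate Env.nil q x (Tm.tuple (G := G) (List.ofFn rs)) ++ K), Δ, V, Q⟩).Red
      (mk ⟨translate Env.nil q' y (Tm.tuple (G := G) (List.ofFn rs)) ++ K, Δ, V,
        Reg.apply U.1 rs Q⟩) := by
  obtain ⟨m, rfl⟩ := Nat.exists_eq_add_of_le' hn
  have hleaves (i : Fin (m + 1)) : branch q' (leaves m q x i).name = none := by
    grind [leaves_name m q x i]
  have htree := sync_tensTree (Δ := Δ) U m (io := [])
    (K := List.ofFn (fun i => Link.one (some (rs i)) (leaves m q x i)) ++ K) hq hx hy (by simp)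
    (by
      intro e he
      rw [Link.edgesList_append, List.mem_append, Link.mem_edgesList] at he
      obtain ⟨_, hl, he⟩ | he := he
      · obtain ⟨i, rfl⟩ := List.mem_ofFn.1 hl
        rw [Link.edges, List.mem_singleton] at he
        exact he ▸ hleaves i
      · exact hK e he) hΔ V Q
  have hsync :=
    QStruct.Step.syncOne U rs (leaves m q x) (leaves m q' y) (tensTree m q' y ++ K) Δ V Q
  refine .trans (.of_eq (mk_perm ?_ _ _ _)) (htree.trans (.trans (.of_eq (mk_perm ?_ _ _ _))
    ((Red.of_step hsync).trans (.of_eq (mk_perm ?_ _ _ _)))))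
  · rw [List.nil_append, ← List.append_assoc]
    exact .cons _ (((translate_tuple rs q x).trans List.perm_append_comm).append_right K)
  · exact .cons _ (List.perm_append_comm_assoc _ _ _)
  · rw [← List.append_assoc]
    exact (translate_tuple rs q' y).symm.append_right K

end QNet.Red

section

variable {G : GateSet} {W : Finset ℕ} {t : Tm G} {B : Ty}

theorem HasType.gate_app_inv {a : G.Op} (h : HasType Ctx.nil W (.app (.gate a) t) B) :
    B = Ty.pow .qbit (G.arity a) ∧ ∃ V, HasType Ctx.nil V t B := by
  obtain ⟨_, _, A, rfl, -, ha, ht⟩ := h.app_inv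
  generalize hF : Ty.arr A B = F, hΓ : Ctx.nil = Γ at ha
  cases ha
  obtain ⟨rfl, rfl⟩ := Ty.arr.inj hF
  exact ⟨rfl, _, ht⟩

theorem HasType.meas_app_inv (h : HasType Ctx.nil W (.app .meas t) B) : B = .bool := by
  obtain ⟨_, _, _, rfl, -, hm, -⟩ := h.app_inv
  generalize hΓ : Ctx.nil = Γ at hm
  cases hm
  rfl

theorem QNet.Red.app_gate {p x : List ℕ} {a : G.Op}
    (ht : HasType Ctx.nil W t (Ty.pow .qbit (G.arity a))) (hx : branch p x = none) {K : List Link}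
    (hK : ∀ e ∈ Link.edgesList K, branch p e.name = none) (Δ : List Edge) (V : Finset ℕ) (Q : Reg) :
    (mk ⟨translate Env.nil p x (.app (.gate a) t) ++ K, Δ, V, Q⟩).Red
      (mk ⟨.sync (G.den a) [(⟨1 :: 0 :: p, (Ty.pow .qbit (G.arity a)).toFormula⟩,
          ⟨x, (Ty.pow .qbit (G.arity a)).toFormula⟩)] ::
        (translate Env.nil (1 :: p) (1 :: 0 :: p) t ++ K), Δ, V, Q⟩) := by
  set P := (Ty.pow .qbit (G.arity a)).toFormula with hP
  have htTy := ht.tyOf_eq (.nil Env.nil.tys)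
  have htens := tensPar_symm (L := translate Env.nil p x (.app (.gate a) t) ++ K)
    (a := ⟨1 :: p, P⟩) (b := ⟨2 :: p, P.neg⟩) (c := ⟨3 :: p, .tens P P.neg⟩)
    (a' := ⟨0 :: 0 :: p, P.neg⟩) (b' := ⟨2 :: 0 :: p, P⟩) (c' := ⟨0 :: p, .par P.neg P⟩)
    (K := .ax ⟨2 :: p, P.neg⟩ ⟨x, P⟩ :: .ax ⟨0 :: 0 :: p, P.neg⟩ ⟨1 :: 0 :: p, P⟩ ::
      .sync (G.den a) [(⟨1 :: 0 :: p, P⟩, ⟨2 :: 0 :: p, P⟩)] ::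
      (translate Env.nil (1 :: p) (1 :: p) t ++ K))
    (by
      rw [translate, htTy]
      simp only [translate, tyOf, ← hP]
      exact .cons _ (.cons _ (.swap _ _ _))) Δ V Q
  have hout := axCut_symm (L := .cut ⟨1 :: p, P⟩ ⟨0 :: 0 :: p, P.neg⟩ ::
      .cut ⟨2 :: p, P.neg⟩ ⟨2 :: 0 :: p, P⟩ ::
      .ax ⟨2 :: p, P.neg⟩ ⟨x, P⟩ :: .ax ⟨0 :: 0 :: p, P.neg⟩ ⟨1 :: 0 :: p, P⟩ ::
      .sync (G.den a) [(⟨1 :: 0 :: p, P⟩, ⟨2 :: 0 :: p, P⟩)] ::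
      (translate Env.nil (1 :: p) (1 :: p) t ++ K))
    (a := ⟨2 :: 0 :: p, P⟩) (b := ⟨2 :: p, P.neg⟩) (c := ⟨x, P⟩)
    ((List.Perm.swap _ _ _).trans (.cons _ (.swap _ _ _)))
    (by grind [branch_cons_cons_self]) Δ V Q
  have hin := axCut (L := .cut ⟨1 :: p, P⟩ ⟨0 :: 0 :: p, P.neg⟩ ::
      .ax ⟨0 :: 0 :: p, P.neg⟩ ⟨1 :: 0 :: p, P⟩ ::
      .sync (G.den a) [(⟨1 :: 0 :: p, P⟩, ⟨x, P⟩)] ::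
      (translate Env.nil (1 :: p) (1 :: p) t ++ K)) (.refl _)
    (by grind [branch_cons_self, branch_cons_cons_self]) Δ V Q
  have ht0 : ∀ e ∈ Link.edgesList (translate Env.nil (1 :: p) (1 :: p) t ++ K),
      e ≠ ⟨2 :: 0 :: p, P⟩ := by
    have := fun e => ht.branch_eq_some_of_mem (p := p) (d := 1) (e := e)
    grind [Link.edgesList_append, branch_cons_cons_self]
  have hne : 1 :: p ≠ 2 :: 0 :: p ∧ x ≠ 1 :: p ∧ 1 :: 0 :: p ≠ 1 :: p := by
    grind [branch_cons_self, branch_cons_cons_self]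
  have hren := ht.mapList_update_translate (1 :: 0 :: p) (.nil Env.nil (branch_self (1 :: p)))
  rw [← hP] at hren
  have hK1 : ∀ e ∈ Link.edgesList K, e ≠ ⟨1 :: p, P⟩ := by grind [branch_cons_self]
  simp only [Link.mapList, Link.map, Link.mapList_update_eq_self _ ht0, mapList_append, hren,
    Link.mapList_update_eq_self _ hK1, List.map_cons, List.map_nil, Function.update_apply,
    Edge.mk.injEq, List.cons.injEq, hne, id, and_true, false_and, if_true, if_false,
    OfNat.one_ne_ofNat, OfNat.zero_ne_ofNat] at hout hin
  exact htens.trans (hout.trans hin)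

theorem QNet.Red.gate {p x : List ℕ} {a : G.Op} {rs : Fin (G.arity a) → ℕ}
    (ht : HasType Ctx.nil W (Tm.tuple (G := G) (List.ofFn rs)) (Ty.pow .qbit (G.arity a)))
    (hx : branch p x = none) {K : List Link} {Δ : List Edge}
    (hK : ∀ e ∈ Link.edgesList K, branch p e.name = none) (hΔ : ∀ e ∈ Δ, branch p e.name = none)
    (V : Finset ℕ) (Q : Reg) :
    (mk ⟨translate Env.nil p x (.app (.gate a) (Tm.tuple (List.ofFn rs))) ++ K, Δ, V, Q⟩).Red
      (mk ⟨translate Env.nil p x (Tm.tuple (G := G) (List.ofFn rs)) ++ K, Δ, V,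
        Reg.apply (G.den a).1 rs Q⟩) := by
  have hbelow {z : List ℕ} (hz : branch p z = none) : branch (4 :: p) z = none :=
    branch_cons_eq_none (by simp [hz])
  have hsync := sync_tuple (G := G) (G.arity_pos a) (G.den a) rs (q := 1 :: p) (x := 1 :: 0 :: p)
    (q' := 4 :: p) (y := x)
    (fun z hz => branch_cons_eq_none (by simp [branch_of_branch_cons hz]))
    (branch_cons_eq_none (by simp)) (hbelow hx) (fun e he => hbelow (hK e he))
    (fun e he => hbelow (hΔ e he)) V Q
  exact (app_gate ht hx hK Δ V Q).trans (hsync.trans (.of_eq (mk_relocate ht V _ (hbelow hx) hx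
    (fun e he => ⟨hbelow (hK e he), hK e he⟩) fun e he => ⟨hbelow (hΔ e he), hΔ e he⟩)))

end

/-! ## Simulation -/

section

variable {G : GateSet} {W : Finset ℕ} {t u v : Tm G} {A B C : Ty}

theorem HasType.new_inv (h : HasType (G := G) Ctx.nil W .new B) : B = .qbit := by
  generalize hΓ : Ctx.nil = Γ at h
  cases h
  rfl

theorem HasType.subst_of_app_lam (h : HasType Ctx.nil W (.app (.lam A t) u) B) :
    ∃ W', HasType Ctx.nil W' (Tm.subst u 0 t) B := by
  obtain ⟨_, _, _, rfl, hV, ht, hu⟩ := h.app_inv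
  obtain ⟨_, hAB, ht⟩ := ht.lam_inv
  obtain ⟨rfl, rfl⟩ := Ty.arr.inj hAB
  exact ⟨_, ht.subst (k := 0) (fun _ h => Option.some.inj h ▸ hu) hV⟩

theorem HasType.subst_of_letp_pair (h : HasType Ctx.nil W (.letp (.pair t u) v) C) :
    ∃ W', HasType Ctx.nil W' (Tm.subst t 0 (Tm.subst u 0 v)) C := by
  obtain ⟨_, _, _, _, rfl, hV, htu, hv⟩ := h.letp_inv
  obtain ⟨_, _, _, _, rfl, hV', hAB, ht, hu⟩ := htu.pair_inv
  obtain ⟨rfl, rfl⟩ := Ty.tens.inj hAB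
  rw [Finset.disjoint_union_left] at hV
  exact ⟨_, (hv.subst (k := 0) (fun _ h => Option.some.inj h ▸ hu) hV.2.symm).subst (k := 0)
    (fun _ h => Option.some.inj h ▸ ht) (Finset.disjoint_union_left.2 ⟨hV.1.symm, hV'.symm⟩)⟩

theorem QNet.Reach.fill (E : EvalCtx G) (hE : HasType Ctx.nil W (E.fill t) A) {V : Finset ℕ}
    {Q : Reg} {l : List (ℝ≥0 × Raw G)}
    (hl : ∀ W' B, HasType Ctx.nil W' t B → ∀ d ∈ l, ∃ W'', HasType Ctx.nil W'' d.2.t B)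
    (h : ∀ W' B, HasType Ctx.nil W' t B → ∀ p x K, branch p x = none →
      (∀ e ∈ Link.edgesList K, branch p e.name = none) →
      (mk ⟨translate Env.nil p x t ++ K, [⟨[], A.toFormula⟩], V, Q⟩).Reach (mapList (fun d =>
        mk ⟨translate Env.nil p x d.t ++ K, [⟨[], A.toFormula⟩], d.V, d.Q⟩) l)) :
    (mk (Raw.toQStruct A ⟨V, Q, E.fill t⟩)).Reach
      (mapList (fun d => mk (Raw.toQStruct A ⟨d.V, d.Q, E.fill d.t⟩)) l) := by
  obtain ⟨W', B, ht⟩ := E.hasType_hole hE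
  obtain ⟨p, x, K, -, hx, hK, hfill⟩ := E.occurs_fill hE (branch_self [])
  have hmk (d : Raw G) (hd : tyOf Env.nil.tys d.t = tyOf Env.nil.tys t) :
      mk (Raw.toQStruct A ⟨d.V, d.Q, E.fill d.t⟩) =
        mk ⟨translate Env.nil p x d.t ++ K, [⟨[], A.toFormula⟩], d.V, d.Q⟩ :=
    mk_perm (hfill ⟨d.t, hd⟩) _ _ _
  rw [hmk ⟨V, Q, t⟩ rfl]
  convert h W' B ht p x K hx hK using 1
  refine List.map_congr_left fun d hd => ?_
  obtain ⟨W'', hd⟩ := hl W' B ht d hd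
  exact congrArg (Prod.mk d.1) (hmk d.2 ((hd.tyOf_eq (.nil _)).trans (ht.tyOf_eq (.nil _)).symm))

theorem QNet.Reach.fill_of_red (E : EvalCtx G) (hE : HasType Ctx.nil W (E.fill t) A)
    {V V' : Finset ℕ} {Q Q' : Reg}
    (hu : ∀ W' B, HasType Ctx.nil W' t B → ∃ W'', HasType Ctx.nil W'' u B)
    (h : ∀ W' B, HasType Ctx.nil W' t B → ∀ p x K, branch p x = none →
      (∀ e ∈ Link.edgesList K, branch p e.name = none) →
      (∀ e ∈ [(⟨[], A.toFormula⟩ : Edge)], branch p e.name = none) →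
      (mk ⟨translate Env.nil p x t ++ K, [⟨[], A.toFormula⟩], V, Q⟩).Red
        (mk ⟨translate Env.nil p x u ++ K, [⟨[], A.toFormula⟩], V', Q'⟩)) :
    (mk (Raw.toQStruct A ⟨V, Q, E.fill t⟩)).Reach
      [(1, mk (Raw.toQStruct A ⟨V', Q', E.fill u⟩))] :=
  Reach.fill E hE (l := [(1, ⟨V', Q', u⟩)])
    (fun W' B ht d hd => List.mem_singleton.1 hd ▸ hu W' B ht)
    fun W' B ht p x K hx hK => (h W' B ht p x K hx hK (by simp)).reach

theorem Raw.Step.reach {c : Raw G} {l : List (ℝ≥0 × Raw G)} (h : c.Step l) (hc : c.IsClosure A) :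
    (QNet.mk (c.toQStruct A)).Reach (mapList (fun d => QNet.mk (d.toQStruct A)) l) := by
  cases h with
  | beta V Q E =>
    exact QNet.Reach.fill_of_red E hc.2 (fun _ _ h => h.subst_of_app_lam)
      fun _ _ h _ _ _ hx hK hΔ => QNet.Red.beta h hx hK hΔ V Q
  | letp V Q E =>
    exact QNet.Reach.fill_of_red E hc.2 (fun _ _ h => h.subst_of_letp_pair)
      fun _ _ h _ _ _ hx hK hΔ => QNet.Red.letp h hx hK hΔ V Q
  | iteTT V Q E t u =>
    refine QNet.Reach.fill_of_red E hc.2 (fun _ _ h => ⟨∅, h.ite_inv.2.1⟩)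
      fun _ B h p x K hx hK hΔ => ?_
    rw [translate, h.ite_inv.2.1.tyOf_eq (.nil _)]
    exact QNet.Red.ite h.ite_inv.2.1 h.ite_inv.2.2 hx hK hΔ hc.1 (b := false)
      fun r => Reg.apply_gateI_addZero Q r
  | iteFF V Q E t u =>
    refine QNet.Reach.fill_of_red E hc.2 (fun _ _ h => ⟨∅, h.ite_inv.2.2⟩)
      fun _ B h p x K hx hK hΔ => ?_
    rw [translate, h.ite_inv.2.1.tyOf_eq (.nil _)]
    exact QNet.Red.ite h.ite_inv.2.1 h.ite_inv.2.2 hx hK hΔ hc.1 (b := true)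
      fun r => Reg.apply_gateX_addZero Q r
  | new V Q E r hr =>
    exact QNet.Reach.fill_of_red E hc.2 (fun _ _ h => ⟨{r}, h.new_inv ▸ .qvar r⟩)
      fun _ _ _ _ _ K _ _ _ => QNet.Red.of_step (.new _ r K _ V Q hr)
  | gate V Q E a rs =>
    exact QNet.Reach.fill_of_red E hc.2 (fun _ _ h => h.gate_app_inv.2)
      fun _ _ h _ _ _ hx hK hΔ =>
        have ⟨hB, _, ht⟩ := h.gate_app_inv
        QNet.Red.gate (hB ▸ ht) hx hK hΔ V Q
  | meas V Q E r =>
    have hfill := QNet.Reach.fill E hc.2 (V := V) (Q := Q)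
      (l := measList (Reg.prob V Q r) fun b =>
        ⟨V.erase r, Reg.proj V Q r b, if b then .ff else .tt⟩)
      (fun _ _ h => ?_) fun _ _ _ p x K hx hK => ?_
    · rw [mapList_measList] at hfill ⊢
      exact hfill
    · rw [h.meas_app_inv]
      exact forall_mem_measList fun b => ⟨∅, by cases b <;> constructor⟩
    · rw [mapList_measList]
      exact QNet.Reach.meas r hx hK (by simp) V Q

theorem Closure.Step.reach {C : Closure G A} {l : List (ℝ≥0 × Closure G A)} (h : C.Step l) :
    C.toNet.Reach (mapList Closure.toNet l) := by
  obtain ⟨c, m, rfl, hs, rfl⟩ := h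
  have hreach := hs.reach c.2
  simp only [mapList, List.map_map] at hreach ⊢
  exact hreach

theorem Closure.Reduces.toNet {C : Closure G A} {𝒟 : Closure G A →₀ ℝ≥0} (h : C.Reduces 𝒟) :
    C.toNet.Reduces (Finsupp.mapDomain Closure.toNet 𝒟) := by
  induction h with
  | refl C =>
    rw [Finsupp.mapDomain_single]
    exact .refl _
  | step C l E hl _ ih =>
    have hlen : (mapList Closure.toNet l).length = l.length := List.length_map _
    have hget (i : Fin (mapList Closure.toNet l).length) : (mapList Closure.toNet l).get i =
        ((l.get (i.cast hlen)).1, (l.get (i.cast hlen)).2.toNet) := List.getElem_map _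
    have hreach := Closure.Step.reach hl
      (fun i => Finsupp.mapDomain Closure.toNet (E (i.cast hlen))) fun i => by
        rw [hget]
        exact ih (i.cast hlen)
    rw [Finsupp.mapDomain_finsetSum, ← (finCongr hlen).sum_comp]
    simp only [Finsupp.mapDomain_smul]
    convert hreach using 1
    exact Finset.sum_congr rfl fun i _ => by rw [hget]; rfl

end

end QSMLL

end

theorem mainTheorem8 (G : QSMLL.GateSet) (A : QSMLL.Ty) :
    (∀ C : QSMLL.Closure G A, C.toNet.IsNet) ∧
    ∀ (C : QSMLL.Closure G A) (𝒟 : QSMLL.Closure G A →₀ ℝ≥0),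
      C.Reduces 𝒟 → C.toNet.Reduces (Finsupp.mapDomain QSMLL.Closure.toNet 𝒟) :=
  ⟨QSMLL.Closure.isNet, fun _ _ h => h.toNet⟩
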